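/- Let $\beta>2$, $\tau>0$, $\phi>0$. Let $\boldsymbol Y=((Y_i,\rho_i))_{i\in\mathbb N}$ be a homogeneous Poisson point process on $\mathbb R^2$ with intensity one and i.i.d. marks $\rho_i$ that are Pareto distributed with tail index $\beta$, i.e. $\mathbb P(\rho_i>s)=(\tau/s)^{\beta}$ for $s\ge\tau$. Put $$\ell_x=\phi\sum_{i}\mathbf 1\{|Y_i-x|<\rho_i\},\qquad \Lambda(\mathrm dx)=\ell_x\,\mathrm dx ,$$ where $\phi$ is such that $\mathbb E[\ell_o]=1$. For $\lambda>0$ let $\mathscr V$ be an independently and uniformly marked Cox process: given $\Lambda$, $\mathscr V$ is a Poisson point process on $\mathbb R^2\times(0,1)$ with intensity measure $\lambda\,\Lambda(\mathrm dx)\,\mathrm du$. Let $\mathbf p:(\mathbb R^2\times(0,1))^2\to[0,1]$ be measurable, symmetric, translation invariant in the locations, and integrable in the sense that $$\int_0^1\mathrm du_o\int_{\mathbb R^2}\mathrm dx\int_0^1\mathrm du_x\ \mathbf p((o,u_o),(x,u_x))<\infty .$$ Given $\mathscr V$, connect each pair of distinct vertices $\boldsymbol x,\boldsymbol y\in\mathscr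 V$ by an edge with probability $\mathbf p(\boldsymbol x,\boldsymbol y)$, independently over the pairs. Let $\mathscr G$ be the resulting graph and $\mathbb P_\lambda$ the underlying probability measure. Then the following holds. 1. For every $\lambda>0$, the vertex locations form a locally finite, simple and stationary point process on $\mathbb R^2$ of intensity $\lambda$ (G1). 2. For every $\lambda>0$ and $z\in\mathbb R^2$, the graphs $\mathscr G$ and $\mathscr G+z$ (all vertex locations shifted by $z$) have the same distribution (G2). 3. For every $\lambda>0$, almost surely all vertices have finite degree. If moreover, for all fixed marks, $\mathbf p((x,u),(y,v))$ is non-increasing in the distance $|x-y|>0$, then the conditional probability, given $\mathscr V$, that two given vertices are connected by an edge is a function of their marks and their distance that is non-increasing in the distance (G3). 4. $\mathscr G$ is monotone: for all $0<\lambda<\lambda'$ and every event $\mathcal E$ of graphs that is increasing (i.e. stable under enlarging the vertex set and the edge set), $\mathbb P_\lambda(\mathcal E)\le\mathbb P_{\lambda'}(\mathcal E)$. 5. For every $\lambda>0$, $\mathscr G$ is polynomially mixing with exponent $\xi=2-\beta<0$: for every $x\in\mathbb R^2$ with $|x|\ge10$, $$\limsup_{r\to\infty}\frac{\log\big|\operatorname{Cov}_\lambda\big(\mathbf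 1_{\mathcal G(o,r)},\mathbf 1_{\mathcal G(rx,r)}\big)\big|}{\log r}\le 2-\beta\qquad(\log 0:=-\infty),$$ where $\mathcal G(y,r)$ is the event that some vertex in $B(y,r)$ is connected to some vertex outside $B(y,2r)$ by a path in the subgraph of $\mathscr G$ induced by the vertices in $B(y,3r)$, and $B(y,s)$ denotes the open Euclidean ball. -/

import Mathlib

open MeasureTheory ProbabilityTheory Filter Topology
open scoped ENNReal NNReal

noncomputable section

namespace CoxPercolation

/-! ### Vertices and geometric graphs -/

/-- The Euclidean plane. -/
abbrev Plane : Type := EuclideanSpace ℝ (Fin 2)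

/-- Vertex marks are elements of the open unit interval `(0,1)`. -/
abbrev Mark : Type := Set.Ioo (0 : ℝ) 1

/-- A (potential) vertex: a location in the plane together with a mark. -/
abbrev Vertex : Type := Plane × Mark

/-- The uniform distribution on `(0,1)`. -/
def uniformMark : Measure Mark := (volume : Measure ℝ).comap Subtype.val

/-- A realisation of the geometric graph: a set of marked vertices `verts` together with a symmetric,
irreflexive adjacency relation `Adj` on it.  The order `≤` on such graphs is inclusion of
both the vertex set and the edge set. -/
abbrev GeometricGraph : Type := (⊤ : SimpleGraph Vertex).Subgraph

/-- The sigma-algebra on geometric graphs generated by the numbers of vertices in measurable sets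
and the numbers of (ordered) edges between measurable sets. -/
instance GeometricGraph.measurableSpace : MeasurableSpace GeometricGraph :=
  (⨆ A : {A : Set Vertex // MeasurableSet A},
      MeasurableSpace.comap (fun G : GeometricGraph => (G.verts ∩ A.1).encard) ⊤) ⊔
  (⨆ A : {A : Set Vertex // MeasurableSet A}, ⨆ B : {B : Set Vertex // MeasurableSet B},
      MeasurableSpace.comap (fun G : GeometricGraph =>
        {e : Vertex × Vertex | e.1 ∈ A.1 ∧ e.2 ∈ B.1 ∧ G.Adj e.1 e.2}.encard) ⊤)

/-- Shift the location of a vertex by `z`, keeping its mark. -/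
def shift (z : Plane) (a : Vertex) : Vertex := (a.1 + z, a.2)

theorem shift_neg_injective (z : Plane) : Function.Injective (shift (-z)) := by
  rintro ⟨a, u⟩ ⟨b, v⟩ h
  simpa [shift] using h

/-- The graph `G + z`: the location of every vertex is shifted by `z`. -/
def GeometricGraph.translate (z : Plane) (G : GeometricGraph) : GeometricGraph where
  verts := {a | shift (-z) a ∈ G.verts}
  Adj a b := G.Adj (shift (-z) a) (shift (-z) b)
  adj_sub h := by
    have := G.adj_sub h
    simp only [SimpleGraph.top_adj, ne_eq] at this ⊢
    exact fun hab => this (by rw [hab])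
  edge_vert h := G.edge_vert h
  symm := ⟨fun _ _ h => G.symm.symm _ _ h⟩

/-- The subgraph `G ∩ D` induced by the vertices located in `D`. -/
def GeometricGraph.restrict (G : GeometricGraph) (D : Set Plane) : GeometricGraph :=
  G.induce {a | a ∈ G.verts ∧ a.1 ∈ D}

/-- The local annulus-crossing event: some vertex located in `B(x,r)` and some vertex located
outside `B(x,2r)` are connected by a path in the subgraph `G ∩ B(x,3r)`. -/
def GeometricGraph.LocalCrossing (G : GeometricGraph) (x : Plane) (r : ℝ) : Prop :=
  ∃ a ∈ (G.restrict (Metric.ball x (3 * r))).verts,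
    ∃ b ∈ (G.restrict (Metric.ball x (3 * r))).verts,
      a.1 ∈ Metric.ball x r ∧ b.1 ∉ Metric.ball x (2 * r) ∧
        (G.restrict (Metric.ball x (3 * r))).spanningCoe.Reachable a b

/-- The geometric graph on the points `x 0, x 1, …` in which `x i` and `x j` are adjacent when
`i` and `j` are adjacent in `g`. -/
def embed (x : ℕ → Vertex) (g : SimpleGraph ℕ) : GeometricGraph where
  verts := Set.range x
  Adj a b := a ≠ b ∧ ∃ i j, x i = a ∧ x j = b ∧ g.Adj i j
  adj_sub h := by simpa using h.1
  edge_vert := by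
    rintro a b ⟨-, i, j, hi, -⟩
    exact ⟨i, hi⟩
  symm := ⟨by
    rintro a b ⟨hab, i, j, hi, hj, hg⟩
    exact ⟨hab.symm, j, i, hj, hi, hg.symm⟩⟩

/-! ### Point processes -/

/-- The point measure `∑ δ_{x i}` of a sequence of points. -/
def pointMeasure {S : Type*} [MeasurableSpace S] (x : ℕ → S) : Measure S :=
  Measure.sum fun i => Measure.dirac (x i)

/-- `η` is a Cox process directed by the random measure `M`: conditionally on (the sigma-algebra
generated by) `M`, the numbers of points in finitely many pairwise disjoint sets of finite mass are
independent, and the number of points in `A` is Poisson distributed with parameter `M A`.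
The space of measures carries the sigma-algebra generated by the evaluations. -/
def IsCoxProcess {Ω S : Type*} [MeasurableSpace Ω] [MeasurableSpace S] (P : Measure Ω)
    (M : Ω → Measure S) (η : Ω → Measure S) : Prop :=
  ∀ (k : ℕ) (A : Fin k → Set S), (∀ j, MeasurableSet (A j)) →
    Pairwise (fun i j => Disjoint (A i) (A j)) → (∀ j, ∀ᵐ ω ∂P, M ω (A j) < ∞) →
    ∀ (n : Fin k → ℕ) (F : Set Ω), MeasurableSet[MeasurableSpace.comap M inferInstance] F →
      P (F ∩ {ω | ∀ j, η ω (A j) = n j}) =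
        ∫⁻ ω in F, ∏ j, poissonMeasure (M ω (A j)).toNNReal {n j} ∂P

/-- A Poisson process with intensity measure `ν`: a Cox process with deterministic directing
measure `ν`. -/
def IsPoissonProcess {Ω S : Type*} [MeasurableSpace Ω] [MeasurableSpace S] (P : Measure Ω)
    (ν : Measure S) (η : Ω → Measure S) : Prop :=
  IsCoxProcess P (fun _ => ν) η

/-! ### The random environment -/

/-- The density `ℓ_x = φ ∑ᵢ 1{|Yᵢ - x| < ρᵢ}`, for the centres and radii `y i = (Yᵢ, ρᵢ)`. -/
def density (φ : ℝ) (y : ℕ → Plane × ℝ) (x : Plane) : ℝ≥0∞ :=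
  ENNReal.ofReal φ * ∑' i, {z : Plane | dist (y i).1 z < (y i).2}.indicator 1 x

/-- The directing measure `Λ(dx) = ℓ_x dx`. -/
def directingMeasure (φ : ℝ) (y : ℕ → Plane × ℝ) : Measure Plane :=
  volume.withDensity (density φ y)

/-! ### The model -/

/-- An integrable, translation-invariant edge-drawing mechanism: `p a b` is the probability that
the vertices `a` and `b` are joined by an edge. -/
structure IsConnectionFunction (p : Vertex → Vertex → ℝ) : Prop where
  measurable : Measurable fun e : Vertex × Vertex => p e.1 e.2
  nonneg : ∀ a b, 0 ≤ p a b
  le_one : ∀ a b, p a b ≤ 1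
  symm : ∀ a b, p a b = p b a
  translation_invariant : ∀ (z : Plane) (a b : Vertex), p (shift z a) (shift z b) = p a b
  integrable : ∫⁻ u, ∫⁻ x : Plane, ∫⁻ v, ENNReal.ofReal (p (0, u) (x, v)) ∂uniformMark
    ∂volume ∂uniformMark < ∞

/-- For fixed marks, the connection probability `p` is non-increasing in the distance of the
two locations. -/
def NonincreasingInDistance (p : Vertex → Vertex → ℝ) : Prop :=
  ∀ (u v : Mark) (x y x' y' : Plane), x ≠ y → dist x y ≤ dist x' y' →
    p (x', u) (y', v) ≤ p (x, u) (y, v)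

/-- A realisation of the model with vertex intensity `lam` on the probability space `(Ω, P)`.
* `Y i ω` are the centres and radii of the Boolean model that defines the environment; they form
  a Poisson process of unit intensity with independent Pareto marks (`P(ρ > s) = (τ / s) ^ β` for
  `s ≥ τ`), that is, a Poisson process on the product space.
* `X i ω` are the vertices: conditionally on the environment `Λ` they form a
  Poisson process of intensity `lam • Λ` with independent uniform marks.
* `g ω` is the graph on the labels: given the vertices, the edges are drawn independently, and `i`
  and `j` are joined with probability `p (X i) (X j)`. -/
structure IsCoxModel {Ω : Type*} [MeasurableSpace Ω] (P : Measure Ω) (β τ φ : ℝ)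
    (p : Vertex → Vertex → ℝ) (lam : ℝ) (Y : ℕ → Ω → Plane × ℝ) (X : ℕ → Ω → Vertex)
    (g : Ω → SimpleGraph ℕ) : Prop where
  measurable_Y : ∀ i, Measurable (Y i)
  measurable_X : ∀ i, Measurable (X i)
  measurable_g : ∀ i j, MeasurableSet {ω | (g ω).Adj i j}
  poisson_Y : IsPoissonProcess P ((volume : Measure Plane).prod (paretoMeasure τ β))
    (fun ω => pointMeasure fun i => Y i ω)
  /-- The normalisation `E[ℓ_o] = 1`. -/
  normalised : ∫⁻ ω, density φ (fun i => Y i ω) 0 ∂P = 1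
  cox_X : IsCoxProcess P
    (fun ω => ENNReal.ofReal lam • (directingMeasure φ fun i => Y i ω).prod uniformMark)
    (fun ω => pointMeasure fun i => X i ω)
  edges : ∀ s : Finset (ℕ × ℕ), (∀ e ∈ s, e.1 < e.2) →
    ∀ F : Set Ω, MeasurableSet[MeasurableSpace.comap (fun ω i => X i ω) inferInstance] F →
      P (F ∩ {ω | ∀ e ∈ s, (g ω).Adj e.1 e.2}) =
        ∫⁻ ω in F, ∏ e ∈ s, ENNReal.ofReal (p (X e.1 ω) (X e.2 ω)) ∂P

/-! ### Properties of random geometric graphs -/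

/-- Locally finite, simple, stationary point process in the plane with intensity `lam`. -/
structure IsStationarySimple {Ω : Type*} [MeasurableSpace Ω] (P : Measure Ω) (lam : ℝ)
    (η : Ω → Measure Plane) : Prop where
  locally_finite : ∀ᵐ ω ∂P, ∀ R : ℝ, η ω (Metric.ball 0 R) < ∞
  simple : ∀ᵐ ω ∂P, ∀ z : Plane, η ω {z} ≤ 1
  stationary : ∀ z : Plane, IdentDistrib (fun ω => (η ω).map (· + z)) η P P
  intensity : ∀ A : Set Plane, MeasurableSet A →
    ∫⁻ ω, η ω A ∂P = ENNReal.ofReal lam * volume A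

/-- `G` and `G + z` have the same distribution, for every `z`. -/
def IsTranslationInvariant {Ω : Type*} [MeasurableSpace Ω] (P : Measure Ω)
    (G : Ω → GeometricGraph) : Prop :=
  ∀ z : Plane, IdentDistrib (fun ω => (G ω).translate z) G P P

/-- Almost surely, all vertices have finite degree. -/
def IsLocallyFinite {Ω : Type*} [MeasurableSpace Ω] (P : Measure Ω)
    (G : Ω → GeometricGraph) : Prop :=
  ∀ᵐ ω ∂P, ∀ a ∈ (G ω).verts, ((G ω).neighborSet a).Finite

/-- The conditional probability, given the vertices, that two given vertices are connected by an
edge is a function of their marks and their distance which is non-increasing in the distance. -/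
def ConnectionDecreasesInDistance {Ω : Type*} [MeasurableSpace Ω] (P : Measure Ω)
    (X : ℕ → Ω → Vertex) (g : Ω → SimpleGraph ℕ) : Prop :=
  ∃ κ : Mark → Mark → ℝ → ℝ, (∀ u v, AntitoneOn (κ u v) (Set.Ioi 0)) ∧
    ∀ i j, i ≠ j →
      P[{ω | (g ω).Adj i j}.indicator (fun _ => (1 : ℝ)) |
          MeasurableSpace.comap (fun ω k => X k ω) inferInstance]
        =ᵐ[P] fun ω => κ (X i ω).2 (X j ω).2 (dist (X i ω).1 (X j ω).1)

/-- Monotonicity in the intensity: the probability of every increasing event of graphs is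
non-decreasing in `lam > 0`. -/
def IsMonotoneFamily {Ω : ℝ → Type*} [∀ l, MeasurableSpace (Ω l)] (P : ∀ l, Measure (Ω l))
    (G : ∀ l, Ω l → GeometricGraph) : Prop :=
  ∀ l l' : ℝ, 0 < l → l < l' → ∀ E : Set GeometricGraph, MeasurableSet E → IsUpperSet E →
    P l {ω | G l ω ∈ E} ≤ P l' {ω | G l' ω ∈ E}

/-- The covariance of the indicators of the local annulus-crossing events at the
origin and at `r • x`, on scale `r`. -/
def crossingCov {Ω : Type*} [MeasurableSpace Ω] (P : Measure Ω)
    (G : Ω → GeometricGraph) (x : Plane) (r : ℝ) : ℝ :=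
  cov[{ω | (G ω).LocalCrossing 0 r}.indicator (fun _ => (1 : ℝ)),
    {ω | (G ω).LocalCrossing (r • x) r}.indicator (fun _ => (1 : ℝ)); P]

/-- Polynomial mixing with exponent `ξ < 0`.  The logarithm takes values in the extended reals and
`log 0 = -∞`. -/
def IsPolynomiallyMixing {Ω : Type*} [MeasurableSpace Ω] (P : Measure Ω)
    (G : Ω → GeometricGraph) (ξ : ℝ) : Prop :=
  ξ < 0 ∧ ∀ x : Plane, 10 ≤ ‖x‖ →
    limsup (fun r : ℝ => ENNReal.log (ENNReal.ofReal |crossingCov P G x r|) /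
      ((Real.log r : ℝ) : EReal)) atTop ≤ (ξ : EReal)

end CoxPercolation

end

noncomputable section

namespace CoxPercolation

/-! ### Sums against the Poisson distribution -/

/-! Everything rests on two kinds of information about the point processes: their first two moments
and their void probabilities.

Moments. Poisson moments, averaged over the directing measure, show that the vertices have mean
measure `lam • vertexVolume` and a second factorial moment measure with density at most `lam ^ 2 *
(1 + φ)` (`lintegral_factorialMeasure_le`); the bound `1 + φ` is the second moment of the Poisson
balls after normalisation. The mean gives local finiteness. Absolute continuity of the second moment
gives simplicity. The bound gives a finite mean number of edges starting in a bounded region, hence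
finite degrees.

Void probabilities. A locally finite simple configuration is determined by recording which sets of a
countable family of bounded open sets it misses. By the Lusin–Souslin theory, every measurable
function of the configuration is then a measurable function of this void pattern
(`exists_eq_comp_voidPattern`), so void probabilities determine laws (`lintegral_eq_of_void`). For
the vertices they are means of `exp (-c * ∑ coverMass)` over the Poisson balls, which shifts do not
change; this yields stationarity. The edges are realised by independent uniform labels on unordered
pairs, and the conditional probability `edgeProb` of a graph event given the vertices depends on the
vertex set alone. Hence the laws of the graphs reduce to the laws of the vertex sets.

Monotonicity. Retaining each vertex of the denser process independently with probability `lam /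
lam'` multiplies the intensity by this factor, so the retained vertices have the void probabilities
of the sparser process. The graph on them is, after relabelling the uniforms, a subgraph of the
denser graph.

Mixing. Given the environment, what happens in two disjoint windows is independent and depends only
on the environment there (`exists_kernels`). The environment in a window is generated by the Boolean
balls that meet it. Unless some ball meets both windows, the two conditional probabilities are
therefore functions of disjoint parts of a Poisson process, which are independent. The covariance is
thus at most three times the probability of a common ball (`abs_measure_inter_sub_le`). For windows
of radius `3 * r` at distance at least `10 * r`, such a ball has radius `s > 2 * r` and a centre in
a disc of area of order `s ^ 2`, so the mean number of such balls is of order `∫ s ^ (1 - β)` over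
`s > 2 * r`, that is, `r ^ (2 - β)`. -/

theorem poissonMeasure_succ (r : ℝ≥0) (n : ℕ) :
    ((n : ℝ≥0∞) + 1) * poissonMeasure r {n + 1} = r * poissonMeasure r {n} := by
  rw [poissonMeasure_singleton, poissonMeasure_singleton]
  have h1 : ((n : ℝ≥0∞) + 1) = ENNReal.ofReal (n + 1) := by
    rw [ENNReal.ofReal_add (by positivity) zero_le_one]; simp
  have h2 : (r : ℝ≥0∞) = ENNReal.ofReal r := by simp
  rw [h1, h2, ← ENNReal.ofReal_mul (by positivity), ← ENNReal.ofReal_mul (by positivity)]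
  congr 1
  rw [Nat.factorial_succ]
  push_cast
  field_simp
  ring

theorem tsum_poissonMeasure (r : ℝ≥0) : ∑' n, poissonMeasure r {n} = 1 := by
  have h : poissonMeasure r (⋃ n : ℕ, {n}) = ∑' n, poissonMeasure r {n} :=
    measure_iUnion (fun i j hij => by simpa using hij) fun n => measurableSet_singleton n
  rw [← h, Set.iUnion_of_singleton, measure_univ]

/-- Size-biasing a Poisson variable adds one point. Taking `f = 1` and `f n = n` yields the first
two moments. -/
theorem tsum_mul_poissonMeasure (r : ℝ≥0) (f : ℕ → ℝ≥0∞) :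
    ∑' n : ℕ, (n : ℝ≥0∞) * f n * poissonMeasure r {n} =
      r * ∑' n, f (n + 1) * poissonMeasure r {n} := by
  rw [tsum_eq_zero_add' ENNReal.summable, ← ENNReal.tsum_mul_left]
  simp only [Nat.cast_zero, zero_mul, zero_add]
  refine tsum_congr fun n => ?_
  have := poissonMeasure_succ r n
  push_cast
  calc ((n : ℝ≥0∞) + 1) * f (n + 1) * poissonMeasure r {n + 1}
      = f (n + 1) * (((n : ℝ≥0∞) + 1) * poissonMeasure r {n + 1}) := by ring
    _ = _ := by rw [this]; ring

theorem tsum_nat_mul_poissonMeasure (r : ℝ≥0) :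
    ∑' n : ℕ, (n : ℝ≥0∞) * poissonMeasure r {n} = r := by
  simpa [tsum_poissonMeasure] using tsum_mul_poissonMeasure r (fun _ => 1)

theorem tsum_nat_mul_nat_mul_poissonMeasure (r : ℝ≥0) :
    ∑' n : ℕ, (n : ℝ≥0∞) * n * poissonMeasure r {n} = r * r + r := by
  have h := tsum_mul_poissonMeasure r (fun n => n)
  rw [h]
  have : ∀ n : ℕ, ((n + 1 : ℕ) : ℝ≥0∞) * poissonMeasure r {n} =
      n * poissonMeasure r {n} + poissonMeasure r {n} := fun n => by push_cast; ring
  simp_rw [this]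
  rw [ENNReal.tsum_add, tsum_nat_mul_poissonMeasure, tsum_poissonMeasure]
  ring

/-- The void probability `exp (-a)` of a Poisson process. -/
def expNeg (a : ℝ≥0∞) : ℝ≥0∞ := ENNReal.ofReal (Real.exp (-a.toReal))

theorem measurable_expNeg : Measurable expNeg := by
  unfold expNeg; fun_prop

theorem poissonMeasure_zero (a : ℝ≥0∞) : poissonMeasure a.toNNReal {0} = expNeg a := by
  simp [poissonMeasure_singleton, expNeg, ENNReal.coe_toNNReal_eq_toReal]

/-- The generating function at `1 - q`: the probability that none of a Poisson number of points
survives independent thinning with retention probability `q`. For `a = ∞` both sides equal one, by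
the conventions of `toNNReal` and `toReal`. -/
theorem tsum_pow_mul_poissonMeasure (a : ℝ≥0∞) (q : ℝ≥0) (hq : q ≤ 1) :
    ∑' n : ℕ, ((1 - q : ℝ≥0) : ℝ≥0∞) ^ n * poissonMeasure a.toNNReal {n} = expNeg (q * a) := by
  set r := a.toNNReal with hr
  set t : ℝ≥0 := 1 - q with ht
  have htq : (t : ℝ) = 1 - q := by rw [ht, NNReal.coe_sub hq]; simp
  have h : ∀ n : ℕ, (t : ℝ≥0∞) ^ n * poissonMeasure r {n} =
      ENNReal.ofReal (Real.exp (-(q * r : ℝ))) * poissonMeasure (t * r) {n} := by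
    intro n
    rw [poissonMeasure_singleton, poissonMeasure_singleton]
    have h2 : (t : ℝ≥0∞) = ENNReal.ofReal t := by simp
    rw [h2, ← ENNReal.ofReal_pow (by positivity), ← ENNReal.ofReal_mul (by positivity),
      ← ENNReal.ofReal_mul (by positivity)]
    congr 1
    have : Real.exp (-(r : ℝ)) = Real.exp (-(q * r : ℝ)) * Real.exp (-(t * r : ℝ)) := by
      rw [← Real.exp_add]; congr 1; rw [htq]; ring
    push_cast
    rw [this, mul_pow]
    ring
  simp_rw [h]
  rw [ENNReal.tsum_mul_left, tsum_poissonMeasure, mul_one, expNeg, ENNReal.toReal_mul]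
  simp [hr, ENNReal.coe_toNNReal_eq_toReal]

/-! ### Point measures -/

section PointMeasure

variable {S : Type*} [MeasurableSpace S]

theorem pointMeasure_apply (x : ℕ → S) {A : Set S} (hA : MeasurableSet A) :
    pointMeasure x A = ∑' i, A.indicator 1 (x i) := by
  rw [pointMeasure, Measure.sum_apply _ hA]
  exact tsum_congr fun i => Measure.dirac_apply' _ hA

theorem pointMeasure_eq_zero_iff (x : ℕ → S) {A : Set S} (hA : MeasurableSet A) :
    pointMeasure x A = 0 ↔ ∀ i, x i ∉ A := by
  rw [pointMeasure_apply x hA, ENNReal.tsum_eq_zero]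
  simp

theorem measurable_pointMeasure {Ω : Type*} [MeasurableSpace Ω] {X : ℕ → Ω → S}
    (hX : ∀ i, Measurable (X i)) : Measurable fun ω => pointMeasure fun i => X i ω := by
  refine Measure.measurable_of_measurable_coe _ fun A hA => ?_
  simp_rw [pointMeasure_apply _ hA]
  exact Measurable.tsum fun i => (measurable_one.indicator hA).comp (hX i)

end PointMeasure

/-! ### Moments of Cox processes -/

section Cox

variable {Ω S : Type*} [MeasurableSpace Ω] [MeasurableSpace S] {P : Measure Ω}
  {M : Ω → Measure S} {η : Ω → Measure S}

theorem IsCoxProcess.measure_pair (h : IsCoxProcess P M η) {A B : Set S}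
    (hA : MeasurableSet A) (hB : MeasurableSet B) (hAB : Disjoint A B)
    (fA : ∀ᵐ ω ∂P, M ω A < ∞) (fB : ∀ᵐ ω ∂P, M ω B < ∞) {F : Set Ω}
    (hF : MeasurableSet[MeasurableSpace.comap M inferInstance] F) (n m : ℕ) :
    P (F ∩ {ω | η ω A = n ∧ η ω B = m}) =
      ∫⁻ ω in F, poissonMeasure (M ω A).toNNReal {n} * poissonMeasure (M ω B).toNNReal {m} ∂P := by
  have := h 2 ![A, B] (by simp [Fin.forall_fin_two, hA, hB])
    (by
      intro i j hij
      fin_cases i <;> fin_cases j <;> simp_all [disjoint_comm])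
    (by simp [Fin.forall_fin_two, fA, fB]) ![n, m] F hF
  simpa [Fin.forall_fin_two, Fin.prod_univ_two] using this

theorem measurable_poissonMeasure_comp {f : Ω → ℝ≥0∞} (hf : Measurable f) (n : ℕ) :
    Measurable fun ω => poissonMeasure (f ω).toNNReal {n} := by
  simp_rw [poissonMeasure_singleton]
  fun_prop

/-- The two counts take countably many values, so the space splits into the events with prescribed
counts, whose weights the Cox property gives. For this reason `f` needs no measurability. -/
theorem IsCoxProcess.lintegral_pair [IsProbabilityMeasure P] (h : IsCoxProcess P M η)
    (hM : Measurable M)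
    (hη : Measurable η) {A B : Set S}
    (hA : MeasurableSet A) (hB : MeasurableSet B) (hAB : Disjoint A B)
    (fA : ∀ᵐ ω ∂P, M ω A < ∞) (fB : ∀ᵐ ω ∂P, M ω B < ∞) {F : Set Ω}
    (hF : MeasurableSet[MeasurableSpace.comap M inferInstance] F) (f : ℝ≥0∞ → ℝ≥0∞ → ℝ≥0∞) :
    ∫⁻ ω in F, f (η ω A) (η ω B) ∂P =
      ∫⁻ ω in F, ∑' n : ℕ, ∑' m : ℕ, f n m * (poissonMeasure (M ω A).toNNReal {n} *
        poissonMeasure (M ω B).toNNReal {m}) ∂P := by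
  have hηA : Measurable fun ω => η ω A := (Measure.measurable_coe hA).comp hη
  have hηB : Measurable fun ω => η ω B := (Measure.measurable_coe hB).comp hη
  have hMA : Measurable fun ω => M ω A := (Measure.measurable_coe hA).comp hM
  have hMB : Measurable fun ω => M ω B := (Measure.measurable_coe hB).comp hM
  have hF' : MeasurableSet F := hM.comap_le _ hF
  let C : ℕ × ℕ → Set Ω := fun e => {ω | η ω A = e.1 ∧ η ω B = e.2}
  have hC : ∀ e, MeasurableSet (C e) := fun e =>
    (hηA (measurableSet_singleton _)).inter (hηB (measurableSet_singleton _))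
  have hCd : Pairwise (Function.onFun Disjoint C) := by
    intro e e' hee
    refine Set.disjoint_left.2 fun ω h1 h2 => hee ?_
    obtain ⟨h1a, h1b⟩ := h1
    obtain ⟨h2a, h2b⟩ := h2
    rw [h1a] at h2a
    rw [h1b] at h2b
    exact Prod.ext (by exact_mod_cast h2a) (by exact_mod_cast h2b)
  have hw : ∀ n m : ℕ, Measurable fun ω => poissonMeasure (M ω A).toNNReal {n} *
        poissonMeasure (M ω B).toNNReal {m} := fun n m =>
    (measurable_poissonMeasure_comp hMA n).mul (measurable_poissonMeasure_comp hMB m)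
  have hone : ∀ ω, ∑' e : ℕ × ℕ, poissonMeasure (M ω A).toNNReal {e.1} *
        poissonMeasure (M ω B).toNNReal {e.2} = 1 := by
    intro ω
    rw [ENNReal.tsum_prod']
    simp_rw [ENNReal.tsum_mul_left, tsum_poissonMeasure, mul_one]
    exact tsum_poissonMeasure _
  -- The counts are almost surely finite because the probabilities of the pairs of finite values
  -- already sum to one.
  have hcov : ∀ᵐ ω ∂P, ω ∈ ⋃ e, C e := by
    refine (mem_ae_iff_prob_eq_one (MeasurableSet.iUnion hC)).2 ?_
    rw [measure_iUnion hCd hC]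
    have : ∀ e, P (C e) = ∫⁻ ω, poissonMeasure (M ω A).toNNReal {e.1} *
        poissonMeasure (M ω B).toNNReal {e.2} ∂P := by
      intro e
      simpa [C] using h.measure_pair hA hB hAB fA fB MeasurableSet.univ e.1 e.2
    simp_rw [this]
    have hm : ∀ e : ℕ × ℕ, AEMeasurable (fun ω => poissonMeasure (M ω A).toNNReal {e.1} *
        poissonMeasure (M ω B).toNNReal {e.2}) P := fun e => (hw e.1 e.2).aemeasurable
    rw [← lintegral_tsum hm]
    simp_rw [hone]
    simp
  have hae : (⋃ e, F ∩ C e : Set Ω) =ᵐ[P] F := by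
    filter_upwards [hcov] with ω hω
    rw [← Set.inter_iUnion]
    exact propext ⟨fun h => h.1, fun h => ⟨h, hω⟩⟩
  calc ∫⁻ ω in F, f (η ω A) (η ω B) ∂P
      = ∫⁻ ω in ⋃ e, F ∩ C e, f (η ω A) (η ω B) ∂P := (setLIntegral_congr hae).symm
    _ = ∑' e, ∫⁻ ω in F ∩ C e, f (η ω A) (η ω B) ∂P :=
        lintegral_iUnion (fun e => hF'.inter (hC e))
          (fun e e' he => (hCd he).mono Set.inter_subset_right Set.inter_subset_right) _
    _ = ∑' e : ℕ × ℕ, ∫⁻ ω in F, f e.1 e.2 * (poissonMeasure (M ω A).toNNReal {e.1} *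
        poissonMeasure (M ω B).toNNReal {e.2}) ∂P := by
        refine tsum_congr fun e => ?_
        rw [lintegral_const_mul _ (hw e.1 e.2), ← h.measure_pair hA hB hAB fA fB hF e.1 e.2]
        rw [setLIntegral_congr_fun (g := fun _ => f e.1 e.2) (hF'.inter (hC e))]
        · simp [C]
        · intro ω hω
          obtain ⟨-, h1, h2⟩ := hω
          simp only [h1, h2]
    _ = _ := by
        have hm : ∀ e : ℕ × ℕ, AEMeasurable (fun ω => f e.1 e.2 *
            (poissonMeasure (M ω A).toNNReal {e.1} * poissonMeasure (M ω B).toNNReal {e.2}))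
            (P.restrict F) := fun e => ((hw e.1 e.2).const_mul _).aemeasurable
        rw [← lintegral_tsum hm]
        exact lintegral_congr fun ω => ENNReal.tsum_prod'

theorem IsCoxProcess.measure_void_pair [IsProbabilityMeasure P] (h : IsCoxProcess P M η)
    {A B : Set S} (hA : MeasurableSet A) (hB : MeasurableSet B) (hAB : Disjoint A B)
    (fA : ∀ᵐ ω ∂P, M ω A < ∞) (fB : ∀ᵐ ω ∂P, M ω B < ∞) {F : Set Ω}
    (hF : MeasurableSet[MeasurableSpace.comap M inferInstance] F) :
    P (F ∩ {ω | η ω A = 0 ∧ η ω B = 0}) = ∫⁻ ω in F, expNeg (M ω A) * expNeg (M ω B) ∂P := by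
  simpa [poissonMeasure_zero] using h.measure_pair hA hB hAB fA fB hF 0 0

theorem IsCoxProcess.measure_void [IsProbabilityMeasure P] (h : IsCoxProcess P M η)
    {A : Set S} (hA : MeasurableSet A) (fA : ∀ᵐ ω ∂P, M ω A < ∞) {F : Set Ω}
    (hF : MeasurableSet[MeasurableSpace.comap M inferInstance] F) :
    P (F ∩ {ω | η ω A = 0}) = ∫⁻ ω in F, expNeg (M ω A) ∂P := by
  have := h 1 (fun _ => A) (fun _ => hA) (fun i j hij => absurd (Subsingleton.elim i j) hij)
    (fun _ => fA) (fun _ => 0) F hF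
  simpa [poissonMeasure_zero] using this

theorem IsCoxProcess.lintegral_single [IsProbabilityMeasure P] (h : IsCoxProcess P M η)
    (hM : Measurable M) (hη : Measurable η) {A : Set S}
    (hA : MeasurableSet A) (fA : ∀ᵐ ω ∂P, M ω A < ∞) (f : ℝ≥0∞ → ℝ≥0∞) :
    ∫⁻ ω, f (η ω A) ∂P = ∫⁻ ω, ∑' n : ℕ, f n * poissonMeasure (M ω A).toNNReal {n} ∂P := by
  have := h.lintegral_pair hM hη hA MeasurableSet.empty (Set.disjoint_empty A) fA (by simp)
    MeasurableSet.univ (fun a _ => f a)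
  simp only [Measure.restrict_univ] at this
  rw [this]
  refine lintegral_congr fun ω => tsum_congr fun n => ?_
  simp_rw [← mul_assoc]
  rw [ENNReal.tsum_mul_left, tsum_poissonMeasure, mul_one]

theorem IsCoxProcess.lintegral_apply [IsProbabilityMeasure P] (h : IsCoxProcess P M η)
    (hM : Measurable M) (hη : Measurable η) {A : Set S}
    (hA : MeasurableSet A) (fA : ∀ᵐ ω ∂P, M ω A < ∞) :
    ∫⁻ ω, η ω A ∂P = ∫⁻ ω, M ω A ∂P := by
  rw [h.lintegral_single hM hη hA fA fun a => a]
  refine lintegral_congr_ae ?_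
  filter_upwards [fA] with ω hω
  rw [tsum_nat_mul_poissonMeasure, ENNReal.coe_toNNReal hω.ne]

theorem IsCoxProcess.lintegral_sq [IsProbabilityMeasure P] (h : IsCoxProcess P M η)
    (hM : Measurable M) (hη : Measurable η) {A : Set S}
    (hA : MeasurableSet A) (fA : ∀ᵐ ω ∂P, M ω A < ∞) :
    ∫⁻ ω, η ω A * η ω A ∂P = ∫⁻ ω, (M ω A * M ω A + M ω A) ∂P := by
  rw [h.lintegral_single hM hη hA fA fun a => a * a]
  refine lintegral_congr_ae ?_
  filter_upwards [fA] with ω hω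
  rw [tsum_nat_mul_nat_mul_poissonMeasure, ENNReal.coe_toNNReal hω.ne]

theorem IsCoxProcess.lintegral_mul_of_disjoint [IsProbabilityMeasure P] (h : IsCoxProcess P M η)
    (hM : Measurable M) (hη : Measurable η) {A B : Set S}
    (hA : MeasurableSet A) (hB : MeasurableSet B) (hAB : Disjoint A B)
    (fA : ∀ᵐ ω ∂P, M ω A < ∞) (fB : ∀ᵐ ω ∂P, M ω B < ∞) :
    ∫⁻ ω, η ω A * η ω B ∂P = ∫⁻ ω, M ω A * M ω B ∂P := by
  have := h.lintegral_pair hM hη hA hB hAB fA fB MeasurableSet.univ (fun a b => a * b)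
  simp only [Measure.restrict_univ] at this
  rw [this]
  refine lintegral_congr_ae ?_
  filter_upwards [fA, fB] with ω hωA hωB
  have : ∀ n m : ℕ, (n : ℝ≥0∞) * m * (poissonMeasure (M ω A).toNNReal {n} *
      poissonMeasure (M ω B).toNNReal {m}) = (n * poissonMeasure (M ω A).toNNReal {n}) *
      (m * poissonMeasure (M ω B).toNNReal {m}) := fun n m => by ring
  simp_rw [this, ENNReal.tsum_mul_left, ENNReal.tsum_mul_right, tsum_nat_mul_poissonMeasure]
  rw [ENNReal.coe_toNNReal hωA.ne, ENNReal.coe_toNNReal hωB.ne]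

/-- Cut along `A \ B`, `A ∩ B` and `B \ A`: counts in disjoint pieces multiply, and only the square
of the count in `A ∩ B` produces the extra diagonal term. -/
theorem IsCoxProcess.lintegral_mul [IsProbabilityMeasure P] (h : IsCoxProcess P M η)
    (hM : Measurable M) (hη : Measurable η) {A B : Set S}
    (hA : MeasurableSet A) (hB : MeasurableSet B)
    (fA : ∀ᵐ ω ∂P, M ω A < ∞) (fB : ∀ᵐ ω ∂P, M ω B < ∞) :
    ∫⁻ ω, η ω A * η ω B ∂P = ∫⁻ ω, (M ω A * M ω B + M ω (A ∩ B)) ∂P := by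
  have mη : ∀ {C : Set S}, MeasurableSet C → Measurable fun ω => η ω C := fun hC =>
    (Measure.measurable_coe hC).comp hη
  have mM : ∀ {C : Set S}, MeasurableSet C → Measurable fun ω => M ω C := fun hC =>
    (Measure.measurable_coe hC).comp hM
  have mmη : ∀ {C D : Set S}, MeasurableSet C → MeasurableSet D →
      Measurable fun ω => η ω C * η ω D := fun hC hD => (mη hC).mul (mη hD)
  have mmM : ∀ {C D : Set S}, MeasurableSet C → MeasurableSet D →
      Measurable fun ω => M ω C * M ω D := fun hC hD => (mM hC).mul (mM hD)
  have hI := hA.inter hB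
  have hA' := hA.diff hB
  have hB' := hB.diff hA
  have fI : ∀ᵐ ω ∂P, M ω (A ∩ B) < ∞ := by
    filter_upwards [fA] with ω hω using (measure_mono Set.inter_subset_left).trans_lt hω
  have fA' : ∀ᵐ ω ∂P, M ω (A \ B) < ∞ := by
    filter_upwards [fA] with ω hω using (measure_mono Set.sdiff_subset).trans_lt hω
  have fB' : ∀ᵐ ω ∂P, M ω (B \ A) < ∞ := by
    filter_upwards [fB] with ω hω using (measure_mono Set.sdiff_subset).trans_lt hω
  have split : ∀ m : Measure S, m A * m B = m (A \ B) * m B + (m (A ∩ B) * m (B \ A) +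
      m (A ∩ B) * m (A ∩ B)) := by
    intro m
    have h1 : m A = m (A ∩ B) + m (A \ B) := (measure_inter_add_sdiff A hB).symm
    have h2 : m B = m (A ∩ B) + m (B \ A) := by
      rw [Set.inter_comm]; exact (measure_inter_add_sdiff B hA).symm
    calc m A * m B = m (A \ B) * m B + m (A ∩ B) * m B := by rw [h1]; ring
      _ = m (A \ B) * m B + m (A ∩ B) * (m (A ∩ B) + m (B \ A)) := by rw [← h2]
      _ = _ := by ring
  have d1 : Disjoint (A \ B) B := Set.disjoint_sdiff_left
  have d2 : Disjoint (A ∩ B) (B \ A) :=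
    Set.disjoint_left.2 fun a ha hb => hb.2 ha.1
  calc ∫⁻ ω, η ω A * η ω B ∂P
      = ∫⁻ ω, η ω (A \ B) * η ω B ∂P + (∫⁻ ω, η ω (A ∩ B) * η ω (B \ A) ∂P +
          ∫⁻ ω, η ω (A ∩ B) * η ω (A ∩ B) ∂P) := by
        rw [← lintegral_add_left (mmη hI hB'), ← lintegral_add_left (mmη hA' hB)]
        exact lintegral_congr fun ω => split _
    _ = ∫⁻ ω, M ω (A \ B) * M ω B ∂P + (∫⁻ ω, M ω (A ∩ B) * M ω (B \ A) ∂P +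
          ∫⁻ ω, (M ω (A ∩ B) * M ω (A ∩ B) + M ω (A ∩ B)) ∂P) := by
        rw [h.lintegral_mul_of_disjoint hM hη hA' hB d1 fA' fB,
          h.lintegral_mul_of_disjoint hM hη hI hB' d2 fI fB', h.lintegral_sq hM hη hI fI]
    _ = _ := by
        rw [← lintegral_add_left (mmM hI hB'), ← lintegral_add_left (mmM hA' hB)]
        refine lintegral_congr fun ω => ?_
        rw [split]
        ring

/-- The second factorial moment measure of the point process `∑ δ_{X i}`. -/
def factorialMeasure (P : Measure Ω) (X : ℕ → Ω → S) : Measure (S × S) :=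
  Measure.sum fun e : ℕ × ℕ =>
    (if e.1 = e.2 then (0 : ℝ≥0∞) else 1) • P.map fun ω => (X e.1 ω, X e.2 ω)

variable {X : ℕ → Ω → S}

theorem lintegral_factorialMeasure (hX : ∀ i, Measurable (X i)) {f : S × S → ℝ≥0∞}
    (hf : Measurable f) : ∫⁻ a, f a ∂factorialMeasure P X =
      ∑' e : ℕ × ℕ, (if e.1 = e.2 then 0 else 1) * ∫⁻ ω, f (X e.1 ω, X e.2 ω) ∂P := by
  rw [factorialMeasure, lintegral_sum_measure]
  refine tsum_congr fun e => ?_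
  rw [lintegral_smul_measure, lintegral_map hf ((hX _).prodMk (hX _)), smul_eq_mul]

/-- The product of the two counts is a sum over all pairs of labels, whose diagonal pairs count the
points of `A ∩ B`. The additive form avoids subtracting possibly infinite quantities. -/
theorem factorialMeasure_prod_add (hX : ∀ i, Measurable (X i)) {A B : Set S}
    (hA : MeasurableSet A) (hB : MeasurableSet B) :
    factorialMeasure P X (A ×ˢ B) + ∫⁻ ω, pointMeasure (fun i => X i ω) (A ∩ B) ∂P =
      ∫⁻ ω, pointMeasure (fun i => X i ω) A * pointMeasure (fun i => X i ω) B ∂P := by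
  have m1 : ∀ {C : Set S} (i), MeasurableSet C →
      Measurable fun ω => C.indicator (1 : S → ℝ≥0∞) (X i ω) := fun i hC =>
    (measurable_one.indicator hC).comp (hX i)
  have m2 : ∀ i j, Measurable fun ω =>
      A.indicator (1 : S → ℝ≥0∞) (X i ω) * B.indicator (1 : S → ℝ≥0∞) (X j ω) := fun i j =>
    (m1 i hA).mul (m1 j hB)
  rw [← lintegral_indicator_one (hA.prod hB), lintegral_factorialMeasure hX
    (measurable_one.indicator (hA.prod hB))]
  simp_rw [pointMeasure_apply _ hA, pointMeasure_apply _ hB, pointMeasure_apply _ (hA.inter hB),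
    ← ENNReal.tsum_mul_right, ← ENNReal.tsum_mul_left]
  rw [lintegral_tsum fun i => (m1 i (hA.inter hB)).aemeasurable,
    lintegral_tsum fun i => (Measurable.tsum fun j => m2 i j).aemeasurable]
  simp_rw [lintegral_tsum fun j => (m2 _ j).aemeasurable]
  rw [ENNReal.tsum_prod', ← ENNReal.tsum_add]
  refine tsum_congr fun i => ?_
  have hd : ∫⁻ ω, (A ∩ B).indicator (1 : S → ℝ≥0∞) (X i ω) ∂P = ∑' j, if j = i then
      ∫⁻ ω, A.indicator (1 : S → ℝ≥0∞) (X i ω) * B.indicator (1 : S → ℝ≥0∞) (X j ω) ∂P else 0 := by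
    rw [tsum_ite_eq]
    refine lintegral_congr fun ω => ?_
    by_cases ha : X i ω ∈ A <;> by_cases hb : X i ω ∈ B <;> simp [ha, hb]
  rw [hd, ← ENNReal.tsum_add]
  refine tsum_congr fun j => ?_
  have he : ∀ ω, (A ×ˢ B).indicator (1 : S × S → ℝ≥0∞) (X i ω, X j ω) =
      A.indicator (1 : S → ℝ≥0∞) (X i ω) * B.indicator (1 : S → ℝ≥0∞) (X j ω) := by
    intro ω
    by_cases ha : X i ω ∈ A <;> by_cases hb : X j ω ∈ B <;> simp [ha, hb]
  simp_rw [he]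
  rcases eq_or_ne i j with rfl | hij
  · simp
  · simp [hij, hij.symm]

/-- The second factorial moment measure of a Cox process is the second moment measure of its
directing measure. -/
theorem IsCoxProcess.factorialMeasure_eq [IsProbabilityMeasure P]
    (hX : ∀ i, Measurable (X i)) (hM : Measurable M)
    (h : IsCoxProcess P M fun ω => pointMeasure fun i => X i ω) {κ : Measure (S × S)}
    (B : ℕ → Set S) (hB : ∀ n, MeasurableSet (B n)) (hmono : Monotone B)
    (hcov : ⋃ n, B n = Set.univ) (hfin : ∀ n, ∫⁻ ω, M ω (B n) ∂P < ∞)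
    (hκfin : ∀ n, κ (B n ×ˢ B n) < ∞)
    (hκ : ∀ C D, MeasurableSet C → MeasurableSet D → ∫⁻ ω, M ω C * M ω D ∂P = κ (C ×ˢ D)) :
    factorialMeasure P X = κ := by
  have hη := measurable_pointMeasure hX
  have mM : ∀ {C : Set S}, MeasurableSet C → Measurable fun ω => M ω C := fun hC =>
    (Measure.measurable_coe hC).comp hM
  have hrect : ∀ n C D, MeasurableSet C → MeasurableSet D → C ⊆ B n → D ⊆ B n →
      factorialMeasure P X (C ×ˢ D) = κ (C ×ˢ D) := by
    intro n C D hC hD hCB hDB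
    have fB : ∀ᵐ ω ∂P, M ω (B n) < ∞ := ae_lt_top (mM (hB n)) (hfin n).ne
    have fC : ∀ᵐ ω ∂P, M ω C < ∞ := by
      filter_upwards [fB] with ω hω using (measure_mono hCB).trans_lt hω
    have fD : ∀ᵐ ω ∂P, M ω D < ∞ := by
      filter_upwards [fB] with ω hω using (measure_mono hDB).trans_lt hω
    have fI : ∀ᵐ ω ∂P, M ω (C ∩ D) < ∞ := by
      filter_upwards [fC] with ω hω using (measure_mono Set.inter_subset_left).trans_lt hω
    have key := factorialMeasure_prod_add (P := P) hX hC hD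
    rw [h.lintegral_mul hM hη hC hD fC fD, lintegral_add_right _ (mM (hC.inter hD)),
      h.lintegral_apply hM hη (hC.inter hD) fI, hκ C D hC hD] at key
    -- The diagonal term can be cancelled only if it is finite, which is why the sets are confined
    -- to `B n`.
    refine (ENNReal.add_left_inj ?_).1 key
    exact ((lintegral_mono fun ω => measure_mono (Set.inter_subset_left.trans hCB)).trans_lt
      (hfin n)).ne
  have hcov2 : ⋃ n, (B n ×ˢ B n : Set (S × S)) = Set.univ := by
    refine Set.eq_univ_of_forall fun e => ?_
    obtain ⟨n, hn⟩ := Set.mem_iUnion.1 (hcov.symm ▸ Set.mem_univ e.1 : e.1 ∈ ⋃ n, B n)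
    obtain ⟨m, hm⟩ := Set.mem_iUnion.1 (hcov.symm ▸ Set.mem_univ e.2 : e.2 ∈ ⋃ n, B n)
    exact Set.mem_iUnion.2 ⟨max n m, hmono (le_max_left _ _) hn, hmono (le_max_right _ _) hm⟩
  -- On each square `B n ×ˢ B n` both measures are finite, so agreement on the π-system of
  -- rectangles suffices there.
  refine (Measure.ext_iff_of_iUnion_eq_univ hcov2).2 fun n => ?_
  have hf : IsFiniteMeasure ((factorialMeasure P X).restrict (B n ×ˢ B n)) := by
    constructor
    rw [Measure.restrict_apply_univ, hrect n _ _ (hB n) (hB n) le_rfl le_rfl]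
    exact hκfin n
  refine ext_of_generate_finite _ generateFrom_prod.symm isPiSystem_prod ?_ ?_
  · rintro _ ⟨C, hC, D, hD, rfl⟩
    have hC : MeasurableSet C := hC
    have hD : MeasurableSet D := hD
    rw [Measure.restrict_apply (hC.prod hD), Measure.restrict_apply (hC.prod hD),
      Set.prod_inter_prod]
    exact hrect n _ _ (hC.inter (hB n)) (hD.inter (hB n)) Set.inter_subset_right
      Set.inter_subset_right
  · rw [Measure.restrict_apply_univ, Measure.restrict_apply_univ]
    exact hrect n _ _ (hB n) (hB n) le_rfl le_rfl

end Cox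

end CoxPercolation

namespace CoxPercolation

/-! ### Laws of patterns -/

section Pattern

variable {ι : Type*}

/-- Intersecting two such events corresponds to uniting the finite index sets. For void patterns
these events say that a finite union of test sets is empty, so a law on patterns is fixed by void
probabilities, without inclusion–exclusion. -/
theorem isPiSystem_forall_mem :
    IsPiSystem (Set.range fun s : Finset ι => {v : ι → Prop | ∀ e ∈ s, v e}) := by
  classical
  rintro _ ⟨s, rfl⟩ _ ⟨t, rfl⟩ -
  refine ⟨s ∪ t, ?_⟩
  ext v
  simp only [Finset.mem_union, Set.mem_ofPred_eq, Set.mem_inter_iff]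
  exact ⟨fun h => ⟨fun e he => h e (.inl he), fun e he => h e (.inr he)⟩,
    fun h e he => he.elim (h.1 e) (h.2 e)⟩

theorem generateFrom_forall_mem : MeasurableSpace.generateFrom
    (Set.range fun s : Finset ι => {v : ι → Prop | ∀ e ∈ s, v e}) = MeasurableSpace.pi := by
  apply le_antisymm
  · refine MeasurableSpace.generateFrom_le ?_
    rintro _ ⟨s, rfl⟩
    have : {v : ι → Prop | ∀ e ∈ s, v e} = ⋂ e ∈ s, {v | v e} := by ext; simp
    change MeasurableSet {v : ι → Prop | ∀ e ∈ s, v e}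
    rw [this]
    exact Finset.measurableSet_biInter _ fun e _ =>
      measurableSet_setOfPred.2 (measurable_pi_apply e)
  · refine iSup_le fun e => ?_
    rw [← measurable_iff_comap_le]
    refine (@measurableSet_setOfPred _ (MeasurableSpace.generateFrom _) _).1 ?_
    refine MeasurableSpace.measurableSet_generateFrom ⟨{e}, ?_⟩
    simp

theorem measurableSet_forall_mem (s : Finset ι) :
    MeasurableSet {v : ι → Prop | ∀ e ∈ s, v e} := by
  rw [← generateFrom_forall_mem]
  exact MeasurableSpace.measurableSet_generateFrom ⟨s, rfl⟩

theorem pattern_measure_ext {μ ν : Measure (ι → Prop)} [IsFiniteMeasure μ]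
    (h : ∀ s : Finset ι, μ {v | ∀ e ∈ s, v e} = ν {v | ∀ e ∈ s, v e}) : μ = ν := by
  refine ext_of_generate_finite _ generateFrom_forall_mem.symm isPiSystem_forall_mem ?_ ?_
  · rintro _ ⟨s, rfl⟩
    exact h s
  · simpa using h ∅

/-- Serves two purposes: with `C` all measurable sets it identifies the joint law of vertices and
edges, and with `C` the pattern events it identifies the joint law of two void patterns. -/
theorem pattern_prod_measure_ext {α : Type*} [MeasurableSpace α] {C : Set (Set α)}
    (hC : ‹MeasurableSpace α› = MeasurableSpace.generateFrom C) (hpi : IsPiSystem C)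
    (huniv : Set.univ ∈ C) {μ ν : Measure (α × (ι → Prop))}
    [IsFiniteMeasure μ] (h : ∀ F ∈ C, ∀ s : Finset ι,
      μ (F ×ˢ {v | ∀ e ∈ s, v e}) = ν (F ×ˢ {v | ∀ e ∈ s, v e})) : μ = ν := by
  have hu : (Set.univ : Set (ι → Prop)) = {v | ∀ e ∈ (∅ : Finset ι), v e} := by simp
  have hg := generateFrom_prod_eq (C := C)
    (D := Set.range fun s : Finset ι => {v : ι → Prop | ∀ e ∈ s, v e})
    ⟨fun _ => Set.univ, fun _ => huniv, Set.iUnion_const _⟩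
    ⟨fun _ => Set.univ, fun _ => ⟨∅, hu.symm⟩, Set.iUnion_const _⟩
  rw [← hC, generateFrom_forall_mem] at hg
  refine ext_of_generate_finite _ hg (hpi.prod isPiSystem_forall_mem) ?_ ?_
  · rintro _ ⟨F, hF, _, ⟨s, rfl⟩, rfl⟩
    exact h F hF s
  · rw [← Set.univ_prod_univ, hu]
    exact h _ huniv ∅

end Pattern

/-! ### Sequences of points and their void patterns -/

section Good

variable {T : Type*}

/-- The points of the sequence have distinct locations, and finitely many of them are located in
each ball. -/
def IsGood (x : ℕ → Plane × T) : Prop :=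
  Function.Injective (fun i => (x i).1) ∧ ∀ R : ℕ, ∃ N : ℕ, ∀ i ≥ N, (R : ℝ) ≤ ‖(x i).1‖

theorem IsGood.injective {x : ℕ → Plane × T} (h : IsGood x) : Function.Injective x :=
  fun _ _ hij => h.1 (congrArg Prod.fst hij)

theorem IsGood.finite {x : ℕ → Plane × T} (h : IsGood x) (R : ℝ) :
    {i | ‖(x i).1‖ < R}.Finite := by
  obtain ⟨n, hn⟩ := exists_nat_ge R
  obtain ⟨N, hN⟩ := h.2 n
  refine (Set.finite_lt_nat N).subset fun i hi => ?_
  by_contra hlt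
  exact absurd (hN i (not_lt.1 hlt)) (not_le.2 (lt_of_lt_of_le hi hn))

theorem measurableSet_isGood [MeasurableSpace T] :
    MeasurableSet {x : ℕ → Plane × T | IsGood x} := by
  have h1 : {x : ℕ → Plane × T | IsGood x} =
      (⋂ i : ℕ, ⋂ j : ℕ, {x | (x i).1 = (x j).1 → i = j}) ∩
      ⋂ R : ℕ, ⋃ N : ℕ, ⋂ i : ℕ, {x | i ≥ N → (R : ℝ) ≤ ‖(x i).1‖} := by
    ext x
    simp [IsGood, Function.Injective]
  rw [h1]
  refine (MeasurableSet.iInter fun i => MeasurableSet.iInter fun j => ?_).inter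
    (MeasurableSet.iInter fun R => MeasurableSet.iUnion fun N => MeasurableSet.iInter fun i => ?_)
  · by_cases hij : i = j
    · simp [hij]
    · simp only [hij, imp_false]
      exact (measurableSet_eq_fun (by fun_prop) (by fun_prop)).compl
  · by_cases hi : i ≥ N
    · simp only [hi, true_imp_iff]
      exact measurableSet_le (by fun_prop) (by fun_prop)
    · simp [hi]

variable [TopologicalSpace T] [SecondCountableTopology T] [Nonempty T]

theorem exists_seq_basis (T : Type*) [TopologicalSpace T] [SecondCountableTopology T]
    [Nonempty T] :
    ∃ U : ℕ → Set T, TopologicalSpace.IsTopologicalBasis (Set.range U) := by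
  obtain ⟨U, hU⟩ := (TopologicalSpace.countable_countableBasis T).exists_eq_range
    (Set.Nonempty.of_sUnion
      ((TopologicalSpace.isBasis_countableBasis T).sUnion_eq ▸ Set.univ_nonempty))
  exact ⟨U, hU ▸ TopologicalSpace.isBasis_countableBasis T⟩

/-- A countable family of bounded open sets that separates the points of good sequences. -/
def testSet (T : Type*) [TopologicalSpace T] [SecondCountableTopology T] [Nonempty T]
    (e : ℕ × ℕ) : Set (Plane × T) :=
  (exists_seq_basis (Plane × T)).choose e.1 ∩ {a | ‖a.1‖ < e.2}

/-- Finite unions of test sets. -/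
def testUnion (T : Type*) [TopologicalSpace T] [SecondCountableTopology T] [Nonempty T]
    (s : Finset (ℕ × ℕ)) : Set (Plane × T) := ⋃ e ∈ s, testSet T e

theorem testUnion_bounded (s : Finset (ℕ × ℕ)) :
    ∃ R : ℕ, testUnion T s ⊆ {a : Plane × T | ‖a.1‖ < R} := by
  refine ⟨s.sup Prod.snd, fun a ha => ?_⟩
  simp only [testUnion, Set.mem_iUnion] at ha
  obtain ⟨e, he, ha⟩ := ha
  have h1 : ‖a.1‖ < e.2 := ha.2
  exact h1.trans_le (by exact_mod_cast Finset.le_sup (f := Prod.snd) he)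

theorem isOpen_testSet (e : ℕ × ℕ) : IsOpen (testSet T e) :=
  ((exists_seq_basis (Plane × T)).choose_spec.isOpen ⟨_, rfl⟩).inter
    (isOpen_lt (by fun_prop) continuous_const)

/-- The void pattern of the points in `D`. -/
def voidPattern (D : Set (Plane × T)) (x : ℕ → Plane × T) : ℕ × ℕ → Prop :=
  fun e => ∀ i, x i ∉ testSet T e ∩ D

theorem forall_voidPattern_iff (D : Set (Plane × T)) (x : ℕ → Plane × T) (s : Finset (ℕ × ℕ)) :
    (∀ e ∈ s, voidPattern D x e) ↔ ∀ i, x i ∉ testUnion T s ∩ D := by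
  simp only [voidPattern, testUnion, Set.mem_inter_iff, Set.mem_iUnion, not_and]
  exact ⟨fun h i ⟨e, he, hi⟩ => h e he i hi, fun h e he i hi => h i ⟨e, he, hi⟩⟩

/-- Near `a` only finitely many points of `y` have to be avoided, and a finite set of points is
closed; the norm cut-off in the test set removes all the others. -/
theorem IsGood.exists_testSet [T1Space T] {y : ℕ → Plane × T} (hy : IsGood y) {a : Plane × T}
    (ha : a ∉ Set.range y) : ∃ e, a ∈ testSet T e ∧ ∀ i, y i ∉ testSet T e := by
  obtain ⟨R, hR⟩ := exists_nat_gt ‖a.1‖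
  have hW : IsOpen (⋂ i ∈ {i | ‖(y i).1‖ < R}, ({y i}ᶜ : Set (Plane × T))) :=
    (hy.finite R).isOpen_biInter fun i _ => isOpen_compl_singleton
  obtain ⟨_, ⟨n, rfl⟩, hn, hsub⟩ :=
    (exists_seq_basis (Plane × T)).choose_spec.exists_subset_of_mem_open (a := a) (by
      simp only [Set.mem_iInter]
      intro i _ hi
      exact ha ⟨i, (Set.mem_singleton_iff.1 hi).symm⟩) hW
  refine ⟨(n, R), ⟨hn, hR⟩, fun i hi => ?_⟩
  have := hsub hi.1
  simp only [Set.mem_iInter] at this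
  exact this i hi.2 rfl

/-- A point of `x` in `D` missed by `y` lies in a test set free of all points of `y`, which is void
for `y` in `D` but not for `x`. No topological property of `D` is needed. -/
theorem IsGood.range_inter_subset [T1Space T] {D : Set (Plane × T)} {x y : ℕ → Plane × T}
    (hy : IsGood y) (h : voidPattern D x = voidPattern D y) :
    Set.range x ∩ D ⊆ Set.range y ∩ D := by
  rintro a ⟨⟨i, rfl⟩, hD⟩
  refine ⟨?_, hD⟩
  by_contra ha
  obtain ⟨e, he, hne⟩ := hy.exists_testSet ha
  have h1 : voidPattern D y e := fun i hi => hne i hi.1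
  rw [← h] at h1
  exact h1 i ⟨he, hD⟩

variable [MeasurableSpace T] [BorelSpace T]

theorem measurableSet_testSet (e : ℕ × ℕ) : MeasurableSet (testSet T e) :=
  (isOpen_testSet e).measurableSet

theorem measurableSet_testUnion (s : Finset (ℕ × ℕ)) : MeasurableSet (testUnion T s) :=
  Finset.measurableSet_biUnion _ fun e _ => measurableSet_testSet e

theorem measurable_voidPattern {D : Set (Plane × T)} (hD : MeasurableSet D) :
    Measurable (voidPattern D) := by
  refine measurable_pi_lambda _ fun e => measurableSet_setOfPred.1 ?_
  have : {x : ℕ → Plane × T | voidPattern D x e} = ⋂ i, (fun x => x i) ⁻¹' (testSet T e ∩ D)ᶜ := by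
    ext; simp [voidPattern]
  rw [this]
  exact MeasurableSet.iInter fun i => measurable_pi_apply i
    ((measurableSet_testSet e).inter hD).compl

/-- A measurable function of good sequences which depends only on the set of points in `D` is a
measurable function of the void pattern. -/
theorem exists_eq_comp_voidPattern [T1Space T] [StandardBorelSpace T] {D : Set (Plane × T)}
    (hD : MeasurableSet D) {F : (ℕ → Plane × T) → ℝ≥0∞} (hF : Measurable F)
    (hinv : ∀ x y, IsGood x → IsGood y → Set.range x ∩ D = Set.range y ∩ D → F x = F y) :
    ∃ F' : (ℕ × ℕ → Prop) → ℝ≥0∞, Measurable F' ∧ ∀ x, IsGood x → F x = F' (voidPattern D x) := by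
  let G := {x : ℕ → Plane × T | IsGood x}
  have : StandardBorelSpace G := measurableSet_isGood.standardBorel
  let f : G → (ℕ × ℕ → Prop) := fun x => voidPattern D x.1
  have hf : Measurable f := (measurable_voidPattern hD).comp measurable_subtype_coe
  have hFf : ∀ x y : G, f x = f y → F x.1 = F y.1 := fun x y h =>
    hinv _ _ x.2 y.2 (Set.Subset.antisymm (y.2.range_inter_subset h)
      (x.2.range_inter_subset h.symm))
  have hmeas : Measurable[MeasurableSpace.comap f inferInstance] fun x : G => F x.1 := by
    intro t ht
    -- By invariance, every level set of `F` is saturated for the pattern map.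
    have hs : f ⁻¹' (f '' ((fun x : G => F x.1) ⁻¹' t)) = (fun x : G => F x.1) ⁻¹' t := by
      refine Set.Subset.antisymm ?_ (Set.subset_preimage_image _ _)
      rintro x ⟨y, hy, hxy⟩
      simp only [Set.mem_preimage] at hy ⊢
      rwa [← hFf y x hxy]
    have hm : MeasurableSet (f ⁻¹' (f '' ((fun x : G => F x.1) ⁻¹' t))) := by
      rw [hs]; exact (hF.comp measurable_subtype_coe) ht
    -- Here descriptive set theory enters: on a standard Borel space, a saturated measurable set is
    -- the preimage of a measurable subset of the range. This is why `G` must be standard Borel.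
    obtain ⟨u, hu, hu'⟩ := hf.measurableSet_preimage_iff_preimage_val.1 hm
    refine ⟨u, hu, ?_⟩
    rw [← hs]
    ext x
    have := Set.ext_iff.1 hu' ⟨f x, x, rfl⟩
    simpa using this
  obtain ⟨F', hF', h⟩ := hmeas.exists_eq_measurable_comp
  exact ⟨F', hF', fun x hx => congrFun h ⟨x, hx⟩⟩

/-- The void probabilities determine the law of a simple point process. -/
theorem lintegral_eq_of_void [T1Space T] [StandardBorelSpace T] {Ω Ω' : Type*}
    [MeasurableSpace Ω] [MeasurableSpace Ω'] {P : Measure Ω} {P' : Measure Ω'}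
    [IsProbabilityMeasure P] {X : ℕ → Ω → Plane × T} {X' : ℕ → Ω' → Plane × T}
    (hX : ∀ i, Measurable (X i)) (hX' : ∀ i, Measurable (X' i))
    (gX : ∀ᵐ ω ∂P, IsGood fun i => X i ω) (gX' : ∀ᵐ ω ∂P', IsGood fun i => X' i ω)
    (hvoid : ∀ s, P {ω | ∀ i, X i ω ∉ testUnion T s} = P' {ω | ∀ i, X' i ω ∉ testUnion T s})
    {F : (ℕ → Plane × T) → ℝ≥0∞} (hF : Measurable F)
    (hinv : ∀ x y, IsGood x → IsGood y → Set.range x = Set.range y → F x = F y) :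
    ∫⁻ ω, F (fun i => X i ω) ∂P = ∫⁻ ω, F (fun i => X' i ω) ∂P' := by
  obtain ⟨F', hF', h⟩ := exists_eq_comp_voidPattern MeasurableSet.univ hF
    (fun x y hx hy hxy => hinv x y hx hy (by simpa using hxy))
  have m1 : Measurable fun ω => voidPattern Set.univ fun i => X i ω :=
    (measurable_voidPattern MeasurableSet.univ).comp (measurable_pi_lambda _ hX)
  have m2 : Measurable fun ω => voidPattern Set.univ fun i => X' i ω :=
    (measurable_voidPattern MeasurableSet.univ).comp (measurable_pi_lambda _ hX')
  have hlaw : P.map (fun ω => voidPattern Set.univ fun i => X i ω) =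
      P'.map (fun ω => voidPattern Set.univ fun i => X' i ω) := by
    have : IsProbabilityMeasure (P.map (fun ω => voidPattern Set.univ fun i => X i ω)) :=
      Measure.isProbabilityMeasure_map m1.aemeasurable
    refine pattern_measure_ext fun s => ?_
    rw [Measure.map_apply m1 (measurableSet_forall_mem s),
      Measure.map_apply m2 (measurableSet_forall_mem s)]
    simp only [Set.preimage_ofPred_eq, forall_voidPattern_iff, Set.inter_univ]
    exact hvoid s
  calc ∫⁻ ω, F (fun i => X i ω) ∂P
      = ∫⁻ ω, F' (voidPattern Set.univ fun i => X i ω) ∂P := by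
        refine lintegral_congr_ae ?_
        filter_upwards [gX] with ω hω using h _ hω
    _ = ∫⁻ ω, F' (voidPattern Set.univ fun i => X' i ω) ∂P' := by
        rw [← lintegral_map hF' m1, hlaw, lintegral_map hF' m2]
    _ = _ := by
        refine lintegral_congr_ae ?_
        filter_upwards [gX'] with ω hω using (h _ hω).symm

end Good

instance : StandardBorelSpace Mark := measurableSet_Ioo.standardBorel

instance : Nonempty Mark := ⟨⟨1 / 2, by norm_num, by norm_num⟩⟩

end CoxPercolation

namespace CoxPercolation

/-! ### Campbell's formula and goodness of Cox processes -/

section Campbell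

variable {Ω S : Type*} [MeasurableSpace Ω] [MeasurableSpace S] {P : Measure Ω}
  {M : Ω → Measure S} {X : ℕ → Ω → S}

/-- The intensity measure of a Cox process is the mean of its directing measure. -/
theorem IsCoxProcess.intensity_eq [IsProbabilityMeasure P]
    (hX : ∀ i, Measurable (X i)) (hM : Measurable M)
    (h : IsCoxProcess P M fun ω => pointMeasure fun i => X i ω) {κ : Measure S}
    (B : ℕ → Set S) (hB : ∀ n, MeasurableSet (B n)) (hcov : ⋃ n, B n = Set.univ)
    (hfin : ∀ n, κ (B n) < ∞) (hκ : ∀ A, MeasurableSet A → ∫⁻ ω, M ω A ∂P = κ A) :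
    (Measure.sum fun i => P.map (X i)) = κ := by
  refine (Measure.ext_iff_of_iUnion_eq_univ hcov).2 fun n => Measure.ext fun A hA => ?_
  have hAB := hA.inter (hB n)
  rw [Measure.restrict_apply hA, Measure.restrict_apply hA, ← hκ _ hAB,
    ← h.lintegral_apply hM (measurable_pointMeasure hX) hAB, Measure.sum_apply _ hAB]
  · simp_rw [pointMeasure_apply _ hAB]
    have hm : ∀ i, AEMeasurable (fun ω => (A ∩ B n).indicator (1 : S → ℝ≥0∞) (X i ω)) P :=
      fun i => ((measurable_one.indicator hAB).comp (hX i)).aemeasurable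
    rw [lintegral_tsum hm]
    refine tsum_congr fun i => ?_
    rw [← lintegral_indicator_one hAB, lintegral_map (measurable_one.indicator hAB) (hX i)]
  · refine ae_lt_top ((Measure.measurable_coe hAB).comp hM) ?_
    rw [hκ _ hAB]
    exact ((measure_mono Set.inter_subset_right).trans_lt (hfin n)).ne

theorem campbell (hX : ∀ i, Measurable (X i)) {κ : Measure S}
    (h : (Measure.sum fun i => P.map (X i)) = κ) {f : S → ℝ≥0∞} (hf : Measurable f) :
    ∫⁻ ω, ∑' i, f (X i ω) ∂P = ∫⁻ a, f a ∂κ := by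
  have hm : ∀ i, AEMeasurable (fun ω => f (X i ω)) P := fun i => (hf.comp (hX i)).aemeasurable
  rw [← h, lintegral_sum_measure, lintegral_tsum hm]
  exact tsum_congr fun i => (lintegral_map hf (hX i)).symm

end Campbell

section Good

variable {T : Type*}

/-- The points located in the ball of radius `n` at the origin. -/
def locBall (T : Type*) (n : ℕ) : Set (Plane × T) := {a | ‖a.1‖ < n}

theorem monotone_locBall : Monotone (locBall T) := fun n m hnm a (ha : ‖a.1‖ < n) =>
  show ‖a.1‖ < m from ha.trans_le (by exact_mod_cast hnm)

theorem iUnion_locBall : ⋃ n, locBall T n = Set.univ :=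
  Set.eq_univ_of_forall fun a => Set.mem_iUnion.2 (exists_nat_gt ‖a.1‖)

theorem locBall_eq_prod (n : ℕ) : locBall T n = Metric.ball (0 : Plane) n ×ˢ Set.univ := by
  ext a; simp [locBall]

variable [MeasurableSpace T]

theorem measurableSet_locBall (n : ℕ) : MeasurableSet (locBall T n) :=
  measurableSet_lt (by fun_prop) measurable_const

theorem volume_prod_locBall_lt_top (ρ : Measure T) [IsProbabilityMeasure ρ] (n : ℕ) :
    (volume : Measure Plane).prod ρ (locBall T n) < ∞ := by
  rw [locBall_eq_prod, Measure.prod_prod, measure_univ, mul_one]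
  exact measure_ball_lt_top

theorem volume_prod_lt_top_of_subset_locBall (ρ : Measure T) [IsProbabilityMeasure ρ] {n : ℕ}
    {A : Set (Plane × T)} (hA : A ⊆ locBall T n) : (volume : Measure Plane).prod ρ A < ∞ :=
  (measure_mono hA).trans_lt (volume_prod_locBall_lt_top ρ n)

theorem measurableSet_eq_location :
    MeasurableSet {e : (Plane × T) × (Plane × T) | e.1.1 = e.2.1} :=
  measurableSet_eq_fun (by fun_prop) (by fun_prop)

theorem prod_eq_location_eq_zero (ρ : Measure T) [SFinite ρ] :
    ((volume : Measure Plane).prod ρ).prod ((volume : Measure Plane).prod ρ)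
      {e | e.1.1 = e.2.1} = 0 := by
  rw [Measure.measure_prod_null measurableSet_eq_location]
  refine Eventually.of_forall fun a => ?_
  have : Prod.mk a ⁻¹' {e : (Plane × T) × (Plane × T) | e.1.1 = e.2.1} = {a.1} ×ˢ Set.univ := by
    ext b; simp [eq_comm]
  simp only [this, Measure.prod_prod, measure_singleton, zero_mul, Pi.zero_apply]

/-- Two labels at one location would charge the diagonal of the factorial moment measure. A finite
mean number of points in a ball makes the series of indicators converge, and indicators that tend to
zero vanish eventually. -/
theorem ae_isGood {Ω : Type*} [MeasurableSpace Ω] {P : Measure Ω} {X : ℕ → Ω → Plane × T}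
    (hX : ∀ i, Measurable (X i)) {κ : Measure (Plane × T)}
    (hκ : (Measure.sum fun i => P.map (X i)) = κ) (hfin : ∀ n, κ (locBall T n) < ∞)
    (hdiag : factorialMeasure P X {e | e.1.1 = e.2.1} = 0) :
    ∀ᵐ ω ∂P, IsGood fun i => X i ω := by
  have h1 : ∀ i j, i ≠ j → ∀ᵐ ω ∂P, (X i ω).1 ≠ (X j ω).1 := by
    intro i j hij
    rw [factorialMeasure, Measure.sum_apply_eq_zero] at hdiag
    have := hdiag (i, j)
    simp only [hij, if_false, one_smul] at this
    rw [Measure.map_apply ((hX i).prodMk (hX j)) measurableSet_eq_location] at this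
    filter_upwards [measure_eq_zero_iff_ae_notMem.1 this] with ω hω using hω
  have h2 : ∀ n : ℕ, ∀ᵐ ω ∂P, ∑' i, (locBall T n).indicator (1 : Plane × T → ℝ≥0∞) (X i ω) < ∞ := by
    intro n
    have hm : Measurable ((locBall T n).indicator (1 : Plane × T → ℝ≥0∞)) :=
      measurable_one.indicator (measurableSet_locBall n)
    refine ae_lt_top (Measurable.tsum fun i => hm.comp (hX i)) ?_
    rw [campbell hX hκ hm, lintegral_indicator_one (measurableSet_locBall n)]
    exact (hfin n).ne
  have h1' : ∀ᵐ ω ∂P, ∀ i j, i ≠ j → (X i ω).1 ≠ (X j ω).1 := by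
    rw [ae_all_iff]; intro i
    rw [ae_all_iff]; intro j
    rw [ae_all_iff]; exact h1 i j
  filter_upwards [h1', ae_all_iff.2 h2] with ω hω1 hω2
  refine ⟨fun i j hij => by_contra fun hne => hω1 i j hne hij, fun n => ?_⟩
  have ht := ENNReal.tendsto_cofinite_zero_of_tsum_ne_top (hω2 n).ne
  rw [Nat.cofinite_eq_atTop] at ht
  obtain ⟨N, hN⟩ := eventually_atTop.1 (ht.eventually_lt_const one_pos)
  refine ⟨N, fun i hi => ?_⟩
  by_contra hlt
  have hmem : X i ω ∈ locBall T n := not_le.1 hlt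
  have := hN i hi
  rw [Set.indicator_of_mem hmem] at this
  simp at this

theorem exists_perm_of_range_eq {S : Type*} {x y : ℕ → S} (hx : Function.Injective x)
    (hy : Function.Injective y) (h : Set.range x = Set.range y) :
    ∃ e : Equiv.Perm ℕ, ∀ i, y (e i) = x i := by
  refine ⟨(Equiv.ofInjective x hx).trans ((Equiv.setCongr h).trans (Equiv.ofInjective y hy).symm),
    fun i => ?_⟩
  simp only [Equiv.trans_apply]
  rw [Equiv.apply_ofInjective_symm hy]
  simp

theorem tsum_eq_of_range_eq {S : Type*} {x y : ℕ → S} (hx : Function.Injective x)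
    (hy : Function.Injective y) (h : Set.range x = Set.range y) (f : S → ℝ≥0∞) :
    ∑' i, f (x i) = ∑' i, f (y i) := by
  obtain ⟨e, he⟩ := exists_perm_of_range_eq hx hy h
  rw [← e.tsum_eq fun i => f (y i)]
  simp_rw [he]

end Good

/-! ### The environment -/

instance : IsProbabilityMeasure uniformMark := by
  constructor
  rw [uniformMark, (MeasurableEmbedding.subtype_coe measurableSet_Ioo).comap_apply,
    Set.image_univ, Subtype.range_coe, Real.volume_Ioo]
  norm_num

instance (τ β : ℝ) : SFinite (paretoMeasure τ β) := by
  unfold paretoMeasure; infer_instance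

/-- The reference measure `dx du` on vertices. -/
def vertexVolume : Measure Vertex := (volume : Measure Plane).prod uniformMark

/-- The intensity measure of the balls of the Boolean model. -/
def ballIntensity (τ β : ℝ) : Measure (Plane × ℝ) :=
  (volume : Measure Plane).prod (paretoMeasure τ β)

instance : SFinite vertexVolume := by unfold vertexVolume; infer_instance

instance (τ β : ℝ) : SFinite (ballIntensity τ β) := by unfold ballIntensity; infer_instance

/-- The balls that cover `x`. -/
def covering (x : Plane) : Set (Plane × ℝ) := {b | dist b.1 x < b.2}

theorem measurableSet_covering (x : Plane) : MeasurableSet (covering x) :=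
  measurableSet_lt (by fun_prop) (by fun_prop)

/-- The mass of the part of `A` located in the ball `b`. -/
def coverMass (A : Set Vertex) (b : Plane × ℝ) : ℝ≥0∞ :=
  vertexVolume (A ∩ {a | dist b.1 a.1 < b.2})

theorem measurableSet_ball_pair :
    MeasurableSet {e : (Plane × ℝ) × Vertex | dist e.1.1 e.2.1 < e.1.2} :=
  measurableSet_lt (by fun_prop) (by fun_prop)

theorem measurable_coverMass {A : Set Vertex} (hA : MeasurableSet A) :
    Measurable (coverMass A) := by
  have : MeasurableSet {e : (Plane × ℝ) × Vertex | e.2 ∈ A ∧ dist e.1.1 e.2.1 < e.1.2} :=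
    (measurable_snd hA).inter measurableSet_ball_pair
  exact measurable_measure_prodMk_left this

theorem density_eq (φ : ℝ) (y : ℕ → Plane × ℝ) (x : Plane) :
    density φ y x = ENNReal.ofReal φ * pointMeasure y (covering x) := by
  rw [density, pointMeasure_apply _ (measurableSet_covering x)]
  rfl

theorem measurable_density {α : Type*} [MeasurableSpace α] (φ : ℝ) {f : α → ℕ → Plane × ℝ}
    {k : α → Plane} (hf : ∀ i, Measurable fun a => f a i) (hk : Measurable k) :
    Measurable fun a => density φ (f a) (k a) := by
  unfold density
  refine Measurable.const_mul (Measurable.tsum fun i => ?_) _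
  have : MeasurableSet {a : α | dist (f a i).1 (k a) < (f a i).2} :=
    measurableSet_lt ((hf i).fst.dist hk) (hf i).snd
  exact measurable_one.indicator this

/-- The intensity measure `lam Λ(dx) du` of the vertices, given the balls `y`. -/
def vertexIntensity (lam φ : ℝ) (y : ℕ → Plane × ℝ) : Measure Vertex :=
  ENNReal.ofReal lam • (directingMeasure φ y).prod uniformMark

theorem vertexIntensity_eq (lam φ : ℝ) (y : ℕ → Plane × ℝ) : vertexIntensity lam φ y =
    ENNReal.ofReal lam • vertexVolume.withDensity fun a => density φ y a.1 := by
  have hm : Measurable (density φ y) :=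
    measurable_density φ (f := fun _ => y) (fun _ => measurable_const) measurable_id
  rw [vertexIntensity, directingMeasure, prod_withDensity_left hm, vertexVolume]

theorem vertexIntensity_apply (lam φ : ℝ) (y : ℕ → Plane × ℝ) {A : Set Vertex}
    (hA : MeasurableSet A) :
    vertexIntensity lam φ y A =
      ENNReal.ofReal lam * ∫⁻ a in A, density φ y a.1 ∂vertexVolume := by
  rw [vertexIntensity_eq, Measure.smul_apply, withDensity_apply _ hA, smul_eq_mul]

/-- By Tonelli the mass of `A` is additive over the Boolean balls. This linear form makes the
environment tractable: shifts act on single balls, and balls far from `A` drop out. -/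
theorem vertexIntensity_apply_eq_tsum (lam φ : ℝ) (y : ℕ → Plane × ℝ) {A : Set Vertex}
    (hA : MeasurableSet A) :
    vertexIntensity lam φ y A =
      ENNReal.ofReal lam * (ENNReal.ofReal φ * ∑' i, coverMass A (y i)) := by
  have hm : ∀ b : Plane × ℝ, MeasurableSet {a : Vertex | dist b.1 a.1 < b.2} := fun b =>
    measurableSet_lt (by fun_prop) (by fun_prop)
  have hi : ∀ b : Plane × ℝ, Measurable fun a : Vertex =>
      {z : Plane | dist b.1 z < b.2}.indicator (1 : Plane → ℝ≥0∞) a.1 := fun b =>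
    (measurable_one.indicator (hm b) : Measurable ({a : Vertex | dist b.1 a.1 < b.2}.indicator 1))
  rw [vertexIntensity_apply _ _ _ hA]
  simp only [density]
  rw [lintegral_const_mul _ (Measurable.tsum fun i => hi (y i)),
    lintegral_tsum fun i => (hi (y i)).aemeasurable]
  congr 2
  refine tsum_congr fun i => ?_
  rw [coverMass, Set.inter_comm, ← Measure.restrict_apply (hm _), ← lintegral_indicator_one (hm _)]
  rfl

theorem measurable_vertexIntensity (lam φ : ℝ) {Ω : Type*} [MeasurableSpace Ω]
    {Y : ℕ → Ω → Plane × ℝ} (hY : ∀ i, Measurable (Y i)) :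
    Measurable fun ω => vertexIntensity lam φ fun i => Y i ω := by
  refine Measure.measurable_of_measurable_coe _ fun A hA => ?_
  simp_rw [vertexIntensity_apply_eq_tsum _ _ _ hA]
  exact ((Measurable.tsum fun i => (measurable_coverMass hA).comp (hY i)).const_mul _).const_mul _

theorem ballIntensity_covering (τ β : ℝ) (x : Plane) :
    ballIntensity τ β (covering x) = ballIntensity τ β (covering 0) := by
  rw [ballIntensity, Measure.prod_apply_symm (measurableSet_covering x),
    Measure.prod_apply_symm (measurableSet_covering 0)]
  refine lintegral_congr fun s => ?_
  exact Measure.addHaar_ball_center volume x s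

end CoxPercolation

namespace CoxPercolation

/-! ### First and second moments of the model -/

section Moments

variable {Ω : Type*} [MeasurableSpace Ω] {P : Measure Ω} {β τ φ : ℝ}
  {p : Vertex → Vertex → ℝ} {lam : ℝ} {Y : ℕ → Ω → Plane × ℝ} {X : ℕ → Ω → Vertex}
  {g : Ω → SimpleGraph ℕ}

theorem ballIntensity_locBall_lt_top (hτ : 0 < τ) (hβ : 0 < β) (n : ℕ) :
    ballIntensity τ β (locBall ℝ n) < ∞ :=
  have := isProbabilityMeasure_paretoMeasure hτ hβ
  volume_prod_locBall_lt_top _ n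

theorem vertexVolume_locBall_lt_top (n : ℕ) : vertexVolume (locBall Mark n) < ∞ :=
  volume_prod_locBall_lt_top _ n

theorem IsCoxModel.cox_vertices (h : IsCoxModel P β τ φ p lam Y X g) :
    IsCoxProcess P (fun ω => vertexIntensity lam φ fun i => Y i ω)
      (fun ω => pointMeasure fun i => X i ω) := h.cox_X

theorem IsCoxModel.poisson_balls (h : IsCoxModel P β τ φ p lam Y X g) :
    IsCoxProcess P (fun _ => ballIntensity τ β) (fun ω => pointMeasure fun i => Y i ω) :=
  h.poisson_Y

theorem IsCoxModel.measurable_balls_apply (h : IsCoxModel P β τ φ p lam Y X g)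
    {A : Set (Plane × ℝ)} (hA : MeasurableSet A) :
    Measurable fun ω => pointMeasure (fun i => Y i ω) A :=
  (Measure.measurable_coe hA).comp (measurable_pointMeasure h.measurable_Y)

theorem IsCoxModel.measurable_density_mul (h : IsCoxModel P β τ φ p lam Y X g) :
    Measurable fun e : (Vertex × Vertex) × Ω =>
      density φ (fun i => Y i e.2) e.1.1.1 * density φ (fun i => Y i e.2) e.1.2.1 :=
  (measurable_density φ (fun i => (h.measurable_Y i).comp measurable_snd)
    measurable_fst.fst.fst).mul
  (measurable_density φ (fun i => (h.measurable_Y i).comp measurable_snd)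
    measurable_fst.snd.fst)

variable [IsProbabilityMeasure P]

theorem IsCoxModel.balls_intensity (h : IsCoxModel P β τ φ p lam Y X g) (hτ : 0 < τ)
    (hβ : 0 < β) : (Measure.sum fun i => P.map (Y i)) = ballIntensity τ β :=
  h.poisson_balls.intensity_eq h.measurable_Y measurable_const (locBall ℝ) measurableSet_locBall
    iUnion_locBall (ballIntensity_locBall_lt_top hτ hβ) (fun A _ => by simp)

theorem IsCoxModel.balls_factorialMeasure (h : IsCoxModel P β τ φ p lam Y X g) (hτ : 0 < τ)
    (hβ : 0 < β) : factorialMeasure P Y = (ballIntensity τ β).prod (ballIntensity τ β) := by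
  have hf := ballIntensity_locBall_lt_top (τ := τ) (β := β) hτ hβ
  refine h.poisson_balls.factorialMeasure_eq h.measurable_Y measurable_const (locBall ℝ)
    measurableSet_locBall monotone_locBall iUnion_locBall (fun n => ?_) (fun n => ?_)
    (fun C D _ _ => ?_)
  · simpa using hf n
  · rw [Measure.prod_prod]
    exact ENNReal.mul_lt_top (hf n) (hf n)
  · simp [Measure.prod_prod]

theorem IsCoxModel.balls_isGood (h : IsCoxModel P β τ φ p lam Y X g) (hτ : 0 < τ)
    (hβ : 0 < β) : ∀ᵐ ω ∂P, IsGood fun i => Y i ω := by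
  refine ae_isGood h.measurable_Y (h.balls_intensity hτ hβ)
    (ballIntensity_locBall_lt_top hτ hβ) ?_
  rw [h.balls_factorialMeasure hτ hβ]
  exact prod_eq_location_eq_zero _

theorem IsCoxModel.lintegral_balls (h : IsCoxModel P β τ φ p lam Y X g) (hτ : 0 < τ)
    (hβ : 0 < β) {A : Set (Plane × ℝ)} (hA : MeasurableSet A) :
    ∫⁻ ω, pointMeasure (fun i => Y i ω) A ∂P = ballIntensity τ β A := by
  simp_rw [pointMeasure_apply _ hA]
  rw [campbell h.measurable_Y (h.balls_intensity hτ hβ) (measurable_one.indicator hA),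
    lintegral_indicator_one hA]

theorem IsCoxModel.phi_mul_covering (h : IsCoxModel P β τ φ p lam Y X g) (hτ : 0 < τ)
    (hβ : 0 < β) (x : Plane) : ENNReal.ofReal φ * ballIntensity τ β (covering x) = 1 := by
  have := h.normalised
  simp_rw [density_eq] at this
  rwa [lintegral_const_mul _ (h.measurable_balls_apply (measurableSet_covering 0)),
    h.lintegral_balls hτ hβ (measurableSet_covering 0),
    ← ballIntensity_covering τ β x] at this

/-- Infinite mean coverage would make the product with `φ` zero or infinite, whereas the
normalisation says that it is one. The Pareto moment need not be computed. -/
theorem IsCoxModel.covering_lt_top (h : IsCoxModel P β τ φ p lam Y X g) (hτ : 0 < τ)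
    (hβ : 0 < β) (x : Plane) : ballIntensity τ β (covering x) < ∞ := by
  have h1 := h.phi_mul_covering hτ hβ x
  rw [lt_top_iff_ne_top]
  intro hx
  rw [hx] at h1
  by_cases hφ : ENNReal.ofReal φ = 0
  · simp [hφ] at h1
  · simp [ENNReal.mul_top hφ] at h1

theorem IsCoxModel.lintegral_density (h : IsCoxModel P β τ φ p lam Y X g) (hτ : 0 < τ)
    (hβ : 0 < β) (x : Plane) : ∫⁻ ω, density φ (fun i => Y i ω) x ∂P = 1 := by
  simp_rw [density_eq]
  rw [lintegral_const_mul _ (h.measurable_balls_apply (measurableSet_covering x)),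
    h.lintegral_balls hτ hβ (measurableSet_covering x),
    h.phi_mul_covering hτ hβ]

/-- The Poisson second moment is the product of the means, normalised to one, plus the mean number
of balls covering both points, which is at most the mean number covering one. The bound is uniform
in `x` and `y`, so integrability of `p` alone will control the edges. -/
theorem IsCoxModel.lintegral_density_mul_le (h : IsCoxModel P β τ φ p lam Y X g) (hτ : 0 < τ)
    (hβ : 0 < β) (x y : Plane) :
    ∫⁻ ω, density φ (fun i => Y i ω) x * density φ (fun i => Y i ω) y ∂P ≤
      1 + ENNReal.ofReal φ := by
  have hm : Measurable fun ω => pointMeasure (fun i => Y i ω) (covering x) *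
      pointMeasure (fun i => Y i ω) (covering y) :=
    (h.measurable_balls_apply (measurableSet_covering x)).mul
    (h.measurable_balls_apply (measurableSet_covering y))
  have e1 := h.phi_mul_covering hτ hβ x
  have e2 := h.phi_mul_covering hτ hβ y
  calc ∫⁻ ω, density φ (fun i => Y i ω) x * density φ (fun i => Y i ω) y ∂P
      = ENNReal.ofReal φ * ENNReal.ofReal φ * ∫⁻ ω, pointMeasure (fun i => Y i ω) (covering x) *
          pointMeasure (fun i => Y i ω) (covering y) ∂P := by
        rw [← lintegral_const_mul _ hm]
        refine lintegral_congr fun ω => ?_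
        rw [density_eq, density_eq]
        ring
    _ = ENNReal.ofReal φ * ENNReal.ofReal φ * (ballIntensity τ β (covering x) *
          ballIntensity τ β (covering y) + ballIntensity τ β (covering x ∩ covering y)) := by
        rw [h.poisson_balls.lintegral_mul measurable_const
          (measurable_pointMeasure h.measurable_Y) (measurableSet_covering x)
          (measurableSet_covering y) (Eventually.of_forall fun _ => h.covering_lt_top hτ hβ x)
          (Eventually.of_forall fun _ => h.covering_lt_top hτ hβ y)]
        simp
    _ ≤ ENNReal.ofReal φ * ENNReal.ofReal φ * (ballIntensity τ β (covering x) *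
          ballIntensity τ β (covering y) + ballIntensity τ β (covering x)) := by
        gcongr
        exact Set.inter_subset_left
    _ = (ENNReal.ofReal φ * ballIntensity τ β (covering x)) *
          (ENNReal.ofReal φ * ballIntensity τ β (covering y)) +
          ENNReal.ofReal φ * (ENNReal.ofReal φ * ballIntensity τ β (covering x)) := by ring
    _ = _ := by rw [e1, e2]; ring

theorem IsCoxModel.lintegral_vertexIntensity (h : IsCoxModel P β τ φ p lam Y X g) (hτ : 0 < τ)
    (hβ : 0 < β) {A : Set Vertex} (hA : MeasurableSet A) :
    ∫⁻ ω, vertexIntensity lam φ (fun i => Y i ω) A ∂P = ENNReal.ofReal lam * vertexVolume A := by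
  have hm : Measurable fun e : Ω × Vertex => density φ (fun i => Y i e.1) e.2.1 :=
    measurable_density φ (fun i => (h.measurable_Y i).comp measurable_fst) measurable_snd.fst
  simp_rw [vertexIntensity_apply _ _ _ hA]
  rw [lintegral_const_mul _ hm.lintegral_prod_right', lintegral_lintegral_swap hm.aemeasurable]
  simp_rw [h.lintegral_density hτ hβ]
  simp

theorem IsCoxModel.vertices_intensity (h : IsCoxModel P β τ φ p lam Y X g) (hτ : 0 < τ)
    (hβ : 0 < β) : (Measure.sum fun i => P.map (X i)) = ENNReal.ofReal lam • vertexVolume := by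
  refine h.cox_vertices.intensity_eq h.measurable_X (measurable_vertexIntensity _ _ h.measurable_Y)
    (locBall Mark) measurableSet_locBall iUnion_locBall (fun n => ?_) (fun A hA => ?_)
  · exact ENNReal.mul_lt_top ENNReal.ofReal_lt_top (vertexVolume_locBall_lt_top n)
  · exact h.lintegral_vertexIntensity hτ hβ hA

theorem IsCoxModel.vertexIntensity_lt_top (h : IsCoxModel P β τ φ p lam Y X g) (hτ : 0 < τ)
    (hβ : 0 < β) {A : Set Vertex} (hA : MeasurableSet A) (hfin : vertexVolume A < ∞) :
    ∀ᵐ ω ∂P, vertexIntensity lam φ (fun i => Y i ω) A < ∞ := by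
  refine ae_lt_top ((Measure.measurable_coe hA).comp
    (measurable_vertexIntensity _ _ h.measurable_Y)) ?_
  rw [h.lintegral_vertexIntensity hτ hβ hA]
  exact (ENNReal.mul_lt_top ENNReal.ofReal_lt_top hfin).ne

/-- The second moment density of the environment. -/
def densityProduct (P : Measure Ω) (φ : ℝ) (Y : ℕ → Ω → Plane × ℝ) (e : Vertex × Vertex) : ℝ≥0∞ :=
  ∫⁻ ω, density φ (fun i => Y i ω) e.1.1 * density φ (fun i => Y i ω) e.2.1 ∂P

/-- Tonelli applied to the product of two masses of the directing measure. The bound on the second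
moment density supplies the local finiteness needed to compare the measures. -/
theorem IsCoxModel.vertices_factorialMeasure (h : IsCoxModel P β τ φ p lam Y X g) (hτ : 0 < τ)
    (hβ : 0 < β) : factorialMeasure P X = (ENNReal.ofReal lam * ENNReal.ofReal lam) •
      (vertexVolume.prod vertexVolume).withDensity (densityProduct P φ Y) := by
  have hd := h.measurable_density_mul
  refine h.cox_vertices.factorialMeasure_eq h.measurable_X
    (measurable_vertexIntensity _ _ h.measurable_Y) (locBall Mark)
    measurableSet_locBall monotone_locBall iUnion_locBall (fun n => ?_) (fun n => ?_)
    (fun C D hC hD => ?_)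
  · rw [h.lintegral_vertexIntensity hτ hβ (measurableSet_locBall n)]
    exact ENNReal.mul_lt_top ENNReal.ofReal_lt_top (vertexVolume_locBall_lt_top n)
  · rw [Measure.smul_apply, smul_eq_mul]
    refine ENNReal.mul_lt_top (ENNReal.mul_lt_top ENNReal.ofReal_lt_top ENNReal.ofReal_lt_top) ?_
    rw [withDensity_apply _ ((measurableSet_locBall n).prod (measurableSet_locBall n))]
    calc ∫⁻ e in locBall Mark n ×ˢ locBall Mark n, densityProduct P φ Y e
          ∂vertexVolume.prod vertexVolume
        ≤ ∫⁻ e in locBall Mark n ×ˢ locBall Mark n, (1 + ENNReal.ofReal φ)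
          ∂vertexVolume.prod vertexVolume :=
          lintegral_mono fun e => h.lintegral_density_mul_le hτ hβ _ _
      _ < ∞ := by
          rw [setLIntegral_const, Measure.prod_prod]
          exact ENNReal.mul_lt_top (by simp) (ENNReal.mul_lt_top
            (vertexVolume_locBall_lt_top n) (vertexVolume_locBall_lt_top n))
  · rw [Measure.smul_apply, smul_eq_mul, withDensity_apply _ (hC.prod hD)]
    simp only [densityProduct]
    rw [lintegral_lintegral_swap hd.aemeasurable,
      ← lintegral_const_mul _ hd.lintegral_prod_left']
    refine lintegral_congr fun ω => ?_
    have hω : Measurable fun a : Vertex => density φ (fun i => Y i ω) a.1 :=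
      measurable_density φ (fun _ => measurable_const) measurable_fst
    rw [vertexIntensity_apply _ _ _ hC, vertexIntensity_apply _ _ _ hD, ← Measure.prod_restrict,
      lintegral_prod_mul hω.aemeasurable hω.aemeasurable]
    ring

theorem IsCoxModel.vertices_isGood (h : IsCoxModel P β τ φ p lam Y X g) (hτ : 0 < τ)
    (hβ : 0 < β) : ∀ᵐ ω ∂P, IsGood fun i => X i ω := by
  refine ae_isGood h.measurable_X (h.vertices_intensity hτ hβ) (fun n => ?_) ?_
  · exact ENNReal.mul_lt_top ENNReal.ofReal_lt_top (vertexVolume_locBall_lt_top n)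
  rw [h.vertices_factorialMeasure hτ hβ, Measure.smul_apply, smul_eq_mul]
  exact mul_eq_zero_of_right _ (withDensity_absolutelyContinuous _ _
    (prod_eq_location_eq_zero uniformMark))

theorem IsCoxModel.lintegral_factorialMeasure_le (h : IsCoxModel P β τ φ p lam Y X g)
    (hτ : 0 < τ) (hβ : 0 < β) {f : Vertex × Vertex → ℝ≥0∞} (hf : Measurable f) :
    ∫⁻ e, f e ∂factorialMeasure P X ≤ (ENNReal.ofReal lam * ENNReal.ofReal lam) *
      ((1 + ENNReal.ofReal φ) * ∫⁻ e, f e ∂vertexVolume.prod vertexVolume) := by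
  have hd := h.measurable_density_mul
  have hdp : Measurable (densityProduct P φ Y) := hd.lintegral_prod_right'
  rw [h.vertices_factorialMeasure hτ hβ, lintegral_smul_measure,
    lintegral_withDensity_eq_lintegral_mul _ hdp hf, ← lintegral_const_mul _ hf, smul_eq_mul]
  refine mul_le_mul_right (lintegral_mono fun e => ?_) _
  change densityProduct P φ Y e * f e ≤ _
  gcongr
  exact h.lintegral_density_mul_le hτ hβ _ _

/-! ### Void probabilities of the model -/

theorem IsCoxModel.balls_void (h : IsCoxModel P β τ φ p lam Y X g)
    {A : Set (Plane × ℝ)} (hA : MeasurableSet A) (hfin : ballIntensity τ β A < ∞) :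
    P {ω | ∀ i, Y i ω ∉ A} = expNeg (ballIntensity τ β A) := by
  have := h.poisson_balls.measure_void hA (Eventually.of_forall fun _ => hfin) MeasurableSet.univ
  simpa [pointMeasure_eq_zero_iff _ hA] using this

theorem IsCoxModel.vertices_void (h : IsCoxModel P β τ φ p lam Y X g) (hτ : 0 < τ)
    (hβ : 0 < β) {A : Set Vertex} (hA : MeasurableSet A) (hfin : vertexVolume A < ∞) :
    P {ω | ∀ i, X i ω ∉ A} = ∫⁻ ω, expNeg (vertexIntensity lam φ (fun i => Y i ω) A) ∂P := by
  have := h.cox_vertices.measure_void hA (h.vertexIntensity_lt_top hτ hβ hA hfin)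
    MeasurableSet.univ
  simpa [pointMeasure_eq_zero_iff _ hA] using this

end Moments

/-! ### Stationarity of the balls and of the vertices -/

section Stationarity

/-- Shift the location of a point, keeping its mark. -/
def shiftLoc {T : Type*} (z : Plane) (a : Plane × T) : Plane × T := (a.1 + z, a.2)

theorem shift_eq_shiftLoc (z : Plane) : shift z = shiftLoc z := rfl

theorem measurable_shiftLoc {T : Type*} [MeasurableSpace T] (z : Plane) :
    Measurable (shiftLoc z : Plane × T → Plane × T) := by
  unfold shiftLoc; fun_prop

theorem measurePreserving_shiftLoc {T : Type*} [MeasurableSpace T] (ρ : Measure T) [SFinite ρ]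
    (z : Plane) : MeasurePreserving (shiftLoc z) ((volume : Measure Plane).prod ρ)
      ((volume : Measure Plane).prod ρ) :=
  (measurePreserving_add_right volume z).prod (MeasurePreserving.id ρ)

theorem IsGood.shiftLoc {T : Type*} {x : ℕ → Plane × T} (hx : IsGood x) (z : Plane) :
    IsGood fun i => shiftLoc z (x i) := by
  refine ⟨fun i j hij => hx.1 (add_right_cancel (b := z) hij), fun R => ?_⟩
  obtain ⟨n, hn⟩ := exists_nat_ge (R + ‖z‖)
  obtain ⟨N, hN⟩ := hx.2 n
  refine ⟨N, fun i hi => ?_⟩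
  have h1 := hN i hi
  have h2 : ‖(x i).1‖ ≤ ‖(x i).1 + z‖ + ‖z‖ := by
    simpa using norm_sub_le ((x i).1 + z) z
  simp only [CoxPercolation.shiftLoc]
  linarith

theorem coverMass_preimage_shiftLoc (z : Plane) {A : Set Vertex} (hA : MeasurableSet A)
    (b : Plane × ℝ) : coverMass (shiftLoc z ⁻¹' A) b = coverMass A (shiftLoc z b) := by
  have hm : MeasurableSet (A ∩ {a : Vertex | dist (shiftLoc z b).1 a.1 < (shiftLoc z b).2}) :=
    hA.inter (measurableSet_lt (by fun_prop) (by fun_prop))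
  rw [coverMass, coverMass, vertexVolume,
    ← (measurePreserving_shiftLoc uniformMark z).measure_preimage
    hm.nullMeasurableSet]
  congr 1
  ext a
  simp [shiftLoc]

variable {Ω Ω' : Type*} [MeasurableSpace Ω] [MeasurableSpace Ω'] {P : Measure Ω} {P' : Measure Ω'}
  [IsProbabilityMeasure P] [IsProbabilityMeasure P'] {β τ φ : ℝ}
  {p : Vertex → Vertex → ℝ} {lam lam' : ℝ} {Y : ℕ → Ω → Plane × ℝ} {X : ℕ → Ω → Vertex}
  {g : Ω → SimpleGraph ℕ} {Y' : ℕ → Ω' → Plane × ℝ} {X' : ℕ → Ω' → Vertex}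
  {g' : Ω' → SimpleGraph ℕ}

theorem exists_subset_locBall_preimage {T : Type*} (z : Plane) {A : Set (Plane × T)} {n : ℕ}
    (hA : A ⊆ locBall T n) : ∃ m, shiftLoc z ⁻¹' A ⊆ locBall T m := by
  obtain ⟨m, hm⟩ := exists_nat_ge (n + ‖z‖)
  refine ⟨m, fun a ha => ?_⟩
  have h0 : shiftLoc z a ∈ locBall T n := hA ha
  have h1 : ‖a.1 + z‖ < n := h0
  have h2 : ‖a.1‖ ≤ ‖a.1 + z‖ + ‖z‖ := by simpa using norm_sub_le (a.1 + z) z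
  change ‖a.1‖ < m
  linarith

/-- One statement with two uses: a shift within one model gives stationarity of the environment, and
`z = 0` with two models shows that its law does not depend on the intensity of the vertices or on
the probability space. -/
theorem IsCoxModel.balls_law (h : IsCoxModel P β τ φ p lam Y X g)
    (h' : IsCoxModel P' β τ φ p lam' Y' X' g') (hτ : 0 < τ) (hβ : 0 < β) (z : Plane)
    {F : (ℕ → Plane × ℝ) → ℝ≥0∞} (hF : Measurable F)
    (hinv : ∀ x y, IsGood x → IsGood y → Set.range x = Set.range y → F x = F y) :
    ∫⁻ ω, F (fun i => shiftLoc z (Y i ω)) ∂P = ∫⁻ ω, F (fun i => Y' i ω) ∂P' := by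
  have := isProbabilityMeasure_paretoMeasure hτ hβ
  refine lintegral_eq_of_void (fun i => (measurable_shiftLoc z).comp (h.measurable_Y i))
    h'.measurable_Y ?_ (h'.balls_isGood hτ hβ) (fun s => ?_) hF hinv
  · filter_upwards [h.balls_isGood hτ hβ] with ω hω using hω.shiftLoc z
  · have hm := measurableSet_testUnion (T := ℝ) s
    obtain ⟨n, hn⟩ := testUnion_bounded (T := ℝ) s
    obtain ⟨m, hm'⟩ := exists_subset_locBall_preimage z hn
    have e1 := h.balls_void (measurable_shiftLoc z hm)
      (volume_prod_lt_top_of_subset_locBall _ hm')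
    rw [h'.balls_void hm (volume_prod_lt_top_of_subset_locBall _ hn)]
    refine e1.trans ?_
    rw [ballIntensity, (measurePreserving_shiftLoc _ z).measure_preimage hm.nullMeasurableSet]

theorem measurable_expNeg_tsum {c : ℝ≥0∞} {A : Set Vertex} (hA : MeasurableSet A) :
    Measurable fun y : ℕ → Plane × ℝ => expNeg (c * ∑' i, coverMass A (y i)) :=
  measurable_expNeg.comp ((Measurable.tsum fun i =>
    (measurable_coverMass hA).comp (measurable_pi_apply i)).const_mul c)

theorem IsCoxModel.lintegral_expNeg (h : IsCoxModel P β τ φ p lam Y X g)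
    (h' : IsCoxModel P' β τ φ p lam' Y' X' g') (hτ : 0 < τ) (hβ : 0 < β) (z : Plane)
    {A : Set Vertex} (hA : MeasurableSet A) (c : ℝ≥0∞) :
    ∫⁻ ω, expNeg (c * ∑' i, coverMass (shiftLoc z ⁻¹' A) (Y i ω)) ∂P =
      ∫⁻ ω, expNeg (c * ∑' i, coverMass A (Y' i ω)) ∂P' := by
  simp_rw [coverMass_preimage_shiftLoc z hA]
  refine h.balls_law h' hτ hβ z (measurable_expNeg_tsum (c := c) hA) fun x y hx hy hxy => ?_
  rw [tsum_eq_of_range_eq hx.injective hy.injective hxy]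

/-- The void probability of a shifted test set is the void probability of the original set in a
shifted environment, and `lintegral_expNeg` removes that shift. -/
theorem IsCoxModel.vertices_law (h : IsCoxModel P β τ φ p lam Y X g)
    (hτ : 0 < τ) (hβ : 0 < β) (z : Plane) {F : (ℕ → Vertex) → ℝ≥0∞} (hF : Measurable F)
    (hinv : ∀ x y, IsGood x → IsGood y → Set.range x = Set.range y → F x = F y) :
    ∫⁻ ω, F (fun i => shiftLoc z (X i ω)) ∂P = ∫⁻ ω, F (fun i => X i ω) ∂P := by
  refine lintegral_eq_of_void (fun i => (measurable_shiftLoc z).comp (h.measurable_X i))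
    h.measurable_X ?_ (h.vertices_isGood hτ hβ) (fun s => ?_) hF hinv
  · filter_upwards [h.vertices_isGood hτ hβ] with ω hω using hω.shiftLoc z
  · have hm := measurableSet_testUnion (T := Mark) s
    obtain ⟨n, hn⟩ := testUnion_bounded (T := Mark) s
    obtain ⟨m, hm'⟩ := exists_subset_locBall_preimage z hn
    have e1 := h.vertices_void hτ hβ (measurable_shiftLoc z hm)
      (volume_prod_lt_top_of_subset_locBall _ hm')
    rw [h.vertices_void hτ hβ hm (volume_prod_lt_top_of_subset_locBall _ hn)]
    refine e1.trans ?_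
    simp_rw [vertexIntensity_apply_eq_tsum _ _ _ hm,
      vertexIntensity_apply_eq_tsum _ _ _ (measurable_shiftLoc z hm), ← mul_assoc]
    exact h.lintegral_expNeg h hτ hβ z hm _

end Stationarity

end CoxPercolation

namespace CoxPercolation

/-! ### Measurability of graphs -/

/-- Expresses the size of a set of values, possibly listed with repetitions, through finite sets of
labels. With countably many labels this is a countable union of measurable conditions. -/
theorem natCast_le_encard_iff {ι T : Type*} {I : ι → Prop} {z : ι → T} (n : ℕ) :
    (n : ℕ∞) ≤ {t | ∃ k, I k ∧ z k = t}.encard ↔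
      ∃ s : Finset ι, s.card = n ∧ (∀ k ∈ s, I k) ∧ ∀ k ∈ s, ∀ l ∈ s, z k = z l → k = l := by
  classical
  constructor
  · intro h
    obtain ⟨t, ht, htn⟩ := Set.exists_subset_encard_eq h
    have htf : t.Finite := Set.finite_of_encard_eq_coe htn
    rcases isEmpty_or_nonempty ι with hι | hι
    · have : t = ∅ := Set.eq_empty_of_forall_notMem fun a ha => hι.elim (ht ha).choose
      refine ⟨∅, ?_, by simp, by simp⟩
      rw [this, Set.encard_empty] at htn
      rw [Finset.card_empty]
      exact_mod_cast htn
    choose! f hf using fun a (ha : a ∈ t) => ht ha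
    refine ⟨htf.toFinset.image f, ?_, ?_, ?_⟩
    · rw [Finset.card_image_of_injOn]
      · rw [htf.encard_eq_coe_toFinset_card] at htn
        exact_mod_cast htn
      · intro a ha b hb hab
        have ha' : a ∈ t := by simpa using ha
        have hb' : b ∈ t := by simpa using hb
        rw [← (hf a ha').2, ← (hf b hb').2, hab]
    · intro k hk
      simp only [Finset.mem_image, Set.Finite.mem_toFinset] at hk
      obtain ⟨a, ha, rfl⟩ := hk
      exact (hf a ha).1
    · intro k hk l hl hkl
      simp only [Finset.mem_image, Set.Finite.mem_toFinset] at hk hl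
      obtain ⟨a, ha, rfl⟩ := hk
      obtain ⟨b, hb, rfl⟩ := hl
      rw [(hf a ha).2, (hf b hb).2] at hkl
      rw [hkl]
  · rintro ⟨s, rfl, hI, hinj⟩
    have : ((s.image z : Finset T) : Set T) ⊆ {t | ∃ k, I k ∧ z k = t} := by
      intro t ht
      simp only [Finset.coe_image, Set.mem_image] at ht
      obtain ⟨k, hk, rfl⟩ := ht
      exact ⟨k, hI k hk, rfl⟩
    refine le_trans ?_ (Set.encard_le_encard this)
    rw [Set.encard_coe_eq_coe_finsetCard, Finset.card_image_of_injOn]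
    exact fun k hk l hl hkl => hinj k hk l hl hkl

theorem measurable_encard {α ι T : Type*} [MeasurableSpace α] [Countable ι] [MeasurableSpace T]
    [MeasurableEq T] {I : ι → Set α} (hI : ∀ k, MeasurableSet (I k)) {z : ι → α → T}
    (hz : ∀ k, Measurable (z k)) :
    Measurable[_, ⊤] fun a => {t | ∃ k, a ∈ I k ∧ z k a = t}.encard := by
  have hle : ∀ n : ℕ, MeasurableSet {a | (n : ℕ∞) ≤ {t | ∃ k, a ∈ I k ∧ z k a = t}.encard} := by
    intro n
    have : {a | (n : ℕ∞) ≤ {t | ∃ k, a ∈ I k ∧ z k a = t}.encard} =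
        ⋃ s : {s : Finset ι // s.card = n}, ((⋂ k ∈ s.1, I k) ∩
          ⋂ k ∈ s.1, ⋂ l ∈ s.1, {a | z k a = z l a → k = l}) := by
      ext a
      simp only [Set.mem_ofPred_eq, natCast_le_encard_iff, Set.mem_iUnion, Set.mem_inter_iff,
        Set.mem_iInter, Subtype.exists, exists_prop]
    rw [this]
    refine MeasurableSet.iUnion fun s => MeasurableSet.inter
      (Finset.measurableSet_biInter _ fun k _ => hI k) ?_
    refine Finset.measurableSet_biInter _ fun k _ => Finset.measurableSet_biInter _ fun l _ => ?_
    by_cases hkl : k = l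
    · simp [hkl]
    · simp only [hkl, imp_false]
      exact (measurableSet_eq_fun (hz k) (hz l)).compl
  intro S _
  have hS : (fun a => {t | ∃ k, a ∈ I k ∧ z k a = t}.encard) ⁻¹' S =
      ⋃ n ∈ S, {a | {t | ∃ k, a ∈ I k ∧ z k a = t}.encard = n} := by
    ext a; simp
  rw [hS]
  refine MeasurableSet.biUnion S.to_countable fun n _ => ?_
  induction n using ENat.recTopCoe with
  | top =>
    have : {a | {t | ∃ k, a ∈ I k ∧ z k a = t}.encard = ⊤} =
        ⋂ n : ℕ, {a | (n : ℕ∞) ≤ {t | ∃ k, a ∈ I k ∧ z k a = t}.encard} := by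
      ext a
      simp only [Set.mem_ofPred_eq, Set.mem_iInter]
      exact ⟨fun h n => h ▸ le_top, fun h => ENat.eq_top_iff_forall_ge.2 h⟩
    rw [this]
    exact MeasurableSet.iInter hle
  | coe n =>
    have : {a | {t | ∃ k, a ∈ I k ∧ z k a = t}.encard = n} =
        {a | (n : ℕ∞) ≤ {t | ∃ k, a ∈ I k ∧ z k a = t}.encard} \
        {a | ((n + 1 : ℕ) : ℕ∞) ≤ {t | ∃ k, a ∈ I k ∧ z k a = t}.encard} := by
      ext a
      simp only [Set.mem_ofPred_eq, Set.mem_sdiff]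
      push_cast
      rw [ENat.add_one_le_iff (ENat.natCast_ne_top n), not_lt]
      exact ⟨fun h => ⟨h.ge, h.le⟩, fun h => le_antisymm h.2 h.1⟩
    rw [this]
    exact (hle n).diff (hle (n + 1))

/-- The sigma-algebra on graphs generated by the edges. -/
instance labelGraphMeasurableSpace : MeasurableSpace (SimpleGraph ℕ) :=
  MeasurableSpace.comap (fun g (e : ℕ × ℕ) => g.Adj e.1 e.2) MeasurableSpace.pi

theorem measurableSet_adj (i j : ℕ) : MeasurableSet {g : SimpleGraph ℕ | g.Adj i j} := by
  have h : Measurable fun (g : SimpleGraph ℕ) (e : ℕ × ℕ) => g.Adj e.1 e.2 :=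
    comap_measurable _
  exact measurableSet_setOfPred.2 ((measurable_pi_apply (i, j)).comp h)

theorem measurable_labelGraph {α : Type*} [MeasurableSpace α] {G : α → SimpleGraph ℕ}
    (h : ∀ i j, MeasurableSet {a | (G a).Adj i j}) : Measurable G := by
  refine measurable_comap_iff.2 (measurable_pi_lambda _ fun e => ?_)
  exact measurableSet_setOfPred.1 (h e.1 e.2)

/-- Graphs on the labels together with the positions of the labels. -/
abbrev LabelledGraph : Type := (ℕ → Vertex) × SimpleGraph ℕ

theorem measurableSet_labelled_adj (i j : ℕ) :
    MeasurableSet {e : LabelledGraph | e.2.Adj i j} := measurable_snd (measurableSet_adj i j)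

theorem measurable_label (i : ℕ) : Measurable fun e : LabelledGraph => e.1 i :=
  (measurable_pi_apply i).comp measurable_fst

theorem measurable_embed : Measurable fun e : LabelledGraph => embed e.1 e.2 := by
  rw [measurable_iff_comap_le, GeometricGraph.measurableSpace]
  simp only [MeasurableSpace.comap_sup, MeasurableSpace.comap_iSup, MeasurableSpace.comap_comp]
  refine sup_le (iSup_le fun A => ?_) (iSup_le fun A => iSup_le fun B => ?_)
  · rw [← measurable_iff_comap_le]
    have := measurable_encard (I := fun (k : ℕ) => {e : LabelledGraph | e.1 k ∈ A.1})
      (fun k => measurable_label k A.2) (z := fun k (e : LabelledGraph) => e.1 k) measurable_label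
    convert! this using 2 with e
    change Set.encard _ = Set.encard _
    congr 1
    ext a
    simp only [embed, Set.mem_inter_iff, Set.mem_range, Set.mem_ofPred_eq]
    constructor
    · rintro ⟨⟨k, rfl⟩, ha⟩
      exact ⟨k, ha, rfl⟩
    · rintro ⟨k, ha, rfl⟩
      exact ⟨⟨k, rfl⟩, ha⟩
  · rw [← measurable_iff_comap_le]
    have := measurable_encard (I := fun (k : ℕ × ℕ) => {e : LabelledGraph | e.1 k.1 ∈ A.1} ∩
      ({e | e.1 k.2 ∈ B.1} ∩ ({e | e.1 k.1 = e.1 k.2}ᶜ ∩ {e | e.2.Adj k.1 k.2})))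
      (fun k => (measurable_label k.1 A.2).inter ((measurable_label k.2 B.2).inter
        ((measurableSet_eq_fun (measurable_label k.1) (measurable_label k.2)).compl.inter
          (measurableSet_labelled_adj k.1 k.2))))
      (z := fun k (e : LabelledGraph) => (e.1 k.1, e.1 k.2))
      (fun k => (measurable_label k.1).prodMk (measurable_label k.2))
    convert! this using 2 with e
    change Set.encard _ = Set.encard _
    congr 1
    ext ⟨a, b⟩
    simp only [embed, Set.mem_inter_iff, Set.mem_compl_iff, Set.mem_ofPred_eq, Prod.mk.injEq]
    constructor
    · rintro ⟨ha, hb, hab, i, j, rfl, rfl, hg⟩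
      exact ⟨(i, j), ⟨ha, hb, hab, hg⟩, rfl, rfl⟩
    · rintro ⟨⟨i, j⟩, ⟨ha, hb, hab, hg⟩, rfl, rfl⟩
      exact ⟨ha, hb, hab, i, j, rfl, rfl, hg⟩

/-! ### Random edges -/

variable {p : Vertex → Vertex → ℝ}

/-- The graph in which `i` and `j` are adjacent if the edge label `u s(i, j)` is less than the
connection probability. -/
def edgeGraph (p : Vertex → Vertex → ℝ) (x : ℕ → Vertex) (u : Sym2 ℕ → unitInterval) :
    SimpleGraph ℕ :=
  SimpleGraph.fromRel fun i j => (u s(i, j) : ℝ) < p (x i) (x j)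

theorem IsConnectionFunction.edgeGraph_adj (hp : IsConnectionFunction p) (x : ℕ → Vertex)
    (u : Sym2 ℕ → unitInterval) (i j : ℕ) :
    (edgeGraph p x u).Adj i j ↔ i ≠ j ∧ (u s(i, j) : ℝ) < p (x i) (x j) := by
  rw [edgeGraph, SimpleGraph.fromRel_adj, Sym2.eq_swap (a := j), hp.symm (x j), or_self]

/-- The law of independent uniform edge labels. -/
def labelLaw : Measure (Sym2 ℕ → unitInterval) := Measure.infinitePi fun _ => volume

instance : IsProbabilityMeasure labelLaw := by unfold labelLaw; infer_instance

/-- Reindexing an independent identically distributed family along an injection preserves its law.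
Permutations give invariance under relabelling the vertices, and injections of labels give the
coupling with a subgraph. -/
theorem measurePreserving_labels {f : ℕ → ℕ} (hf : Function.Injective f) :
    MeasurePreserving (fun (u : Sym2 ℕ → unitInterval) z => u (Sym2.map f z)) labelLaw labelLaw :=
  ⟨by fun_prop, Measure.map_infinitePi_infinitePi_of_inj (P := fun _ : Sym2 ℕ =>
    (volume : Measure unitInterval)) (Sym2.map.injective hf)⟩

theorem IsConnectionFunction.measurable_comp (hp : IsConnectionFunction p) {α : Type*}
    [MeasurableSpace α] {f k : α → Vertex} (hf : Measurable f) (hk : Measurable k) :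
    Measurable fun a => p (f a) (k a) :=
  hp.measurable.comp (hf.prodMk hk)

theorem IsConnectionFunction.measurable_edgeGraph (hp : IsConnectionFunction p) :
    Measurable fun e : (ℕ → Vertex) × (Sym2 ℕ → unitInterval) => (e.1, edgeGraph p e.1 e.2) := by
  refine measurable_fst.prodMk (measurable_labelGraph fun i j => ?_)
  simp only [hp.edgeGraph_adj]
  by_cases hij : i = j
  · simp [hij]
  · simp only [ne_eq, hij, not_false_eq_true, true_and]
    refine measurableSet_lt ?_ (hp.measurable_comp ((measurable_pi_apply i).comp measurable_fst)
      ((measurable_pi_apply j).comp measurable_fst))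
    exact measurable_subtype_coe.comp ((measurable_pi_apply _).comp measurable_snd)

theorem volume_lt_unitInterval {c : ℝ} (h0 : 0 ≤ c) (h1 : c ≤ 1) :
    volume {v : unitInterval | (v : ℝ) < c} = ENNReal.ofReal c :=
  unitInterval.volume_Iio (x := ⟨c, h0, h1⟩)

/-- Ordered pairs `i < j` correspond to distinct unordered pairs, so the edges depend on distinct
independent labels and the probabilities multiply. -/
theorem IsConnectionFunction.labelLaw_adj (hp : IsConnectionFunction p) (x : ℕ → Vertex)
    (s : Finset (ℕ × ℕ)) (hs : ∀ e ∈ s, e.1 < e.2) :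
    labelLaw {u | ∀ e ∈ s, (edgeGraph p x u).Adj e.1 e.2} =
      ∏ e ∈ s, ENNReal.ofReal (p (x e.1) (x e.2)) := by
  classical
  let t : Sym2 ℕ → Set unitInterval :=
    Sym2.lift ⟨fun i j => {v | (v : ℝ) < p (x i) (x j)}, fun i j => by
      simp only [hp.symm (x i)]⟩
  have ht : ∀ i j, t s(i, j) = {v : unitInterval | (v : ℝ) < p (x i) (x j)} := fun i j => rfl
  have hinj : Set.InjOn (fun e : ℕ × ℕ => s(e.1, e.2)) s := by
    rintro ⟨a, b⟩ hab ⟨c, d⟩ hcd h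
    have h1 := hs _ hab
    have h2 := hs _ hcd
    simp only [Sym2.eq_iff] at h
    simp only at h1 h2
    rcases h with ⟨rfl, rfl⟩ | ⟨rfl, rfl⟩
    · rfl
    · omega
  have hset : {u | ∀ e ∈ s, (edgeGraph p x u).Adj e.1 e.2} =
      Set.pi (s.image fun e : ℕ × ℕ => s(e.1, e.2) : Finset (Sym2 ℕ)) t := by
    ext u
    simp only [Set.mem_ofPred_eq, Set.mem_pi, Finset.coe_image, Set.forall_mem_image,
      Finset.mem_coe, ht, hp.edgeGraph_adj]
    exact forall₂_congr fun e he => and_iff_right (hs e he).ne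
  rw [hset, labelLaw, Measure.infinitePi_pi _ (fun z _ => ?_), Finset.prod_image hinj]
  · refine Finset.prod_congr rfl fun e _ => ?_
    rw [ht]
    exact volume_lt_unitInterval (hp.nonneg _ _) (hp.le_one _ _)
  · induction z using Sym2.ind with
    | _ i j => exact measurableSet_lt measurable_subtype_coe measurable_const

/-- The presence of the edges between the labels `i < j`. -/
def edgeCode (g : SimpleGraph ℕ) (e : {e : ℕ × ℕ // e.1 < e.2}) : Prop := g.Adj e.1.1 e.1.2

/-- The graph with prescribed edges between the labels `i < j`. -/
def decodeEdges (v : {e : ℕ × ℕ // e.1 < e.2} → Prop) : SimpleGraph ℕ :=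
  SimpleGraph.fromRel fun i j => ∃ h : i < j, v ⟨(i, j), h⟩

theorem decodeEdges_edgeCode (g : SimpleGraph ℕ) : decodeEdges (edgeCode g) = g := by
  ext i j
  simp only [decodeEdges, edgeCode, SimpleGraph.fromRel_adj, exists_prop]
  constructor
  · rintro ⟨-, ⟨-, h⟩ | ⟨-, h⟩⟩
    exacts [h, h.symm]
  · intro h
    refine ⟨h.ne, ?_⟩
    rcases lt_or_gt_of_ne h.ne with hlt | hlt
    exacts [.inl ⟨hlt, h⟩, .inr ⟨hlt, h.symm⟩]

theorem measurable_decodeEdges : Measurable decodeEdges := by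
  refine measurable_labelGraph fun i j => ?_
  simp only [decodeEdges, SimpleGraph.fromRel_adj]
  by_cases hij : i = j
  · simp [hij]
  · rcases lt_or_gt_of_ne hij with h | h
    · simp only [ne_eq, hij, not_false_eq_true, h, exists_true_left, h.not_gt, true_and,
        IsEmpty.exists_iff, or_false]
      exact measurableSet_setOfPred.2 (measurable_pi_apply _)
    · simp only [ne_eq, hij, not_false_eq_true, h, exists_true_left, h.not_gt, true_and,
        IsEmpty.exists_iff, false_or]
      exact measurableSet_setOfPred.2 (measurable_pi_apply _)

theorem measurable_edgeCode : Measurable edgeCode :=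
  measurable_pi_lambda _ fun e => measurableSet_setOfPred.1 (measurableSet_adj e.1.1 e.1.2)

/-! ### The conditional law of the edges given the vertices. -/

section Law

variable {Ω : Type*} [MeasurableSpace Ω] {P : Measure Ω} {β τ φ : ℝ}
  {lam : ℝ} {Y : ℕ → Ω → Plane × ℝ} {X : ℕ → Ω → Vertex} {g : Ω → SimpleGraph ℕ}

theorem IsCoxModel.measurable_vertices (h : IsCoxModel P β τ φ p lam Y X g) :
    Measurable fun ω i => X i ω := measurable_pi_lambda _ h.measurable_X

theorem IsCoxModel.measurable_labelled (h : IsCoxModel P β τ φ p lam Y X g) :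
    Measurable fun ω => ((fun i => X i ω, g ω) : LabelledGraph) :=
  h.measurable_vertices.prodMk (measurable_labelGraph h.measurable_g)

variable [IsProbabilityMeasure P]

/-- Given the vertices, the edges have the law of the edges defined by independent uniform edge
labels. -/
theorem IsCoxModel.lintegral_labelled (h : IsCoxModel P β τ φ p lam Y X g)
    (hp : IsConnectionFunction p) {H : LabelledGraph → ℝ≥0∞} (hH : Measurable H) :
    ∫⁻ ω, H (fun i => X i ω, g ω) ∂P =
      ∫⁻ ω, ∫⁻ u, H (fun i => X i ω, edgeGraph p (fun i => X i ω) u) ∂labelLaw ∂P := by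
  let c : LabelledGraph → (ℕ → Vertex) × ({e : ℕ × ℕ // e.1 < e.2} → Prop) :=
    fun e => (e.1, edgeCode e.2)
  have hc : Measurable c := measurable_fst.prodMk (measurable_edgeCode.comp measurable_snd)
  let d : (ℕ → Vertex) × ({e : ℕ × ℕ // e.1 < e.2} → Prop) → LabelledGraph :=
    fun e => (e.1, decodeEdges e.2)
  have hd : Measurable d := measurable_fst.prodMk (measurable_decodeEdges.comp measurable_snd)
  have hdc : ∀ e, d (c e) = e := fun e => Prod.ext rfl (decodeEdges_edgeCode e.2)
  let f : Ω × (Sym2 ℕ → unitInterval) → LabelledGraph :=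
    fun e => (fun i => X i e.1, edgeGraph p (fun i => X i e.1) e.2)
  have hf : Measurable f := hp.measurable_edgeGraph.comp
    ((h.measurable_vertices.comp measurable_fst).prodMk measurable_snd)
  have h1 : Measurable fun ω => c (fun i => X i ω, g ω) := hc.comp h.measurable_labelled
  have h2 : Measurable fun e => c (f e) := hc.comp hf
  have key : P.map (fun ω => c (fun i => X i ω, g ω)) =
      (P.prod labelLaw).map (fun e => c (f e)) := by
    have : IsProbabilityMeasure (P.map (fun ω => c (fun i => X i ω, g ω))) :=
      Measure.isProbabilityMeasure_map h1.aemeasurable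
    -- The field `edges` prescribes exactly the probabilities of the π-system events "vertices in
    -- `F`, all edges of `s` present". Passing to edge codes over `i < j` matches its restriction to
    -- ordered pairs.
    refine pattern_prod_measure_ext (C := {F | MeasurableSet F})
      MeasurableSpace.generateFrom_measurableSet.symm MeasurableSpace.isPiSystem_measurableSet
      MeasurableSet.univ fun F hF s => ?_
    have hF : MeasurableSet F := hF
    have hm := hF.prod (measurableSet_forall_mem s)
    have hs : ∀ e ∈ s.map (Function.Embedding.subtype _), e.1 < e.2 := by
      intro e he
      simp only [Finset.mem_map, Function.Embedding.coe_subtype] at he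
      obtain ⟨e', -, rfl⟩ := he
      exact e'.2
    have hset : ∀ γ : SimpleGraph ℕ, (∀ e ∈ s, edgeCode γ e) ↔
        ∀ e ∈ s.map (Function.Embedding.subtype _), γ.Adj e.1 e.2 := by
      intro γ
      simp [edgeCode]
    have hF' : MeasurableSet ((fun ω i => X i ω) ⁻¹' F) := h.measurable_vertices hF
    have hmod := h.edges (s.map (Function.Embedding.subtype _)) hs ((fun ω i => X i ω) ⁻¹' F)
      ⟨F, hF, rfl⟩
    rw [Measure.map_apply h1 hm, Measure.map_apply h2 hm, Measure.prod_apply (h2 hm)]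
    have e1 : (fun ω => c (fun i => X i ω, g ω)) ⁻¹' (F ×ˢ {v | ∀ e ∈ s, v e}) =
        ((fun ω i => X i ω) ⁻¹' F) ∩
        {ω | ∀ e ∈ s.map (Function.Embedding.subtype _), (g ω).Adj e.1 e.2} := by
      ext ω
      simp only [c, Set.mem_preimage, Set.mem_prod, Set.mem_ofPred_eq, hset, Set.mem_inter_iff]
    change P ((fun ω => c (fun i => X i ω, g ω)) ⁻¹' (F ×ˢ {v | ∀ e ∈ s, v e})) = _
    rw [e1, hmod, ← lintegral_indicator hF']
    refine lintegral_congr fun ω => ?_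
    have e2 : Prod.mk ω ⁻¹' ((fun e => c (f e)) ⁻¹' (F ×ˢ {v | ∀ e ∈ s, v e})) =
        {u | (fun i => X i ω) ∈ F ∧ ∀ e ∈ s.map (Function.Embedding.subtype _),
          (edgeGraph p (fun i => X i ω) u).Adj e.1 e.2} := by
      ext u
      simp only [c, f, Set.mem_preimage, Set.mem_prod, Set.mem_ofPred_eq, hset]
    rw [e2]
    by_cases hω : (fun i => X i ω) ∈ F
    · rw [Set.indicator_of_mem (by exact hω)]
      simp only [hω, true_and]
      exact (hp.labelLaw_adj (fun i => X i ω) _ hs).symm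
    · rw [Set.indicator_of_notMem (by exact hω)]
      simp [hω]
  calc ∫⁻ ω, H (fun i => X i ω, g ω) ∂P
      = ∫⁻ ω, H (d (c (fun i => X i ω, g ω))) ∂P := by simp_rw [hdc]
    _ = ∫⁻ e, H (d e) ∂P.map (fun ω => c (fun i => X i ω, g ω)) :=
        (lintegral_map (hH.comp hd) h1).symm
    _ = ∫⁻ e, H (d (c (f e))) ∂P.prod labelLaw := by
        rw [key]
        exact lintegral_map (hH.comp hd) h2
    _ = ∫⁻ e, H (f e) ∂P.prod labelLaw := by simp_rw [hdc]
    _ = _ := lintegral_prod _ (hH.comp hf).aemeasurable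

end Law

end CoxPercolation

namespace CoxPercolation

variable {p : Vertex → Vertex → ℝ}

/-! ### Probabilities of graph events given the vertices -/

/-- Events whose preimages under the embedding of labelled graphs are measurable. -/
def IsObservable (E : Set GeometricGraph) : Prop :=
  MeasurableSet {e : LabelledGraph | embed e.1 e.2 ∈ E}

theorem isObservable_of_measurableSet {E : Set GeometricGraph} (hE : MeasurableSet E) :
    IsObservable E := measurable_embed hE

/-- The probability of the event `E` given that the vertices are the points of `x`. -/
def edgeProb (p : Vertex → Vertex → ℝ) (E : Set GeometricGraph) (x : ℕ → Vertex) : ℝ≥0∞ :=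
  labelLaw {u | embed x (edgeGraph p x u) ∈ E}

theorem edgeProb_le_one (E : Set GeometricGraph) (x : ℕ → Vertex) : edgeProb p E x ≤ 1 :=
  prob_le_one

theorem IsConnectionFunction.measurableSet_edge_event (hp : IsConnectionFunction p)
    {E : Set GeometricGraph} (hE : IsObservable E) : MeasurableSet
      {e : (ℕ → Vertex) × (Sym2 ℕ → unitInterval) | embed e.1 (edgeGraph p e.1 e.2) ∈ E} :=
  hp.measurable_edgeGraph hE

theorem IsConnectionFunction.measurableSet_label_event (hp : IsConnectionFunction p)
    {E : Set GeometricGraph} (hE : IsObservable E) (x : ℕ → Vertex) :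
    MeasurableSet {u | embed x (edgeGraph p x u) ∈ E} :=
  measurable_prodMk_left (hp.measurableSet_edge_event hE)

theorem IsConnectionFunction.measurable_edgeProb (hp : IsConnectionFunction p)
    {E : Set GeometricGraph} (hE : IsObservable E) : Measurable (edgeProb p E) :=
  measurable_measure_prodMk_left (hp.measurableSet_edge_event hE)

theorem IsCoxModel.measure_event {Ω : Type*} [MeasurableSpace Ω] {P : Measure Ω}
    [IsProbabilityMeasure P] {β τ φ : ℝ} {lam : ℝ} {Y : ℕ → Ω → Plane × ℝ} {X : ℕ → Ω → Vertex}
    {g : Ω → SimpleGraph ℕ} (h : IsCoxModel P β τ φ p lam Y X g) (hp : IsConnectionFunction p)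
    {E : Set GeometricGraph} (hE : IsObservable E) :
    P {ω | embed (fun i => X i ω) (g ω) ∈ E} = ∫⁻ ω, edgeProb p E (fun i => X i ω) ∂P := by
  have h1 := h.lintegral_labelled hp
    (H := {e : LabelledGraph | embed e.1 e.2 ∈ E}.indicator 1) (measurable_one.indicator hE)
  have hm : MeasurableSet {ω | embed (fun i => X i ω) (g ω) ∈ E} := h.measurable_labelled hE
  rw [← lintegral_indicator_one hm]
  refine Eq.trans h1 (lintegral_congr fun ω => ?_)
  rw [edgeProb, ← lintegral_indicator_one (hp.measurableSet_label_event hE _)]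
  rfl

/-- The event `E` depends only on the part of the graph located in `D`. -/
def IsLocal (D : Set Plane) (E : Set GeometricGraph) : Prop :=
  ∀ G G' : GeometricGraph, G.restrict D = G'.restrict D → (G ∈ E ↔ G' ∈ E)

theorem restrict_univ (G : GeometricGraph) : G.restrict Set.univ = G := by
  refine SimpleGraph.Subgraph.ext ?_ ?_
  · ext a; simp [GeometricGraph.restrict]
  · ext a b
    simp only [GeometricGraph.restrict, SimpleGraph.Subgraph.induce_adj, Set.mem_ofPred_eq,
      Set.mem_univ, and_true]
    exact ⟨fun h => h.2.2, fun h => ⟨h.fst_mem, h.snd_mem, h⟩⟩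

theorem isLocal_univ (E : Set GeometricGraph) : IsLocal Set.univ E := by
  intro G G' h
  rw [restrict_univ, restrict_univ] at h
  rw [h]

theorem restrict_embed_verts (x : ℕ → Vertex) (γ : SimpleGraph ℕ) (D : Set Plane) (a : Vertex) :
    a ∈ ((embed x γ).restrict D).verts ↔ (∃ i, x i = a) ∧ a.1 ∈ D := Iff.rfl

theorem restrict_embed_adj (x : ℕ → Vertex) (γ : SimpleGraph ℕ) (D : Set Plane) (a b : Vertex) :
    ((embed x γ).restrict D).Adj a b ↔
      a.1 ∈ D ∧ b.1 ∈ D ∧ a ≠ b ∧ ∃ i j, x i = a ∧ x j = b ∧ γ.Adj i j := by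
  simp only [GeometricGraph.restrict, SimpleGraph.Subgraph.induce_adj, embed, Set.mem_ofPred_eq,
    Set.mem_range]
  constructor
  · rintro ⟨⟨-, ha⟩, ⟨-, hb⟩, h⟩
    exact ⟨ha, hb, h⟩
  · rintro ⟨ha, hb, hab, i, j, hi, hj, h⟩
    exact ⟨⟨⟨i, hi⟩, ha⟩, ⟨⟨j, hj⟩, hb⟩, hab, i, j, hi, hj, h⟩

/-- After transporting the edge labels along `e`, which preserves their law, the two graphs coincide
inside `D`, and a local event sees nothing else. -/
theorem IsConnectionFunction.edgeProb_eq_of_perm (hp : IsConnectionFunction p)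
    {E : Set GeometricGraph} (hE : IsObservable E) {D : Set Plane} (hD : IsLocal D E)
    {x y : ℕ → Vertex} (e : Equiv.Perm ℕ)
    (he : ∀ i, (x i).1 ∈ D ∨ (y (e i)).1 ∈ D → y (e i) = x i) :
    edgeProb p E x = edgeProb p E y := by
  rw [edgeProb, ← (measurePreserving_labels e.injective).measure_preimage
    (hp.measurableSet_label_event hE x).nullMeasurableSet, edgeProb]
  congr 1
  ext u
  refine hD _ _ (SimpleGraph.Subgraph.ext ?_ ?_)
  · ext a
    rw [restrict_embed_verts, restrict_embed_verts]
    refine and_congr_left fun ha => ⟨?_, ?_⟩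
    · rintro ⟨i, rfl⟩
      exact ⟨e i, he i (.inl ha)⟩
    · rintro ⟨j, rfl⟩
      obtain ⟨i, rfl⟩ := e.surjective j
      exact ⟨i, (he i (.inr ha)).symm⟩
  · ext a b
    rw [restrict_embed_adj, restrict_embed_adj]
    refine and_congr_right fun ha => and_congr_right fun hb => and_congr_right fun _ => ⟨?_, ?_⟩
    · rintro ⟨i, j, rfl, rfl, h⟩
      refine ⟨e i, e j, he i (.inl ha), he j (.inl hb), ?_⟩
      rw [hp.edgeGraph_adj] at h ⊢
      rw [he i (.inl ha), he j (.inl hb)]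
      exact ⟨e.injective.ne h.1, h.2⟩
    · rintro ⟨k, l, rfl, rfl, h⟩
      obtain ⟨i, rfl⟩ := e.surjective k
      obtain ⟨j, rfl⟩ := e.surjective l
      have hi := he i (.inr ha)
      have hj := he j (.inr hb)
      refine ⟨i, j, hi.symm, hj.symm, ?_⟩
      rw [hp.edgeGraph_adj] at h ⊢
      rw [hi, hj] at h
      exact ⟨fun hij => h.1 (by rw [hij]), h.2⟩

theorem IsConnectionFunction.edgeProb_eq_of_range_eq (hp : IsConnectionFunction p)
    {E : Set GeometricGraph} (hE : IsObservable E) (x y : ℕ → Vertex) (hx : IsGood x)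
    (hy : IsGood y) (h : Set.range x = Set.range y) : edgeProb p E x = edgeProb p E y := by
  obtain ⟨e, he⟩ := exists_perm_of_range_eq hx.injective hy.injective h
  exact hp.edgeProb_eq_of_perm hE (isLocal_univ E) e fun i _ => he i

/-- Matching the labels of the common points is a bijection between two finite sets of labels. Their
complements are both countably infinite, so it extends to a permutation of `ℕ`. -/
theorem exists_perm_of_range_inter_eq {S : Type*} {x y : ℕ → S} (hx : Function.Injective x)
    (hy : Function.Injective y) {D : Set S} (hfx : {i | x i ∈ D}.Finite)
    (hfy : {i | y i ∈ D}.Finite) (h : Set.range x ∩ D = Set.range y ∩ D) :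
    ∃ e : Equiv.Perm ℕ, ∀ i, x i ∈ D ∨ y (e i) ∈ D → y (e i) = x i := by
  classical
  have h1 : ∀ i : {i | x i ∈ D}, ∃ j, y j = x i := fun i => by
    have : x i ∈ Set.range x ∩ D := ⟨⟨i, rfl⟩, i.2⟩
    rw [h] at this
    exact this.1
  have h2 : ∀ j : {j | y j ∈ D}, ∃ i, x i = y j := fun j => by
    have : y j ∈ Set.range y ∩ D := ⟨⟨j, rfl⟩, j.2⟩
    rw [← h] at this
    exact this.1
  choose f hf using h1
  choose k hk using h2
  let e1 : {i | x i ∈ D} ≃ {j | y j ∈ D} :=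
    { toFun := fun i => ⟨f i, show y (f i) ∈ D by rw [hf]; exact i.2⟩
      invFun := fun j => ⟨k j, show x (k j) ∈ D by rw [hk]; exact j.2⟩
      left_inv := fun i => Subtype.ext (hx (by rw [hk]; exact hf i))
      right_inv := fun j => Subtype.ext (hy (by rw [hf]; exact hk j)) }
  have : Infinite {i // i ∉ {i | x i ∈ D}} := hfx.infinite_compl.to_subtype
  have : Infinite {i // i ∉ {j | y j ∈ D}} := hfy.infinite_compl.to_subtype
  obtain ⟨e2⟩ : Nonempty ({i // i ∉ {i | x i ∈ D}} ≃ {i // i ∉ {j | y j ∈ D}}) :=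
    nonempty_equiv_of_countable
  let e : Equiv.Perm ℕ := (Equiv.sumCompl (· ∈ {i | x i ∈ D})).symm.trans
    ((Equiv.sumCongr e1 e2).trans (Equiv.sumCompl (· ∈ {j | y j ∈ D})))
  have hin : ∀ i (hi : i ∈ {i | x i ∈ D}), y (e i) = x i := by
    intro i hi
    have : e i = f ⟨i, hi⟩ := by
      simp only [e, Equiv.trans_apply]
      rw [Equiv.sumCompl_symm_apply_of_pos hi]
      rfl
    rw [this, hf]
  refine ⟨e, fun i hi => ?_⟩
  by_cases hxi : i ∈ {i | x i ∈ D}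
  · exact hin i hxi
  · exfalso
    have hyi := hi.resolve_left hxi
    have : e i = (e2 ⟨i, hxi⟩ : ℕ) := by
      simp only [e, Equiv.trans_apply]
      rw [Equiv.sumCompl_symm_apply_of_neg hxi]
      rfl
    rw [this] at hyi
    exact (e2 ⟨i, hxi⟩).2 hyi

theorem IsConnectionFunction.edgeProb_eq_of_range_inter_eq (hp : IsConnectionFunction p)
    {E : Set GeometricGraph} (hE : IsObservable E) {D : Set Plane} {R : ℝ}
    (hDR : D ⊆ Metric.ball 0 R) (hD : IsLocal D E) (x y : ℕ → Vertex) (hx : IsGood x)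
    (hy : IsGood y) (h : Set.range x ∩ {a | a.1 ∈ D} = Set.range y ∩ {a | a.1 ∈ D}) :
    edgeProb p E x = edgeProb p E y := by
  have hfin : ∀ {x : ℕ → Vertex}, IsGood x → {i | x i ∈ {a : Vertex | a.1 ∈ D}}.Finite :=
    fun hx => (hx.finite R).subset fun i hi => by simpa using hDR hi
  obtain ⟨e, he⟩ := exists_perm_of_range_inter_eq hx.injective hy.injective (hfin hx) (hfin hy) h
  exact hp.edgeProb_eq_of_perm hE hD e he

/-- Passing to a subsequence of the vertices decreases the probability of increasing events. -/
theorem IsConnectionFunction.edgeProb_comp_le (hp : IsConnectionFunction p)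
    {E : Set GeometricGraph} (hE : IsObservable E) (hup : IsUpperSet E) (x : ℕ → Vertex)
    {n : ℕ → ℕ} (hn : Function.Injective n) :
    edgeProb p E (fun i => x (n i)) ≤ edgeProb p E x := by
  rw [edgeProb, ← (measurePreserving_labels hn).measure_preimage
    (hp.measurableSet_label_event hE _).nullMeasurableSet, edgeProb]
  refine measure_mono fun u hu => hup (a := embed (fun i => x (n i))
    (edgeGraph p (fun i => x (n i)) fun z => u (Sym2.map n z))) ⟨?_, ?_⟩ hu
  · rintro _ ⟨i, rfl⟩
    exact ⟨n i, rfl⟩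
  · rintro a b ⟨hab, i, j, rfl, rfl, h⟩
    refine ⟨hab, n i, n j, rfl, rfl, ?_⟩
    rw [hp.edgeGraph_adj] at h ⊢
    exact ⟨hn.ne h.1, h.2⟩

theorem embed_shift (z : Plane) (x : ℕ → Vertex) (γ : SimpleGraph ℕ) :
    embed (fun i => shiftLoc z (x i)) γ = (embed x γ).translate z := by
  have hs : ∀ a b : Vertex, shiftLoc z a = b ↔ a = shift (-z) b := by
    rintro ⟨a, u⟩ ⟨b, v⟩
    simp only [shiftLoc, shift, Prod.mk.injEq, eq_add_neg_iff_add_eq]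
  refine SimpleGraph.Subgraph.ext ?_ ?_
  · ext a
    simp [embed, GeometricGraph.translate, hs]
  · ext a b
    simp only [embed, GeometricGraph.translate, hs]
    rw [(shift_neg_injective z).ne_iff]

/-- Translation invariance of `p` makes the label graph unchanged under the shift, so only the
embedding moves. -/
theorem IsConnectionFunction.edgeProb_shift (hp : IsConnectionFunction p)
    (E : Set GeometricGraph) (z : Plane) (x : ℕ → Vertex) :
    edgeProb p E (fun i => shiftLoc z (x i)) =
      edgeProb p {G | GeometricGraph.translate z G ∈ E} x := by
  rw [edgeProb, edgeProb]
  have : ∀ u, edgeGraph p (fun i => shiftLoc z (x i)) u = edgeGraph p x u := by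
    intro u
    ext i j
    rw [hp.edgeGraph_adj, hp.edgeGraph_adj, ← shift_eq_shiftLoc, hp.translation_invariant]
  simp_rw [this, embed_shift]
  rfl

/-- Local events in disjoint domains are independent given the vertices. -/
theorem IsConnectionFunction.edgeProb_inter (hp : IsConnectionFunction p)
    {E₁ E₂ : Set GeometricGraph} (hE₁ : IsObservable E₁) (hE₂ : IsObservable E₂)
    {D₁ D₂ : Set Plane} (h₁ : IsLocal D₁ E₁) (h₂ : IsLocal D₂ E₂) (hD : Disjoint D₁ D₂)
    (x : ℕ → Vertex) : edgeProb p (E₁ ∩ E₂) x = edgeProb p E₁ x * edgeProb p E₂ x := by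
  classical
  let Z : Set Plane → Set (Sym2 ℕ) := fun D => {z | ∀ i ∈ z, (x i).1 ∈ D}
  let m : Sym2 ℕ → MeasurableSpace (Sym2 ℕ → unitInterval) :=
    fun z => MeasurableSpace.comap (fun u => u z) inferInstance
  have hloc : ∀ {E : Set GeometricGraph} {D : Set Plane}, IsObservable E → IsLocal D E →
      MeasurableSet[⨆ z ∈ Z D, m z] {u | embed x (edgeGraph p x u) ∈ E} := by
    intro E D hE hD
    -- Resetting to zero the labels of all pairs not contained in `D` does not affect a `D`-local
    -- event, so the event is measurable with respect to the remaining labels.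
    let r : (Sym2 ℕ → unitInterval) → (Sym2 ℕ → unitInterval) :=
      fun u z => if z ∈ Z D then u z else 0
    have hr : Measurable[⨆ z ∈ Z D, m z] r := by
      refine @measurable_pi_lambda _ _ _ (⨆ z ∈ Z D, m z) _ _ fun z => ?_
      by_cases hz : z ∈ Z D
      · simp only [r, hz, if_true]
        exact (comap_measurable _).mono (le_iSup₂ (f := fun z (_ : z ∈ Z D) => m z) z hz) le_rfl
      · simp only [r, hz, if_false]
        exact @measurable_const _ _ _ (⨆ z ∈ Z D, m z) _
    have : {u | embed x (edgeGraph p x u) ∈ E} = r ⁻¹' {u | embed x (edgeGraph p x u) ∈ E} := by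
      ext u
      refine hD _ _ (SimpleGraph.Subgraph.ext rfl ?_)
      ext a b
      rw [restrict_embed_adj, restrict_embed_adj]
      refine and_congr_right fun ha => and_congr_right fun hb => and_congr_right fun _ =>
        exists₂_congr fun i j => and_congr_right fun hi => and_congr_right fun hj => ?_
      have hz : s(i, j) ∈ Z D := by
        intro k hk
        rcases Sym2.mem_iff.1 hk with rfl | rfl
        · rw [hi]; exact ha
        · rw [hj]; exact hb
      rw [hp.edgeGraph_adj, hp.edgeGraph_adj]
      simp only [r, hz, if_true]
    rw [this]
    exact hr (hp.measurableSet_label_event hE x)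
  have hind : iIndep m labelLaw :=
    iIndepFun_infinitePi (P := fun _ : Sym2 ℕ => (volume : Measure unitInterval))
      (X := fun _ => id) (fun _ => measurable_id)
  -- An unordered pair has at least one member, whose location cannot lie in both domains.
  have hZ : Disjoint (Z D₁) (Z D₂) := by
    refine Set.disjoint_left.2 fun z h1 h2 => ?_
    induction z using Sym2.ind with
    | _ i j =>
      exact Set.disjoint_left.1 hD (h1 i (Sym2.mem_mk_left i j)) (h2 i (Sym2.mem_mk_left i j))
  have := indep_iSup_of_disjoint (fun z => (measurable_pi_apply z).comap_le) hind hZ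
  exact (Indep_iff _ _ _).1 this _ _ (hloc hE₁ h₁) (hloc hE₂ h₂)

/-! ### Crossing events -/

/-- The labels `i` and `j` are at the same position or are joined by an edge inside `D`. -/
def LabelStep (D : Set Plane) (e : LabelledGraph) (i j : ℕ) : Prop :=
  e.1 i = e.1 j ∨ ((e.1 i).1 ∈ D ∧ (e.1 j).1 ∈ D ∧ e.1 i ≠ e.1 j ∧
    ∃ k l, e.1 k = e.1 i ∧ e.1 l = e.1 j ∧ e.2.Adj k l)

/-- The labels `i` and `j` are joined by `n` steps. -/
def LabelReach (D : Set Plane) (e : LabelledGraph) : ℕ → ℕ → ℕ → Prop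
  | 0, i, j => i = j
  | n + 1, i, j => ∃ k, LabelReach D e n i k ∧ LabelStep D e k j

theorem measurableSet_label_eq (i j : ℕ) : MeasurableSet {e : LabelledGraph | e.1 i = e.1 j} :=
  measurableSet_eq_fun (measurable_label i) (measurable_label j)

theorem measurableSet_label_mem {D : Set Plane} (hD : MeasurableSet D) (i : ℕ) :
    MeasurableSet {e : LabelledGraph | (e.1 i).1 ∈ D} := (measurable_label i).fst hD

theorem measurableSet_labelStep {D : Set Plane} (hD : MeasurableSet D) (i j : ℕ) :
    MeasurableSet {e : LabelledGraph | LabelStep D e i j} := by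
  refine (measurableSet_label_eq i j).union ((measurableSet_label_mem hD i).inter
    ((measurableSet_label_mem hD j).inter ((measurableSet_label_eq i j).compl.inter ?_)))
  have : {e : LabelledGraph | ∃ k l, e.1 k = e.1 i ∧ e.1 l = e.1 j ∧ e.2.Adj k l} = ⋃ k, ⋃ l,
      {e | e.1 k = e.1 i} ∩ ({e | e.1 l = e.1 j} ∩ {e | e.2.Adj k l}) := by
    ext e
    simp
  refine MeasurableSet.congr ?_ this.symm
  exact MeasurableSet.iUnion fun k => MeasurableSet.iUnion fun l =>
    (measurableSet_label_eq k i).inter ((measurableSet_label_eq l j).inter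
      (measurableSet_labelled_adj k l))

theorem measurableSet_labelReach {D : Set Plane} (hD : MeasurableSet D) (n i j : ℕ) :
    MeasurableSet {e : LabelledGraph | LabelReach D e n i j} := by
  induction n generalizing j with
  | zero => simp [LabelReach]
  | succ n ih =>
    simp only [LabelReach, Set.ofPred_exists]
    exact MeasurableSet.iUnion fun k => (ih k).inter (measurableSet_labelStep hD k j)

/-- Replaces paths through an uncountable vertex space by countably many label conditions. Steps
between labels of the same vertex are allowed because an arbitrary sequence may repeat positions. -/
theorem reachable_restrict_iff (D : Set Plane) (e : LabelledGraph) (i j : ℕ) :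
    ((embed e.1 e.2).restrict D).spanningCoe.Reachable (e.1 i) (e.1 j) ↔
      ∃ n, LabelReach D e n i j := by
  constructor
  · intro h
    rw [SimpleGraph.reachable_iff_reflTransGen] at h
    generalize hb : e.1 j = b at h
    induction h generalizing j with
    -- One step rather than none, since `j` may be another label of the vertex labelled by `i`.
    | refl => exact ⟨1, i, rfl, .inl hb.symm⟩
    | @tail b c _ hbc ih =>
      rw [SimpleGraph.Subgraph.spanningCoe_adj, restrict_embed_adj] at hbc
      obtain ⟨h1, h2, h3, k, l, hk, hl, hkl⟩ := hbc
      obtain ⟨n, hn⟩ := ih k hk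
      refine ⟨n + 1, k, hn, .inr ?_⟩
      rw [hb, hk]
      exact ⟨h1, h2, h3, k, l, hk, hl, hkl⟩
  · rintro ⟨n, hn⟩
    induction n generalizing j with
    | zero =>
      obtain rfl : i = j := hn
      exact SimpleGraph.Reachable.refl _
    | succ n ih =>
      obtain ⟨k, hk, hkj⟩ := hn
      refine (ih k hk).trans ?_
      rcases hkj with h | h
      · rw [h]
      · refine SimpleGraph.Adj.reachable ?_
        rw [SimpleGraph.Subgraph.spanningCoe_adj, restrict_embed_adj]
        exact h

/-- On labelled graphs the vertices and paths are indexed by countable sets, so the event is a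
countable union. Measurability is asked only after the embedding, where this argument applies. -/
theorem isObservable_localCrossing (c : Plane) (r : ℝ) :
    IsObservable {G | G.LocalCrossing c r} := by
  have hb : ∀ s, MeasurableSet (Metric.ball c s) := fun s => Metric.isOpen_ball.measurableSet
  have : {e : LabelledGraph | embed e.1 e.2 ∈ {G : GeometricGraph | G.LocalCrossing c r}} =
      ⋃ i, ⋃ j, ⋃ n, {e : LabelledGraph | (e.1 i).1 ∈ Metric.ball c (3 * r)} ∩
        ({e : LabelledGraph | (e.1 j).1 ∈ Metric.ball c (3 * r)} ∩
        ({e : LabelledGraph | (e.1 i).1 ∈ Metric.ball c r} ∩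
        ({e : LabelledGraph | (e.1 j).1 ∈ Metric.ball c (2 * r)}ᶜ ∩
        {e : LabelledGraph | LabelReach (Metric.ball c (3 * r)) e n i j}))) := by
    ext e
    simp only [Set.mem_ofPred_eq, Set.mem_iUnion, Set.mem_inter_iff, Set.mem_compl_iff]
    constructor
    · rintro ⟨a, ⟨⟨i, rfl⟩, ha⟩, b, ⟨⟨j, rfl⟩, hb⟩, h1, h2, h3⟩
      obtain ⟨n, hn⟩ := (reachable_restrict_iff _ _ _ _).1 h3
      exact ⟨i, j, n, ha, hb, h1, h2, hn⟩
    · rintro ⟨i, j, n, ha, hb, h1, h2, hn⟩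
      exact ⟨e.1 i, ⟨⟨i, rfl⟩, ha⟩, e.1 j, ⟨⟨j, rfl⟩, hb⟩, h1, h2,
        (reachable_restrict_iff _ _ _ _).2 ⟨n, hn⟩⟩
  rw [IsObservable, this]
  refine MeasurableSet.iUnion fun i => MeasurableSet.iUnion fun j =>
    MeasurableSet.iUnion fun n => ?_
  exact (measurableSet_label_mem (hb _) i).inter ((measurableSet_label_mem (hb _) j).inter
    ((measurableSet_label_mem (hb _) i).inter ((measurableSet_label_mem (hb _) j).compl.inter
      (measurableSet_labelReach (hb _) n i j))))

theorem isLocal_localCrossing (c : Plane) (r : ℝ) :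
    IsLocal (Metric.ball c (3 * r)) {G | G.LocalCrossing c r} := by
  intro G G' h
  simp only [Set.mem_ofPred_eq, GeometricGraph.LocalCrossing, h]

end CoxPercolation

namespace CoxPercolation

/-! ### Properties of the vertices and of the graph at a fixed intensity. -/

section Items

variable {p : Vertex → Vertex → ℝ} {Ω : Type*} [MeasurableSpace Ω] {P : Measure Ω}
  {β τ φ : ℝ} {lam : ℝ} {Y : ℕ → Ω → Plane × ℝ} {X : ℕ → Ω → Vertex}
  {g : Ω → SimpleGraph ℕ}

theorem IsCoxModel.measure_adj (h : IsCoxModel P β τ φ p lam Y X g)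
    (hp : IsConnectionFunction p) {i j : ℕ} (hij : i ≠ j) {F : Set Ω}
    (hF : MeasurableSet[MeasurableSpace.comap (fun ω i => X i ω) inferInstance] F) :
    P (F ∩ {ω | (g ω).Adj i j}) = ∫⁻ ω in F, ENNReal.ofReal (p (X i ω) (X j ω)) ∂P := by
  rcases lt_or_gt_of_ne hij with hlt | hlt
  · simpa using h.edges {(i, j)} (by simpa using hlt) F hF
  · have := h.edges {(j, i)} (by simpa using hlt) F hF
    simp only [Finset.mem_singleton, forall_eq, Finset.prod_singleton] at this
    simp_rw [hp.symm (X i _), SimpleGraph.adj_comm _ i]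
    exact this

variable [IsProbabilityMeasure P]

/-! ### The vertex locations -/

theorem pointMeasure_eq_of_range_eq {x y : ℕ → Vertex} (hx : IsGood x) (hy : IsGood y)
    (h : Set.range x = Set.range y) :
    pointMeasure (fun i => (x i).1) = pointMeasure (fun i => (y i).1) := by
  refine Measure.ext fun A hA => ?_
  rw [pointMeasure_apply _ hA, pointMeasure_apply _ hA]
  exact tsum_eq_of_range_eq hx.injective hy.injective h fun a => A.indicator 1 a.1

theorem map_add_pointMeasure (x : ℕ → Vertex) (z : Plane) :
    (pointMeasure fun i => (x i).1).map (· + z) = pointMeasure fun i => (shiftLoc z (x i)).1 := by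
  refine Measure.ext fun A hA => ?_
  rw [Measure.map_apply (measurable_add_const z) hA, pointMeasure_apply _ hA,
    pointMeasure_apply _ (measurable_add_const z hA)]
  rfl

theorem IsCoxModel.isStationarySimple (h : IsCoxModel P β τ φ p lam Y X g) (hτ : 0 < τ)
    (hβ : 0 < β) : IsStationarySimple P lam fun ω => pointMeasure fun i => (X i ω).1 where
  locally_finite := by
    filter_upwards [h.vertices_isGood hτ hβ] with ω hω R
    rw [pointMeasure_apply _ Metric.isOpen_ball.measurableSet,
      tsum_eq_sum (s := (hω.finite R).toFinset)]
    · refine ENNReal.sum_lt_top.2 fun i _ => ?_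
      exact (Set.indicator_le_self' (fun _ _ => zero_le) _).trans_lt ENNReal.one_lt_top
    · intro i hi
      refine Set.indicator_of_notMem (fun hmem => hi ?_) _
      simpa using hmem
  simple := by
    filter_upwards [h.vertices_isGood hτ hβ] with ω hω z
    rw [pointMeasure_apply _ (measurableSet_singleton z)]
    by_cases hz : ∃ k, (X k ω).1 = z
    · obtain ⟨k, rfl⟩ := hz
      rw [tsum_eq_single k]
      · simp
      · intro i hi
        have : (X i ω).1 ∉ ({(X k ω).1} : Set Plane) := fun hmem => hi (hω.1 hmem)
        exact Set.indicator_of_notMem this _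
    · rw [ENNReal.tsum_eq_zero.2]
      · exact zero_le
      · intro i
        have : (X i ω).1 ∉ ({z} : Set Plane) := fun hmem => hz ⟨i, hmem⟩
        exact Set.indicator_of_notMem this _
  stationary := by
    intro z
    have hm : Measurable fun x : ℕ → Vertex => pointMeasure fun i => (x i).1 :=
      measurable_pointMeasure fun i => (measurable_pi_apply i).fst
    have m1 : Measurable fun ω => pointMeasure fun i => (X i ω).1 := hm.comp h.measurable_vertices
    have m2 : Measurable fun ω => (pointMeasure fun i => (X i ω).1).map (· + z) :=
      (Measure.measurable_map _ (measurable_add_const z)).comp m1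
    refine ⟨m2.aemeasurable, m1.aemeasurable, Measure.ext fun T hT => ?_⟩
    rw [Measure.map_apply m2 hT, Measure.map_apply m1 hT, ← lintegral_indicator_one (m2 hT),
      ← lintegral_indicator_one (m1 hT)]
    -- An event of the location measure is a function of the vertex sequence that depends only on
    -- its range.
    have := h.vertices_law hτ hβ z
      (F := fun x => T.indicator 1 (pointMeasure fun i => (x i).1))
      ((measurable_one.indicator hT).comp hm)
      (fun x y hx hy hxy => by simp only [pointMeasure_eq_of_range_eq hx hy hxy])
    simp_rw [← map_add_pointMeasure (fun i => X i _) z] at this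
    exact this
  intensity := by
    intro A hA
    have hf : Measurable fun a : Vertex => A.indicator (1 : Plane → ℝ≥0∞) a.1 :=
      (measurable_one.indicator hA).comp measurable_fst
    simp_rw [pointMeasure_apply _ hA]
    rw [campbell h.measurable_X (h.vertices_intensity hτ hβ) hf, lintegral_smul_measure,
      smul_eq_mul]
    congr 1
    have : (fun a : Vertex => A.indicator (1 : Plane → ℝ≥0∞) a.1) =
        (A ×ˢ (Set.univ : Set Mark)).indicator 1 := by
      ext a
      by_cases ha : a.1 ∈ A <;> simp [ha, Set.indicator]
    rw [this, lintegral_indicator_one (hA.prod MeasurableSet.univ), vertexVolume,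
      Measure.prod_prod, measure_univ, mul_one]

/-! ### Translation invariance of the graph -/

theorem IsCoxModel.isTranslationInvariant (h : IsCoxModel P β τ φ p lam Y X g)
    (hp : IsConnectionFunction p) (hτ : 0 < τ) (hβ : 0 < β) :
    IsTranslationInvariant P fun ω => embed (fun i => X i ω) (g ω) := by
  intro z
  have hs : Measurable fun e : LabelledGraph =>
      ((fun i => shiftLoc z (e.1 i), e.2) : LabelledGraph) :=
    (measurable_pi_lambda _ fun i => (measurable_shiftLoc z).comp (measurable_label i)).prodMk
      measurable_snd
  have ht : Measurable fun e : LabelledGraph => GeometricGraph.translate z (embed e.1 e.2) := by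
    simp_rw [← embed_shift]
    exact measurable_embed.comp hs
  have m1 : Measurable fun ω => embed (fun i => X i ω) (g ω) :=
    measurable_embed.comp h.measurable_labelled
  have m2 : Measurable fun ω => GeometricGraph.translate z (embed (fun i => X i ω) (g ω)) :=
    ht.comp h.measurable_labelled
  refine ⟨m2.aemeasurable, m1.aemeasurable, Measure.ext fun E hE => ?_⟩
  rw [Measure.map_apply m2 hE, Measure.map_apply m1 hE]
  have hO := isObservable_of_measurableSet hE
  have hO' : IsObservable {G | GeometricGraph.translate z G ∈ E} := ht hE
  refine (h.measure_event hp hO').trans (Eq.trans ?_ (h.measure_event hp hO).symm)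
  -- The translation passes from the graph to the vertices, whose law is shift invariant.
  simp_rw [← hp.edgeProb_shift]
  exact h.vertices_law hτ hβ z (hp.measurable_edgeProb hO) (hp.edgeProb_eq_of_range_eq hO)

/-! ### Local finiteness of the graph -/

/-- Recentring at the first vertex leaves an inner integral that depends only on its mark. The whole
integral factors into the area of a disc and the integral assumed finite for `p`. -/
theorem IsConnectionFunction.lintegral_edges (hp : IsConnectionFunction p) (n : ℕ) :
    ∫⁻ e : Vertex × Vertex, (locBall Mark n).indicator 1 e.1 * ENNReal.ofReal (p e.1 e.2)
      ∂vertexVolume.prod vertexVolume < ∞ := by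
  have hm : Measurable fun e : Vertex × Vertex => ENNReal.ofReal (p e.1 e.2) :=
    hp.measurable.ennreal_ofReal
  have hm1 : Measurable ((locBall Mark n).indicator (1 : Vertex → ℝ≥0∞)) :=
    measurable_one.indicator (measurableSet_locBall n)
  let q : Mark → ℝ≥0∞ := fun u => ∫⁻ b, ENNReal.ofReal (p (0, u) b) ∂vertexVolume
  have hq : Measurable q :=
    Measurable.lintegral_prod_right' (f := fun e : Mark × Vertex =>
      ENNReal.ofReal (p (0, e.1) e.2))
      (hp.measurable_comp (measurable_const.prodMk measurable_fst) measurable_snd).ennreal_ofReal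
  have hqa : ∀ a : Vertex, ∫⁻ b, ENNReal.ofReal (p a b) ∂vertexVolume = q a.2 := by
    intro a
    have hma : Measurable fun b => ENNReal.ofReal (p a b) :=
      (hp.measurable_comp measurable_const measurable_id).ennreal_ofReal
    have h1 : ∫⁻ b, ENNReal.ofReal (p a b) ∂vertexVolume =
        ∫⁻ b, ENNReal.ofReal (p a (shiftLoc a.1 b)) ∂vertexVolume :=
      ((measurePreserving_shiftLoc uniformMark a.1).lintegral_comp hma).symm
    rw [h1]
    refine lintegral_congr fun b => ?_
    have h2 := hp.translation_invariant a.1 (0, a.2) b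
    rw [shift_eq_shiftLoc] at h2
    have h3 : shiftLoc a.1 ((0, a.2) : Vertex) = a := by simp [shiftLoc]
    rw [h3] at h2
    rw [h2]
  have hqint : ∫⁻ u, q u ∂uniformMark < ∞ := by
    refine lt_of_eq_of_lt (lintegral_congr fun u => ?_) hp.integrable
    exact lintegral_prod _
      (hp.measurable_comp measurable_const measurable_id).ennreal_ofReal.aemeasurable
  have hm2 : Measurable fun e : Vertex × Vertex =>
      (locBall Mark n).indicator (1 : Vertex → ℝ≥0∞) e.1 * ENNReal.ofReal (p e.1 e.2) :=
    (hm1.comp measurable_fst).mul hm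
  rw [lintegral_prod _ hm2.aemeasurable]
  have hm3 : ∀ a, Measurable fun b => ENNReal.ofReal (p a b) := fun a =>
    (hp.measurable_comp measurable_const measurable_id).ennreal_ofReal
  simp_rw [lintegral_const_mul _ (hm3 _), hqa]
  have : ∀ a : Vertex, (locBall Mark n).indicator (1 : Vertex → ℝ≥0∞) a * q a.2 =
      (Metric.ball (0 : Plane) n).indicator (1 : Plane → ℝ≥0∞) a.1 * q a.2 := by
    intro a
    congr 1
    by_cases ha : ‖a.1‖ < n <;> simp [locBall, Set.indicator, ha]
  simp_rw [this]
  rw [vertexVolume, lintegral_prod_mul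
    ((measurable_one.indicator Metric.isOpen_ball.measurableSet).aemeasurable) hq.aemeasurable,
    lintegral_indicator_one Metric.isOpen_ball.measurableSet]
  exact ENNReal.mul_lt_top measure_ball_lt_top hqint

/-- The mean number of edges whose first endpoint lies in a fixed ball is finite, by the second
factorial moment bound. Hence almost surely this number is finite for all integer radii at once, and
every vertex lies in one of these balls. No Palm measure is required. -/
theorem IsCoxModel.isLocallyFinite (h : IsCoxModel P β τ φ p lam Y X g)
    (hp : IsConnectionFunction p) (hτ : 0 < τ) (hβ : 0 < β) :
    IsLocallyFinite P fun ω => embed (fun i => X i ω) (g ω) := by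
  have hEdge : ∀ n : ℕ, ∀ᵐ ω ∂P, ∑' e : ℕ × ℕ,
      ({ω | X e.1 ω ∈ locBall Mark n} ∩ {ω | (g ω).Adj e.1 e.2}).indicator
        (1 : Ω → ℝ≥0∞) ω < ∞ := by
    intro n
    have hB : ∀ i, MeasurableSet {ω | X i ω ∈ locBall Mark n} := fun i =>
      h.measurable_X i (measurableSet_locBall n)
    have hA : ∀ e : ℕ × ℕ, MeasurableSet
        ({ω | X e.1 ω ∈ locBall Mark n} ∩ {ω | (g ω).Adj e.1 e.2}) := fun e =>
      (hB e.1).inter (h.measurable_g e.1 e.2)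
    have hm : Measurable fun e : Vertex × Vertex =>
        (locBall Mark n).indicator (1 : Vertex → ℝ≥0∞) e.1 * ENNReal.ofReal (p e.1 e.2) :=
      ((measurable_one.indicator (measurableSet_locBall n)).comp measurable_fst).mul
        hp.measurable.ennreal_ofReal
    refine ae_lt_top (Measurable.tsum fun e => measurable_one.indicator (hA e)) ?_
    rw [lintegral_tsum fun e => (measurable_one.indicator (hA e)).aemeasurable]
    have key := h.lintegral_factorialMeasure_le hτ hβ hm
    rw [lintegral_factorialMeasure h.measurable_X hm] at key
    refine ne_of_lt (lt_of_le_of_lt (le_of_eq (tsum_congr fun e => ?_)) (key.trans_lt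
      (ENNReal.mul_lt_top (ENNReal.mul_lt_top ENNReal.ofReal_lt_top ENNReal.ofReal_lt_top)
        (ENNReal.mul_lt_top (by simp) (hp.lintegral_edges n)))))
    rw [lintegral_indicator_one (hA e)]
    by_cases he : e.1 = e.2
    · simp [he]
    · have hF : MeasurableSet[MeasurableSpace.comap (fun ω i => X i ω) inferInstance]
          {ω | X e.1 ω ∈ locBall Mark n} :=
        ⟨(fun x : ℕ → Vertex => x e.1) ⁻¹' locBall Mark n,
          measurable_pi_apply e.1 (measurableSet_locBall n), rfl⟩
      rw [h.measure_adj hp he hF, ← lintegral_indicator (hB e.1)]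
      simp only [he, if_false, one_mul]
      refine lintegral_congr fun ω => ?_
      by_cases hω : X e.1 ω ∈ locBall Mark n <;> simp [hω, Set.indicator]
  filter_upwards [ae_all_iff.2 hEdge, h.vertices_isGood hτ hβ] with ω hω hgood
  rintro _ ⟨i, rfl⟩
  obtain ⟨n, hn⟩ := exists_nat_gt ‖(X i ω).1‖
  have ht := ENNReal.tendsto_cofinite_zero_of_tsum_ne_top (hω n).ne
  have hfin := ht.eventually_lt_const one_pos
  rw [eventually_cofinite] at hfin
  refine (hfin.image fun e => X e.2 ω).subset ?_
  rintro b ⟨-, k, j, hk, hj, hadj⟩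
  obtain rfl : k = i := hgood.injective hk
  refine ⟨(k, j), ?_, hj⟩
  have : ω ∈ {ω | X k ω ∈ locBall Mark n} ∩ {ω | (g ω).Adj k j} := ⟨hn, hadj⟩
  simp only [Set.mem_ofPred_eq, not_lt]
  rw [Set.indicator_of_mem this]
  rfl

/-! ### Monotonicity in the distance -/

theorem IsCoxModel.condExp_adj (h : IsCoxModel P β τ φ p lam Y X g)
    (hp : IsConnectionFunction p) {i j : ℕ} (hij : i ≠ j) :
    P[{ω | (g ω).Adj i j}.indicator (fun _ => (1 : ℝ)) |
      MeasurableSpace.comap (fun ω k => X k ω) inferInstance] =ᵐ[P]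
      fun ω => p (X i ω) (X j ω) := by
  have hle : MeasurableSpace.comap (fun ω k => X k ω) inferInstance ≤ ‹MeasurableSpace Ω› :=
    h.measurable_vertices.comap_le
  have hmp : Measurable fun ω => p (X i ω) (X j ω) :=
    hp.measurable_comp (h.measurable_X i) (h.measurable_X j)
  have hint : Integrable (fun ω => p (X i ω) (X j ω)) P := by
    refine Integrable.of_bound hmp.aestronglyMeasurable 1 (Eventually.of_forall fun ω => ?_)
    rw [Real.norm_eq_abs, abs_of_nonneg (hp.nonneg _ _)]
    exact hp.le_one _ _
  symm
  refine ae_eq_condExp_of_forall_setIntegral_eq hle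
    ((integrable_const (1 : ℝ)).indicator (h.measurable_g i j)) (fun s _ _ => hint.integrableOn)
    (fun F hF _ => ?_) ?_
  · have hF' := hle F hF
    rw [integral_eq_lintegral_of_nonneg_ae (Eventually.of_forall fun ω => hp.nonneg _ _)
      hmp.aestronglyMeasurable.restrict, ← h.measure_adj hp hij hF,
      setIntegral_indicator (h.measurable_g i j)]
    simp [Measure.real]
  · have hX : ∀ k, Measurable[MeasurableSpace.comap (fun ω k => X k ω) inferInstance] (X k) :=
      fun k => (measurable_pi_apply (X := fun _ : ℕ => Vertex) k).comp
        (comap_measurable fun ω k => X k ω)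
    exact (hp.measurable.comp ((hX i).prodMk (hX j))).stronglyMeasurable.aestronglyMeasurable

theorem IsCoxModel.connectionDecreasesInDistance (h : IsCoxModel P β τ φ p lam Y X g)
    (hp : IsConnectionFunction p) (hτ : 0 < τ) (hβ : 0 < β) (hdec : NonincreasingInDistance p) :
    ConnectionDecreasesInDistance P X g := by
  -- The profile is read off along the first coordinate axis.
  refine ⟨fun u v t => p (0, u) (EuclideanSpace.single 0 t, v), fun u v t ht t' _ htt' => ?_,
    fun i j hij => (h.condExp_adj hp hij).trans ?_⟩
  · have ht : 0 < t := ht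
    refine hdec u v _ _ _ _ (fun h0 => ?_) ?_
    · have := congrArg norm h0
      simp only [norm_zero, PiLp.norm_single, Real.norm_eq_abs] at this
      exact ht.ne' (abs_eq_zero.1 this.symm)
    · simpa [abs_of_pos ht, abs_of_pos (ht.trans_le htt')] using htt'
  · filter_upwards [h.vertices_isGood hτ hβ] with ω hω
    have hne : (X i ω).1 ≠ (X j ω).1 := fun he => hij (hω.1 he)
    have hd : dist (0 : Plane) (EuclideanSpace.single 0 (dist (X i ω).1 (X j ω).1)) =
        dist (X i ω).1 (X j ω).1 := by simp
    -- Monotonicity used in both directions at equal distances shows that `p` is radial; coinciding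
    -- locations must be excluded, and almost surely do not occur.
    refine le_antisymm (hdec _ _ _ _ _ _ (fun h0 => ?_) hd.le) (hdec _ _ _ _ _ _ hne hd.ge)
    rw [h0, dist_self] at hd
    exact hne (dist_eq_zero.1 hd.symm)

end Items

end CoxPercolation

namespace CoxPercolation

/-! ### Thinning -/

/-- The label `i` is retained. -/
def Retained (q : ℝ≥0) (b : ℕ → unitInterval) (i : ℕ) : Prop := (b i : ℝ) < q

open Classical in
/-- An enumeration of the retained labels. -/
def retainedSeq (q : ℝ≥0) (b : ℕ → unitInterval) (k : ℕ) : ℕ :=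
  if {i | Retained q b i}.Infinite then Nat.nth (Retained q b) k else k

/-- The law of independent uniform labels of the vertices. -/
def thinningLaw : Measure (ℕ → unitInterval) := Measure.infinitePi fun _ => volume

instance : IsProbabilityMeasure thinningLaw := by unfold thinningLaw; infer_instance

variable {q : ℝ≥0}

/-- The identity branch for finitely many retained labels, a null case when `0 < q ≤ 1`, makes this
true for every `b`, so a thinned sequence is always a genuine subsequence. -/
theorem strictMono_retainedSeq (b : ℕ → unitInterval) : StrictMono (retainedSeq q b) := by
  intro k l hkl
  unfold retainedSeq
  split_ifs with h
  · exact Nat.nth_strictMono h hkl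
  · exact hkl

theorem measurableSet_retained (i : ℕ) : MeasurableSet {b | Retained q b i} :=
  measurableSet_lt (measurable_subtype_coe.comp (measurable_pi_apply i)) measurable_const

theorem measurableSet_infinite_retained : MeasurableSet {b | {i | Retained q b i}.Infinite} := by
  have : {b | {i | Retained q b i}.Infinite} =
      ⋂ n : ℕ, ⋃ i : ℕ, ⋃ _ : n < i, {b | Retained q b i} := by
    ext b
    simp only [Set.mem_ofPred_eq, Set.mem_iInter, Set.mem_iUnion]
    rw [Set.infinite_iff_exists_gt]
    refine forall_congr' fun n => exists_congr fun i => ?_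
    simp only [Set.mem_ofPred_eq, exists_prop]
    exact and_comm
  rw [this]
  exact MeasurableSet.iInter fun n => MeasurableSet.iUnion fun i => MeasurableSet.iUnion fun _ =>
    measurableSet_retained i

open Classical in
theorem measurable_count_retained (m : ℕ) : Measurable fun b => Nat.count (Retained q b) m := by
  induction m with
  | zero => simp
  | succ m ih =>
    simp_rw [Nat.count_succ]
    exact ih.add (Measurable.ite (measurableSet_retained m) measurable_const measurable_const)

open Classical in
-- The `k`-th retained label is `m` exactly when `m` is retained and `k` retained labels precede it,
-- a condition on finitely many coordinates.
theorem measurable_retainedSeq (k : ℕ) : Measurable fun b => retainedSeq q b k := by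
  refine measurable_to_countable' fun m => ?_
  have : (fun b => retainedSeq q b k) ⁻¹' {m} =
      ({b | {i | Retained q b i}.Infinite} ∩ ({b | Retained q b m} ∩
        {b | Nat.count (Retained q b) m = k})) ∪
      ({b | {i | Retained q b i}.Infinite}ᶜ ∩ {_b | k = m}) := by
    ext b
    simp only [Set.mem_preimage, Set.mem_singleton_iff, Set.mem_union, Set.mem_inter_iff,
      Set.mem_ofPred_eq, Set.mem_compl_iff, retainedSeq]
    split_ifs with h
    · simp only [h, true_and, not_true_eq_false, false_and, or_false]
      constructor
      · rintro rfl
        exact ⟨Nat.nth_mem_of_infinite h k, Nat.count_nth_of_infinite h k⟩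
      · rintro ⟨h1, rfl⟩
        exact Nat.nth_count h1
    · simp [h]
  rw [this]
  refine (measurableSet_infinite_retained.inter ((measurableSet_retained m).inter
    (measurable_count_retained m (measurableSet_singleton k)))).union
    (measurableSet_infinite_retained.compl.inter (MeasurableSet.const _))

theorem thinningLaw_forall_not (hq : q ≤ 1) (s : Finset ℕ) :
    thinningLaw {b | ∀ i ∈ s, ¬ Retained q b i} = ((1 - q : ℝ≥0) : ℝ≥0∞) ^ s.card := by
  have hq' : (q : ℝ) ≤ 1 := by exact_mod_cast hq
  have : {b | ∀ i ∈ s, ¬ Retained q b i} =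
      Set.pi (s : Set ℕ) fun _ => Set.Ici (⟨q, q.2, hq'⟩ : unitInterval) := by
    ext b
    simp only [Set.mem_ofPred_eq, Retained, not_lt, Set.mem_pi, Finset.mem_coe, Set.mem_Ici]
    rfl
  rw [this, thinningLaw, Measure.infinitePi_pi _ fun _ _ => measurableSet_Ici]
  simp only [unitInterval.volume_Ici, Finset.prod_const]
  congr 1

/-- The probability that none of `m` consecutive labels is retained is `(1 - q) ^ m`, which tends to
zero. -/
theorem ae_infinite_retained (h0 : 0 < q) (hq : q ≤ 1) :
    ∀ᵐ b ∂thinningLaw, {i | Retained q b i}.Infinite := by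
  have hlt : ((1 - q : ℝ≥0) : ℝ≥0∞) < 1 := by
    exact_mod_cast tsub_lt_self one_pos h0
  have h1 : ∀ n : ℕ, thinningLaw {b | ∀ i, n < i → ¬ Retained q b i} = 0 := by
    intro n
    refine le_antisymm (ge_of_tendsto' (ENNReal.tendsto_pow_atTop_nhds_zero_of_lt_one hlt)
      fun m => ?_) zero_le
    have := thinningLaw_forall_not hq (Finset.Ioc n (n + m))
    rw [Nat.card_Ioc, Nat.add_sub_cancel_left] at this
    rw [← this]
    exact measure_mono fun b hb i hi => hb i (Finset.mem_Ioc.1 hi).1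
  have h2 : ∀ᵐ b ∂thinningLaw, ∀ n : ℕ, ¬ ∀ i, n < i → ¬ Retained q b i :=
    ae_all_iff.2 fun n => measure_eq_zero_iff_ae_notMem.1 (h1 n)
  filter_upwards [h2] with b hb
  refine Set.infinite_of_forall_exists_gt fun n => ?_
  have := hb n
  push Not at this
  obtain ⟨i, hi, h⟩ := this
  exact ⟨i, h, hi⟩

theorem IsGood.comp_strictMono {T : Type*} {x : ℕ → Plane × T} (hx : IsGood x) {n : ℕ → ℕ}
    (hn : StrictMono n) : IsGood fun k => x (n k) :=
  ⟨hx.1.comp hn.injective, fun R => (hx.2 R).imp fun _ hN i hi => hN _ (hi.trans (hn.id_le i))⟩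

theorem pointMeasure_eq_card {S : Type*} [MeasurableSpace S] (x : ℕ → S) {A : Set S}
    (hA : MeasurableSet A) (s : Finset ℕ) (hs : ∀ i, i ∈ s ↔ x i ∈ A) :
    pointMeasure x A = s.card := by
  rw [pointMeasure_apply x hA, tsum_eq_sum (s := s)]
  · rw [Finset.sum_congr rfl fun i hi => Set.indicator_of_mem ((hs i).1 hi) _]
    simp
  · intro i hi
    exact Set.indicator_of_notMem (fun h => hi ((hs i).2 h)) _

/-! ### Thinned vertex processes and monotonicity in the intensity. -/

section

variable {p : Vertex → Vertex → ℝ} {Ω Ω' : Type*} [MeasurableSpace Ω] [MeasurableSpace Ω']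
  {P : Measure Ω} {P' : Measure Ω'} [IsProbabilityMeasure P] [IsProbabilityMeasure P']
  {β τ φ : ℝ} {lam lam' : ℝ} {Y : ℕ → Ω → Plane × ℝ} {X : ℕ → Ω → Vertex}
  {g : Ω → SimpleGraph ℕ} {Y' : ℕ → Ω' → Plane × ℝ} {X' : ℕ → Ω' → Vertex}
  {g' : Ω' → SimpleGraph ℕ}

/-- Given `n` vertices in `A`, none is retained with probability `(1 - q) ^ n`. Averaging over the
Poisson count turns this into the void probability for `q` times the intensity. -/
theorem IsCoxModel.void_thinning (h : IsCoxModel P β τ φ p lam Y X g) (hτ : 0 < τ)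
    (hβ : 0 < β) (h0 : 0 < q) (hq : q ≤ 1) {A : Set Vertex} (hA : MeasurableSet A) {R : ℕ}
    (hAR : A ⊆ locBall Mark R) :
    (P.prod thinningLaw) {e | ∀ k, X (retainedSeq q e.2 k) e.1 ∉ A} =
      ∫⁻ ω, expNeg (q * vertexIntensity lam φ (fun i => Y i ω) A) ∂P := by
  have hm : MeasurableSet {e : Ω × (ℕ → unitInterval) | ∀ i, X i e.1 ∈ A → ¬ Retained q e.2 i} := by
    have : {e : Ω × (ℕ → unitInterval) | ∀ i, X i e.1 ∈ A → ¬ Retained q e.2 i} =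
        ⋂ i, ({e | X i e.1 ∈ A}ᶜ ∪ {e | Retained q e.2 i}ᶜ) := by
      ext e
      simp only [Set.mem_ofPred_eq, Set.mem_iInter, Set.mem_union, Set.mem_compl_iff]
      exact forall_congr' fun i => imp_iff_not_or
    rw [this]
    exact MeasurableSet.iInter fun i => ((h.measurable_X i).comp measurable_fst hA).compl.union
      (measurable_snd (measurableSet_retained i)).compl
  have hfin : ∀ᵐ ω ∂P, vertexIntensity lam φ (fun i => Y i ω) A < ∞ :=
    h.vertexIntensity_lt_top hτ hβ hA (volume_prod_lt_top_of_subset_locBall _ hAR)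
  have hae : {e : Ω × (ℕ → unitInterval) | ∀ k, X (retainedSeq q e.2 k) e.1 ∉ A} =ᵐ[P.prod thinningLaw]
      {e : Ω × (ℕ → unitInterval) | ∀ i, X i e.1 ∈ A → ¬ Retained q e.2 i} := by
    have h1 : ∀ᵐ e ∂P.prod thinningLaw, {i | Retained q e.2 i}.Infinite :=
      Measure.quasiMeasurePreserving_snd.ae (ae_infinite_retained h0 hq)
    filter_upwards [h1] with e he
    refine propext ⟨fun h i hi hr => ?_, fun h k hk => h _ hk ?_⟩
    · have : i ∈ Set.range (Nat.nth (Retained q e.2)) := by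
        rw [Nat.range_nth_of_infinite he]; exact hr
      obtain ⟨k, rfl⟩ := this
      refine h k ?_
      rwa [retainedSeq, if_pos he]
    · rw [retainedSeq, if_pos he]
      exact Nat.nth_mem_of_infinite he k
  rw [measure_congr hae, Measure.prod_apply hm]
  have hcount := h.cox_vertices.lintegral_single (measurable_vertexIntensity _ _ h.measurable_Y)
    (measurable_pointMeasure h.measurable_X) hA hfin
    -- `lintegral_single` takes functions on `ℝ≥0∞`; the floor recovers the natural exponent from a
    -- finite count.
    fun a => ((1 - q : ℝ≥0) : ℝ≥0∞) ^ ⌊a.toReal⌋₊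
  have hterm : ∀ n : ℕ, ⌊((n : ℝ≥0∞)).toReal⌋₊ = n := by simp
  simp_rw [hterm, tsum_pow_mul_poissonMeasure _ q hq] at hcount
  rw [← hcount]
  refine lintegral_congr_ae ?_
  filter_upwards [h.vertices_isGood hτ hβ] with ω hω
  have hs : {i | X i ω ∈ A}.Finite := (hω.finite R).subset fun i hi => hAR hi
  rw [pointMeasure_eq_card _ hA hs.toFinset (fun i => by simp), hterm,
    ← thinningLaw_forall_not hq]
  congr 1
  ext b
  simp

theorem IsCoxModel.measure_event_le (h : IsCoxModel P β τ φ p lam Y X g)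
    (h' : IsCoxModel P' β τ φ p lam' Y' X' g') (hp : IsConnectionFunction p) (hτ : 0 < τ)
    (hβ : 0 < β) (hlam : 0 < lam) (hlt : lam < lam') {E : Set GeometricGraph}
    (hE : MeasurableSet E) (hup : IsUpperSet E) :
    P {ω | embed (fun i => X i ω) (g ω) ∈ E} ≤ P' {ω | embed (fun i => X' i ω) (g' ω) ∈ E} := by
  have hO := isObservable_of_measurableSet hE
  have hlam' : 0 < lam' := hlam.trans hlt
  -- The retention probability that turns intensity `lam'` into `lam`.
  let q : ℝ≥0 := (lam / lam').toNNReal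
  have hqr : (q : ℝ) = lam / lam' := Real.coe_toNNReal _ (by positivity)
  have h0 : 0 < q := Real.toNNReal_pos.2 (by positivity)
  have hq : q ≤ 1 := by
    rw [← NNReal.coe_le_coe, hqr]
    exact (div_le_one hlam').2 hlt.le
  have hqlam : (q : ℝ≥0∞) * ENNReal.ofReal lam' = ENNReal.ofReal lam := by
    rw [← ENNReal.ofReal_coe_nnreal, ← ENNReal.ofReal_mul q.coe_nonneg, hqr,
      div_mul_cancel₀ _ hlam'.ne']
  rw [h.measure_event hp hO, h'.measure_event hp hO]
  have hmX : ∀ k, Measurable fun e : Ω' × (ℕ → unitInterval) => X' (retainedSeq q e.2 k) e.1 := by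
    intro k
    have hu : Measurable fun e : ℕ × Ω' => X' e.1 e.2 :=
      measurable_from_prod_countable_right fun i => h'.measurable_X i
    exact hu.comp (((measurable_retainedSeq k).comp measurable_snd).prodMk measurable_fst)
  have hlaw : ∫⁻ ω, edgeProb p E (fun i => X i ω) ∂P =
      ∫⁻ e, edgeProb p E (fun k => X' (retainedSeq q e.2 k) e.1) ∂P'.prod thinningLaw := by
    refine lintegral_eq_of_void (P' := P'.prod thinningLaw)
      (X' := fun k e => X' (retainedSeq q e.2 k) e.1) h.measurable_X hmX
      (h.vertices_isGood hτ hβ) ?_ (fun s => ?_)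
      (hp.measurable_edgeProb hO) (hp.edgeProb_eq_of_range_eq hO)
    · filter_upwards [Measure.quasiMeasurePreserving_fst.ae (h'.vertices_isGood hτ hβ)] with e he
      exact he.comp_strictMono (strictMono_retainedSeq e.2)
    · have hm := measurableSet_testUnion (T := Mark) s
      obtain ⟨n, hn⟩ := testUnion_bounded (T := Mark) s
      rw [h'.void_thinning hτ hβ h0 hq hm hn, h.vertices_void hτ hβ hm
        (volume_prod_lt_top_of_subset_locBall _ hn)]
      -- The shift by zero serves only to compare the environments on the two probability spaces.
      have := h.lintegral_expNeg h' hτ hβ 0 hm (ENNReal.ofReal lam * ENNReal.ofReal φ)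
      have hz : shiftLoc (T := Mark) 0 ⁻¹' testUnion Mark s = testUnion Mark s := by
        ext a; simp [shiftLoc]
      rw [hz] at this
      simp_rw [vertexIntensity_apply_eq_tsum _ _ _ hm, ← mul_assoc, hqlam]
      exact this
  rw [hlaw]
  calc ∫⁻ e, edgeProb p E (fun k => X' (retainedSeq q e.2 k) e.1) ∂P'.prod thinningLaw
      ≤ ∫⁻ e, edgeProb p E (fun i => X' i e.1) ∂P'.prod thinningLaw :=
        lintegral_mono fun e =>
          hp.edgeProb_comp_le hO hup (fun i => X' i e.1) (strictMono_retainedSeq e.2).injective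
    _ = _ := by
        have hm : Measurable fun e : Ω' × (ℕ → unitInterval) => edgeProb p E (fun i => X' i e.1) :=
          (hp.measurable_edgeProb hO).comp (h'.measurable_vertices.comp measurable_fst)
        rw [lintegral_prod _ hm.aemeasurable]
        simp

end

end CoxPercolation

namespace CoxPercolation

/-! ### Conditional independence of Cox processes on disjoint sets -/

section Kernels

variable {T : Type*} [TopologicalSpace T] [SecondCountableTopology T] [Nonempty T]
  [MeasurableSpace T] [BorelSpace T] {Ω : Type*} [MeasurableSpace Ω] {P : Measure Ω}
  {M : Ω → Measure (Plane × T)} {X : ℕ → Ω → Plane × T} {D D₁ D₂ : Set (Plane × T)}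

/-- The masses of the finite unions of test sets in `D`. -/
def testMass (D : Set (Plane × T)) (m : Measure (Plane × T)) (s : Finset (ℕ × ℕ)) : ℝ≥0∞ :=
  m (testUnion T s ∩ D)

theorem measurable_testMass (hD : MeasurableSet D) : Measurable (testMass D) :=
  measurable_pi_lambda _ fun s => Measure.measurable_coe ((measurableSet_testUnion s).inter hD)

theorem measurable_voidPattern_comp (hX : ∀ i, Measurable (X i)) (hD : MeasurableSet D) :
    Measurable fun ω => voidPattern D fun i => X i ω :=
  (measurable_voidPattern hD).comp (measurable_pi_lambda _ hX)

theorem forall_voidPattern_iff_pointMeasure (hD : MeasurableSet D) (x : ℕ → Plane × T)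
    (s : Finset (ℕ × ℕ)) :
    (∀ e ∈ s, voidPattern D x e) ↔ pointMeasure x (testUnion T s ∩ D) = 0 :=
  (forall_voidPattern_iff D x s).trans
    (pointMeasure_eq_zero_iff _ ((measurableSet_testUnion s).inter hD)).symm

variable [IsProbabilityMeasure P]

/-- Conditioning the void pattern on the masses of the test sets in `D` alone is enough, since these
already determine the void probabilities. The resulting kernel has only the directing measure on `D`
as input, and this input can later be replaced by another one. -/
theorem IsCoxProcess.exists_kernel
    (h : IsCoxProcess P M fun ω => pointMeasure fun i => X i ω) (hX : ∀ i, Measurable (X i))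
    (hM : Measurable M) (hfin : ∀ s, ∀ᵐ ω ∂P, M ω (testUnion T s) < ∞) (hD : MeasurableSet D) :
    ∃ κ : Kernel (Finset (ℕ × ℕ) → ℝ≥0∞) (ℕ × ℕ → Prop), IsMarkovKernel κ ∧
      ∀ᵐ ω ∂P, ∀ s, κ (testMass D (M ω)) {v | ∀ e ∈ s, v e} = expNeg (testMass D (M ω) s) := by
  have hV := measurable_voidPattern_comp hX hD
  have hm : Measurable fun ω => testMass D (M ω) := (measurable_testMass hD).comp hM
  refine ⟨condDistrib (fun ω => voidPattern D fun i => X i ω) (fun ω => testMass D (M ω)) P,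
    inferInstance, ae_all_iff.2 fun s => ?_⟩
  have hS := measurableSet_forall_mem s
  have hκ : Measurable fun a => condDistrib (fun ω => voidPattern D fun i => X i ω)
      (fun ω => testMass D (M ω)) P a {v | ∀ e ∈ s, v e} := Kernel.measurable_coe _ hS
  have he : Measurable fun a : Finset (ℕ × ℕ) → ℝ≥0∞ => expNeg (a s) :=
    measurable_expNeg.comp (measurable_pi_apply s)
  have : IsProbabilityMeasure (P.map fun ω => testMass D (M ω)) :=
    Measure.isProbabilityMeasure_map hm.aemeasurable
  refine ae_of_ae_map hm.aemeasurable (p := fun a => condDistrib _ _ P a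
    {v : ℕ × ℕ → Prop | ∀ e ∈ s, v e} = expNeg (a s))
    (ae_eq_of_forall_setLIntegral_eq_of_sigmaFinite hκ he fun t ht _ => ?_)
  rw [setLIntegral_map ht hκ hm, setLIntegral_map ht he hm,
    setLIntegral_preimage_condDistrib hm hV.aemeasurable hS ht]
  have hv := h.measure_void ((measurableSet_testUnion s).inter hD) (by
    filter_upwards [hfin s] with ω hω using (measure_mono Set.inter_subset_left).trans_lt hω)
    (F := (fun ω => testMass D (M ω)) ⁻¹' t) ⟨_, measurable_testMass hD ht, rfl⟩
  simp_rw [← forall_voidPattern_iff_pointMeasure hD] at hv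
  exact hv

/-- Given the directing measure, the patterns of a Cox process on disjoint sets are independent,
and their conditional laws depend only on the directing measure on the respective set. -/
theorem IsCoxProcess.exists_kernels
    (h : IsCoxProcess P M fun ω => pointMeasure fun i => X i ω) (hX : ∀ i, Measurable (X i))
    (hM : Measurable M) (hfin : ∀ s, ∀ᵐ ω ∂P, M ω (testUnion T s) < ∞)
    (hD₁ : MeasurableSet D₁) (hD₂ : MeasurableSet D₂) (hD : Disjoint D₁ D₂) :
    ∃ κ₁ κ₂ : Kernel (Finset (ℕ × ℕ) → ℝ≥0∞) (ℕ × ℕ → Prop),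
      IsMarkovKernel κ₁ ∧ IsMarkovKernel κ₂ ∧
      ∀ F₁ F₂ : (ℕ × ℕ → Prop) → ℝ≥0∞, Measurable F₁ → Measurable F₂ →
        ∫⁻ ω, F₁ (voidPattern D₁ fun i => X i ω) * F₂ (voidPattern D₂ fun i => X i ω) ∂P =
        ∫⁻ ω, (∫⁻ v, F₁ v ∂κ₁ (testMass D₁ (M ω))) * ∫⁻ v, F₂ v ∂κ₂ (testMass D₂ (M ω)) ∂P := by
  obtain ⟨κ₁, i₁, h₁⟩ := h.exists_kernel hX hM hfin hD₁
  obtain ⟨κ₂, i₂, h₂⟩ := h.exists_kernel hX hM hfin hD₂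
  refine ⟨κ₁, κ₂, i₁, i₂, fun F₁ F₂ hF₁ hF₂ => ?_⟩
  have hV₁ := measurable_voidPattern_comp hX hD₁
  have hV₂ := measurable_voidPattern_comp hX hD₂
  have hm₁ : Measurable fun ω => testMass D₁ (M ω) := (measurable_testMass hD₁).comp hM
  have hm₂ : Measurable fun ω => testMass D₂ (M ω) := (measurable_testMass hD₂).comp hM
  let κ := (κ₁.comap _ hm₁) ×ₖ (κ₂.comap _ hm₂)
  have hκ : ∀ ω, κ ω = (κ₁ (testMass D₁ (M ω))).prod (κ₂ (testMass D₂ (M ω))) := fun ω =>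
    Kernel.prod_apply _ _ _
  -- On the π-system of pairs of void events the joint law is a mean of products of exponentials, by
  -- the Cox property on disjoint sets, and so is the mixture of the product kernels.
  have hlaw : P.map (fun ω => (voidPattern D₁ (fun i => X i ω), voidPattern D₂ fun i => X i ω)) =
      P.bind κ := by
    have : IsProbabilityMeasure (P.map fun ω =>
        (voidPattern D₁ (fun i => X i ω), voidPattern D₂ fun i => X i ω)) :=
      Measure.isProbabilityMeasure_map (hV₁.prodMk hV₂).aemeasurable
    refine pattern_prod_measure_ext generateFrom_forall_mem.symm isPiSystem_forall_mem
      ⟨∅, by simp⟩ ?_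
    rintro _ ⟨t, rfl⟩ s
    have hts := (measurableSet_forall_mem t).prod (measurableSet_forall_mem s)
    rw [Measure.map_apply (hV₁.prodMk hV₂) hts, Measure.bind_apply hts κ.aemeasurable]
    have f : ∀ (D : Set (Plane × T)) (s : Finset (ℕ × ℕ)), ∀ᵐ ω ∂P, M ω (testUnion T s ∩ D) < ∞ :=
      fun D s => by
        filter_upwards [hfin s] with ω hω using (measure_mono Set.inter_subset_left).trans_lt hω
    have hv := h.measure_void_pair ((measurableSet_testUnion t).inter hD₁)
      ((measurableSet_testUnion s).inter hD₂)
      (hD.mono Set.inter_subset_right Set.inter_subset_right) (f D₁ t) (f D₂ s) MeasurableSet.univ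
    rw [Set.univ_inter, Measure.restrict_univ] at hv
    calc P {ω | (∀ e ∈ t, voidPattern D₁ (fun i => X i ω) e) ∧
          ∀ e ∈ s, voidPattern D₂ (fun i => X i ω) e}
        = P ({ω | ∀ e ∈ t, voidPattern D₁ (fun i => X i ω) e} ∩
          {ω | ∀ e ∈ s, voidPattern D₂ (fun i => X i ω) e}) := rfl
      _ = ∫⁻ ω, expNeg (testMass D₁ (M ω) t) * expNeg (testMass D₂ (M ω) s) ∂P := by
        simp_rw [forall_voidPattern_iff_pointMeasure hD₁, forall_voidPattern_iff_pointMeasure hD₂]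
        exact hv
      _ = _ := by
        refine lintegral_congr_ae ?_
        filter_upwards [h₁, h₂] with ω e₁ e₂
        rw [hκ, Measure.prod_prod, e₁, e₂]
  have hF : Measurable fun e : (ℕ × ℕ → Prop) × (ℕ × ℕ → Prop) => F₁ e.1 * F₂ e.2 :=
    (hF₁.comp measurable_fst).mul (hF₂.comp measurable_snd)
  calc ∫⁻ ω, F₁ (voidPattern D₁ fun i => X i ω) * F₂ (voidPattern D₂ fun i => X i ω) ∂P
      = ∫⁻ e, F₁ e.1 * F₂ e.2 ∂P.bind κ := by
        rw [← hlaw, lintegral_map hF (hV₁.prodMk hV₂)]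
    _ = ∫⁻ ω, ∫⁻ e, F₁ e.1 * F₂ e.2 ∂κ ω ∂P :=
        Measure.lintegral_bind κ.aemeasurable hF.aemeasurable
    _ = _ := by
        refine lintegral_congr fun ω => ?_
        rw [hκ, lintegral_prod_mul hF₁.aemeasurable hF₂.aemeasurable]

/-- With a deterministic directing measure the kernels have constant inputs, so the mixed integral
is a product. Replacing one of the two functions by the constant one identifies each factor. -/
theorem IsPoissonProcess.lintegral_mul_of_disjoint [T1Space T] [StandardBorelSpace T]
    {ν : Measure (Plane × T)} (h : IsPoissonProcess P ν fun ω => pointMeasure fun i => X i ω)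
    (hX : ∀ i, Measurable (X i)) (hgood : ∀ᵐ ω ∂P, IsGood fun i => X i ω)
    (hfin : ∀ s, ν (testUnion T s) < ∞)
    (hD₁ : MeasurableSet D₁) (hD₂ : MeasurableSet D₂) (hD : Disjoint D₁ D₂)
    {F₁ F₂ : (ℕ → Plane × T) → ℝ≥0∞} (hF₁ : Measurable F₁) (hF₂ : Measurable F₂)
    (inv₁ : ∀ x y, IsGood x → IsGood y → Set.range x ∩ D₁ = Set.range y ∩ D₁ → F₁ x = F₁ y)
    (inv₂ : ∀ x y, IsGood x → IsGood y → Set.range x ∩ D₂ = Set.range y ∩ D₂ → F₂ x = F₂ y) :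
    ∫⁻ ω, F₁ (fun i => X i ω) * F₂ (fun i => X i ω) ∂P =
      (∫⁻ ω, F₁ (fun i => X i ω) ∂P) * ∫⁻ ω, F₂ (fun i => X i ω) ∂P := by
  obtain ⟨κ₁, κ₂, i₁, i₂, hκ⟩ := IsCoxProcess.exists_kernels h hX measurable_const
    (fun s => Eventually.of_forall fun _ => hfin s) hD₁ hD₂ hD
  obtain ⟨G₁, hG₁, e₁⟩ := exists_eq_comp_voidPattern hD₁ hF₁ inv₁
  obtain ⟨G₂, hG₂, e₂⟩ := exists_eq_comp_voidPattern hD₂ hF₂ inv₂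
  have hmul := hκ G₁ G₂ hG₁ hG₂
  have hl := hκ G₁ (fun _ => 1) hG₁ measurable_const
  have hr := hκ (fun _ => 1) G₂ measurable_const hG₂
  simp only [mul_one, one_mul, lintegral_const, measure_univ] at hmul hl hr
  rw [← hl, ← hr] at hmul
  have a₁ : ∀ᵐ ω ∂P, F₁ (fun i => X i ω) = G₁ (voidPattern D₁ fun i => X i ω) := by
    filter_upwards [hgood] with ω hω using e₁ _ hω
  have a₂ : ∀ᵐ ω ∂P, F₂ (fun i => X i ω) = G₂ (voidPattern D₂ fun i => X i ω) := by
    filter_upwards [hgood] with ω hω using e₂ _ hω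
  rw [lintegral_congr_ae a₁, lintegral_congr_ae a₂, ← hmul]
  refine lintegral_congr_ae ?_
  filter_upwards [a₁, a₂] with ω h₁ h₂
  rw [h₁, h₂]

end Kernels

end CoxPercolation

namespace CoxPercolation

/-! ### Decorrelation of distant local events -/

section Decorrelation

/-- The balls of the Boolean model that meet the ball of radius `R` at `c`. -/
def meeting (c : Plane) (R : ℝ) : Set (Plane × ℝ) := {b | dist b.1 c < b.2 + R}

theorem measurableSet_meeting (c : Plane) (R : ℝ) : MeasurableSet (meeting c R) :=
  measurableSet_lt (by fun_prop) (by fun_prop)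

/-- The vertices located in the ball of radius `R` at `c`. -/
def verticesIn (c : Plane) (R : ℝ) : Set Vertex := {a | a.1 ∈ Metric.ball c R}

theorem measurableSet_verticesIn (c : Plane) (R : ℝ) : MeasurableSet (verticesIn c R) :=
  measurable_fst Metric.isOpen_ball.measurableSet

theorem coverMass_eq_zero {A : Set Vertex} {c : Plane} {R : ℝ} (hA : A ⊆ verticesIn c R)
    {b : Plane × ℝ} (hb : b ∉ meeting c R) : coverMass A b = 0 := by
  have : A ∩ {a | dist b.1 a.1 < b.2} = ∅ := by
    refine Set.eq_empty_of_forall_notMem fun a ha => hb ?_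
    have h1 : dist a.1 c < R := hA ha.1
    have h2 : dist b.1 a.1 < b.2 := ha.2
    have := dist_triangle b.1 a.1 c
    simp only [meeting, Set.mem_ofPred_eq]
    linarith
  rw [coverMass, this, measure_empty]

/-- The masses of the finite unions of test sets in `D` under the vertex intensity generated by the
balls in `K`. -/
def ballMass (lam φ : ℝ) (D : Set Vertex) (K : Set (Plane × ℝ)) (y : ℕ → Plane × ℝ)
    (s : Finset (ℕ × ℕ)) : ℝ≥0∞ :=
  ENNReal.ofReal lam *
    (ENNReal.ofReal φ * ∑' i, K.indicator (coverMass (testUnion Mark s ∩ D)) (y i))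

variable {lam φ : ℝ}

theorem measurable_ballMass {D : Set Vertex} {K : Set (Plane × ℝ)} (hD : MeasurableSet D)
    (hK : MeasurableSet K) : Measurable (ballMass lam φ D K) := by
  refine measurable_pi_lambda _ fun s => ?_
  have hm : Measurable (K.indicator (coverMass (testUnion Mark s ∩ D))) :=
    (measurable_coverMass ((measurableSet_testUnion s).inter hD)).indicator hK
  exact ((Measurable.tsum fun i => hm.comp (measurable_pi_apply i)).const_mul _).const_mul _

theorem ballMass_eq_of_range_inter_eq {D : Set Vertex} {K : Set (Plane × ℝ)}
    {x y : ℕ → Plane × ℝ} (hx : IsGood x) (hy : IsGood y)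
    (h : Set.range x ∩ K = Set.range y ∩ K) : ballMass lam φ D K x = ballMass lam φ D K y := by
  funext s
  have key : ∀ {z : ℕ → Plane × ℝ}, IsGood z → ∀ f : Plane × ℝ → ℝ≥0∞,
      ∑' i, K.indicator f (z i) = ∑' b : ↥(Set.range z ∩ K), f b := by
    intro z hz f
    rw [← tsum_range (g := z) (K.indicator f) hz.injective, Set.inter_comm,
      tsum_subtype (Set.range z) (K.indicator f), tsum_subtype (K ∩ Set.range z) f,
      Set.inter_comm, Set.indicator_indicator]
  rw [ballMass, ballMass, key hx, key hy, h]

/-- Balls that do not meet the window contribute nothing to it, so any `K` containing those present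
that do meet it gives the same masses. -/
theorem testMass_vertexIntensity {c : Plane} {R : ℝ} {K : Set (Plane × ℝ)} {y : ℕ → Plane × ℝ}
    (h : ∀ i, y i ∈ meeting c R → y i ∈ K) :
    testMass (verticesIn c R) (vertexIntensity lam φ y) =
      ballMass lam φ (verticesIn c R) K y := by
  funext s
  rw [testMass, vertexIntensity_apply_eq_tsum _ _ _
    ((measurableSet_testUnion s).inter (measurableSet_verticesIn c R)), ballMass]
  congr 2
  refine tsum_congr fun i => ?_
  by_cases hi : y i ∈ K
  · rw [Set.indicator_of_mem hi]
  · rw [Set.indicator_of_notMem hi]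
    exact coverMass_eq_zero Set.inter_subset_right fun hm => hi (h i hm)

theorem abs_toReal_lintegral_sub_le {Ω : Type*} [MeasurableSpace Ω] {P : Measure Ω}
    [IsProbabilityMeasure P] {f g : Ω → ℝ≥0∞} (hf : ∀ ω, f ω ≤ 1) (hg : ∀ ω, g ω ≤ 1) {N : Set Ω}
    (hN : MeasurableSet N) (h : ∀ ω, ω ∉ N → f ω = g ω) :
    |(∫⁻ ω, f ω ∂P).toReal - (∫⁻ ω, g ω ∂P).toReal| ≤ P.real N := by
  have key : ∀ {f g : Ω → ℝ≥0∞}, (∀ ω, f ω ≤ 1) → (∀ ω, g ω ≤ 1) →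
      (∀ ω, ω ∉ N → f ω = g ω) →
      (∫⁻ ω, f ω ∂P).toReal ≤ (∫⁻ ω, g ω ∂P).toReal + P.real N := by
    intro f g hf hg h
    have hg1 : ∫⁻ ω, g ω ∂P ≠ ∞ :=
      ((lintegral_mono hg).trans_lt (by simp)).ne
    have : ∫⁻ ω, f ω ∂P ≤ ∫⁻ ω, g ω ∂P + P N := by
      rw [← lintegral_indicator_one hN, ← lintegral_add_right _ (measurable_one.indicator hN)]
      refine lintegral_mono fun ω => ?_
      by_cases hω : ω ∈ N
      · rw [Set.indicator_of_mem hω]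
        exact (hf ω).trans le_add_self
      · rw [h ω hω]
        exact le_self_add
    rw [Measure.real, ← ENNReal.toReal_add hg1 (measure_ne_top P N)]
    exact ENNReal.toReal_mono (ENNReal.add_ne_top.2 ⟨hg1, measure_ne_top P N⟩) this
  have h1 := key hf hg h
  have h2 := key hg hf fun ω hω => (h ω hω).symm
  rw [abs_le]
  constructor <;> linarith

theorem toReal_lintegral_le_one {Ω : Type*} [MeasurableSpace Ω] {P : Measure Ω}
    [IsProbabilityMeasure P] {f : Ω → ℝ≥0∞} (hf : ∀ ω, f ω ≤ 1) : (∫⁻ ω, f ω ∂P).toReal ≤ 1 := by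
  refine ENNReal.toReal_le_of_le_ofReal zero_le_one ?_
  exact (lintegral_mono hf).trans (by simp)

variable {Ω : Type*} [MeasurableSpace Ω] {P : Measure Ω} [IsProbabilityMeasure P] {β τ : ℝ}
  {p : Vertex → Vertex → ℝ} {Y : ℕ → Ω → Plane × ℝ} {X : ℕ → Ω → Vertex} {g : Ω → SimpleGraph ℕ}

theorem IsCoxModel.measure_exists_ball_le (h : IsCoxModel P β τ φ p lam Y X g) (hτ : 0 < τ)
    (hβ : 0 < β) {K : Set (Plane × ℝ)} (hK : MeasurableSet K) :
    P {ω | ∃ i, Y i ω ∈ K} ≤ ballIntensity τ β K := by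
  rw [← h.balls_intensity hτ hβ, Measure.sum_apply _ hK, Set.ofPred_exists]
  refine (measure_iUnion_le _).trans (ENNReal.tsum_le_tsum fun i => ?_)
  rw [Measure.map_apply (h.measurable_Y i) hK]
  rfl

/-- The conditional probability of a local event given the vertices. -/
theorem IsConnectionFunction.exists_edgeProb_eq (hp : IsConnectionFunction p)
    {E : Set GeometricGraph} (hE : IsObservable E) {c : Plane} {R : ℝ}
    (hloc : IsLocal (Metric.ball c R) E) : ∃ F : (ℕ × ℕ → Prop) → ℝ≥0∞, Measurable F ∧
      (∀ v, F v ≤ 1) ∧ ∀ x, IsGood x → edgeProb p E x = F (voidPattern (verticesIn c R) x) := by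
  have hsub : Metric.ball c R ⊆ Metric.ball 0 (‖c‖ + R) := fun z hz => by
    rw [Metric.mem_ball] at hz ⊢
    have := dist_triangle z c 0
    rw [dist_zero_right c] at this
    linarith
  obtain ⟨F, hF, h⟩ := exists_eq_comp_voidPattern (measurableSet_verticesIn c R)
    (hp.measurable_edgeProb hE) (hp.edgeProb_eq_of_range_inter_eq hE hsub hloc)
  refine ⟨fun v => min (F v) 1, hF.min measurable_const, fun v => min_le_right _ _,
    fun x hx => ?_⟩
  change _ = min (F _) 1
  rw [← h x hx, min_eq_left (edgeProb_le_one E x)]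

/-- Given the environment the two events are independent, so only the dependence between the
environments in the two windows matters, and it is carried by the balls that meet both. Discarding
these balls makes the conditional probabilities independent, at an error bounded by the probability
that such a ball exists. -/
theorem IsCoxModel.abs_measure_inter_sub_le (h : IsCoxModel P β τ φ p lam Y X g)
    (hp : IsConnectionFunction p) (hτ : 0 < τ) (hβ : 0 < β) {E₁ E₂ : Set GeometricGraph}
    (hE₁ : IsObservable E₁) (hE₂ : IsObservable E₂) {c₁ c₂ : Plane} {R : ℝ}
    (loc₁ : IsLocal (Metric.ball c₁ R) E₁) (loc₂ : IsLocal (Metric.ball c₂ R) E₂)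
    (hc : Disjoint (Metric.ball c₁ R) (Metric.ball c₂ R)) :
    |P.real {ω | embed (fun i => X i ω) (g ω) ∈ E₁ ∩ E₂} -
      P.real {ω | embed (fun i => X i ω) (g ω) ∈ E₁} *
        P.real {ω | embed (fun i => X i ω) (g ω) ∈ E₂}| ≤
      3 * P.real {ω | ∃ i, Y i ω ∈ meeting c₁ R ∩ meeting c₂ R} := by
  have hD₁ := measurableSet_verticesIn c₁ R
  have hD₂ := measurableSet_verticesIn c₂ R
  have hH₁ := measurableSet_meeting c₁ R
  have hH₂ := measurableSet_meeting c₂ R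
  have hD : Disjoint (verticesIn c₁ R) (verticesIn c₂ R) := hc.preimage Prod.fst
  obtain ⟨F₁, mF₁, bF₁, eF₁⟩ := hp.exists_edgeProb_eq hE₁ loc₁
  obtain ⟨F₂, mF₂, bF₂, eF₂⟩ := hp.exists_edgeProb_eq hE₂ loc₂
  obtain ⟨κ₁, κ₂, i₁, i₂, hκ⟩ := h.cox_vertices.exists_kernels h.measurable_X
    (measurable_vertexIntensity lam φ h.measurable_Y) (fun s => by
      obtain ⟨n, hn⟩ := testUnion_bounded (T := Mark) s
      exact h.vertexIntensity_lt_top hτ hβ (measurableSet_testUnion s)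
        (volume_prod_lt_top_of_subset_locBall _ hn)) hD₁ hD₂ hD
  have hgood := h.vertices_isGood hτ hβ
  let k₁ : (Finset (ℕ × ℕ) → ℝ≥0∞) → ℝ≥0∞ := fun m => ∫⁻ v, F₁ v ∂κ₁ m
  let k₂ : (Finset (ℕ × ℕ) → ℝ≥0∞) → ℝ≥0∞ := fun m => ∫⁻ v, F₂ v ∂κ₂ m
  have mk₁ : Measurable k₁ := mF₁.lintegral_kernel
  have mk₂ : Measurable k₂ := mF₂.lintegral_kernel
  have bk₁ : ∀ m, k₁ m ≤ 1 := fun m => (lintegral_mono bF₁).trans (by simp)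
  have bk₂ : ∀ m, k₂ m ≤ 1 := fun m => (lintegral_mono bF₂).trans (by simp)
  let M : Ω → Measure Vertex := fun ω => vertexIntensity lam φ fun i => Y i ω
  let f₁ : Ω → ℝ≥0∞ := fun ω => k₁ (testMass (verticesIn c₁ R) (M ω))
  let f₂ : Ω → ℝ≥0∞ := fun ω => k₂ (testMass (verticesIn c₂ R) (M ω))
  -- Same kernel, but fed with the environment generated only by the balls that meet this window and
  -- not the other.
  let G₁ : (ℕ → Plane × ℝ) → ℝ≥0∞ := fun y =>
    k₁ (ballMass lam φ (verticesIn c₁ R) (meeting c₁ R \ meeting c₂ R) y)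
  let G₂ : (ℕ → Plane × ℝ) → ℝ≥0∞ := fun y =>
    k₂ (ballMass lam φ (verticesIn c₂ R) (meeting c₂ R \ meeting c₁ R) y)
  have p₁ : P {ω | embed (fun i => X i ω) (g ω) ∈ E₁} = ∫⁻ ω, f₁ ω ∂P := by
    have := hκ F₁ (fun _ => 1) mF₁ measurable_const
    simp only [mul_one, lintegral_const, measure_univ] at this
    rw [h.measure_event hp hE₁]
    refine Eq.trans (lintegral_congr_ae ?_) this
    filter_upwards [hgood] with ω hω using eF₁ _ hω
  have p₂ : P {ω | embed (fun i => X i ω) (g ω) ∈ E₂} = ∫⁻ ω, f₂ ω ∂P := by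
    have := hκ (fun _ => 1) F₂ measurable_const mF₂
    simp only [one_mul, lintegral_const, measure_univ] at this
    rw [h.measure_event hp hE₂]
    refine Eq.trans (lintegral_congr_ae ?_) this
    filter_upwards [hgood] with ω hω using eF₂ _ hω
  have p₁₂ : P {ω | embed (fun i => X i ω) (g ω) ∈ E₁ ∩ E₂} = ∫⁻ ω, f₁ ω * f₂ ω ∂P := by
    rw [h.measure_event hp (E := E₁ ∩ E₂) (MeasurableSet.inter hE₁ hE₂)]
    refine Eq.trans (lintegral_congr_ae ?_) (hκ F₁ F₂ mF₁ mF₂)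
    filter_upwards [hgood] with ω hω
    rw [hp.edgeProb_inter hE₁ hE₂ loc₁ loc₂ hc, eF₁ _ hω, eF₂ _ hω]
  have hprod : ∫⁻ ω, G₁ (fun i => Y i ω) * G₂ (fun i => Y i ω) ∂P =
      (∫⁻ ω, G₁ (fun i => Y i ω) ∂P) * ∫⁻ ω, G₂ (fun i => Y i ω) ∂P := by
    refine IsPoissonProcess.lintegral_mul_of_disjoint h.poisson_balls h.measurable_Y
      (h.balls_isGood hτ hβ) (fun s => ?_) (hH₁.diff hH₂) (hH₂.diff hH₁)
      (Set.disjoint_left.2 fun b hb hb' => hb.2 hb'.1)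
      (mk₁.comp (measurable_ballMass hD₁ (hH₁.diff hH₂)))
      (mk₂.comp (measurable_ballMass hD₂ (hH₂.diff hH₁)))
      (fun x y hx hy hxy => congrArg k₁ (ballMass_eq_of_range_inter_eq hx hy hxy))
      (fun x y hx hy hxy => congrArg k₂ (ballMass_eq_of_range_inter_eq hx hy hxy))
    obtain ⟨n, hn⟩ := testUnion_bounded (T := ℝ) s
    exact (measure_mono hn).trans_lt (ballIntensity_locBall_lt_top hτ hβ n)
  let N : Set Ω := {ω | ∃ i, Y i ω ∈ meeting c₁ R ∩ meeting c₂ R}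
  have hN : MeasurableSet N := by
    simp only [N, Set.ofPred_exists]
    exact MeasurableSet.iUnion fun i => h.measurable_Y i (hH₁.inter hH₂)
  have e₁ : ∀ ω, ω ∉ N → f₁ ω = G₁ (fun i => Y i ω) := fun ω hω =>
    congrArg k₁ (testMass_vertexIntensity fun i hi => ⟨hi, fun hi' => hω ⟨i, hi, hi'⟩⟩)
  have e₂ : ∀ ω, ω ∉ N → f₂ ω = G₂ (fun i => Y i ω) := fun ω hω =>
    congrArg k₂ (testMass_vertexIntensity fun i hi => ⟨hi, fun hi' => hω ⟨i, hi', hi⟩⟩)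
  have d₁ := abs_toReal_lintegral_sub_le (P := P) (fun _ => bk₁ _) (fun _ => bk₁ _) hN e₁
  have d₂ := abs_toReal_lintegral_sub_le (P := P) (fun _ => bk₂ _) (fun _ => bk₂ _) hN e₂
  have d₁₂ := abs_toReal_lintegral_sub_le (P := P) (f := fun ω => f₁ ω * f₂ ω)
    (g := fun ω => G₁ (fun i => Y i ω) * G₂ (fun i => Y i ω))
    (fun _ => mul_le_one' (bk₁ _) (bk₂ _)) (fun _ => mul_le_one' (bk₁ _) (bk₂ _)) hN
    fun ω hω => by rw [e₁ ω hω, e₂ ω hω]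
  have b₁ : (∫⁻ ω, f₁ ω ∂P).toReal ≤ 1 := toReal_lintegral_le_one fun _ => bk₁ _
  have b₂ : (∫⁻ ω, G₂ (fun i => Y i ω) ∂P).toReal ≤ 1 := toReal_lintegral_le_one fun _ => bk₂ _
  rw [hprod, ENNReal.toReal_mul] at d₁₂
  rw [Measure.real, Measure.real, Measure.real, p₁, p₂, p₁₂]
  have n₁ : 0 ≤ (∫⁻ ω, f₁ ω ∂P).toReal := ENNReal.toReal_nonneg
  have n₂ : 0 ≤ (∫⁻ ω, G₂ (fun i => Y i ω) ∂P).toReal := ENNReal.toReal_nonneg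
  generalize (∫⁻ ω, f₁ ω * f₂ ω ∂P).toReal = a at *
  generalize (∫⁻ ω, f₁ ω ∂P).toReal = b at *
  generalize (∫⁻ ω, f₂ ω ∂P).toReal = c at *
  generalize (∫⁻ ω, G₁ (fun i => Y i ω) ∂P).toReal = b' at *
  generalize (∫⁻ ω, G₂ (fun i => Y i ω) ∂P).toReal = c' at *
  have q0 : 0 ≤ P.real N := measureReal_nonneg
  change _ ≤ 3 * P.real N
  generalize P.real N = q at *
  -- Three replacements, in the joint probability and in each of the two factors, each cost at most
  -- `q`.
  calc |a - b * c| = |(a - b' * c') - (b - b') * c' - b * (c - c')| := by congr 1; ring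
    _ ≤ |a - b' * c'| + |(b - b') * c'| + |b * (c - c')| :=
      (abs_sub _ _).trans (add_le_add_left (abs_sub _ _) _)
    _ ≤ q + q * 1 + 1 * q := by
      rw [abs_mul, abs_mul, abs_of_nonneg n₁, abs_of_nonneg n₂]
      gcongr
    _ = 3 * q := by ring

end Decorrelation

end CoxPercolation

namespace CoxPercolation

/-! ### Polynomial mixing -/

section Mixing

variable {β τ : ℝ}

/-- The centres of the windows are at least `10 * r` apart, so `10 * r < 2 * s + 6 * r` and `s > 2 *
r`. Then the centre of the ball has norm below `s + 3 * r < 5 / 2 * s`. -/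
theorem meeting_inter_subset {x : Plane} (hx : 10 ≤ ‖x‖) {r : ℝ} (hr : 0 < r) :
    meeting 0 (3 * r) ∩ meeting (r • x) (3 * r) ⊆
      {b | 2 * r < b.2 ∧ b.1 ∈ Metric.ball 0 (5 / 2 * b.2)} := by
  rintro ⟨c, s⟩ ⟨h1, h2⟩
  simp only [meeting, Set.mem_ofPred_eq, Metric.mem_ball] at h1 h2 ⊢
  have h3 := dist_triangle_left (0 : Plane) (r • x) c
  rw [dist_zero_left, norm_smul, Real.norm_eq_abs, abs_of_pos hr] at h3
  have h4 : r * 10 ≤ r * ‖x‖ := by gcongr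
  constructor <;> linarith

/-- For each radius `s > 2 * r` the admissible centres fill a disc of radius `5 / 2 * s`. Its area
times the Pareto density is of order `s ^ (1 - β)`, which is integrable at infinity because `β > 2`.
-/
theorem ballIntensity_meeting_inter_le (hβ : 2 < β) (hτ : 0 < τ) {x : Plane} (hx : 10 ≤ ‖x‖)
    {r : ℝ} (hr : 0 < r) :
    ballIntensity τ β (meeting 0 (3 * r) ∩ meeting (r • x) (3 * r)) ≤
      ENNReal.ofReal (β * τ ^ β * (5 / 2) ^ 2 * (2 ^ (2 - β) / (β - 2)) * r ^ (2 - β)) *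
        volume (Metric.ball (0 : Plane) 1) := by
  have hm : MeasurableSet {b : Plane × ℝ | 2 * r < b.2 ∧ b.1 ∈ Metric.ball 0 (5 / 2 * b.2)} := by
    have h1 : MeasurableSet {b : Plane × ℝ | 2 * r < b.2} :=
      measurableSet_lt (by fun_prop) (by fun_prop)
    have h2 : MeasurableSet {b : Plane × ℝ | dist b.1 0 < 5 / 2 * b.2} :=
      measurableSet_lt (by fun_prop) (by fun_prop)
    exact h1.inter h2
  refine (measure_mono (meeting_inter_subset hx hr)).trans ?_
  have hpdf : Measurable (paretoPDF τ β) := (measurable_paretoPDFReal τ β).ennreal_ofReal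
  have hint : IntegrableOn (fun s : ℝ => β * τ ^ β * (5 / 2) ^ 2 * s ^ (1 - β))
      (Set.Ioi (2 * r)) :=
    (integrableOn_Ioi_rpow_of_lt (by linarith) (by linarith)).const_mul _
  have hpos : ∀ s ∈ Set.Ioi (2 * r), 0 ≤ β * τ ^ β * (5 / 2) ^ 2 * s ^ (1 - β) := by
    intro s hs
    have : 0 < s := lt_trans (by linarith) hs
    positivity
  rw [ballIntensity, Measure.prod_apply_symm hm, paretoMeasure,
    lintegral_withDensity_eq_lintegral_mul _ hpdf (measurable_measure_prodMk_right hm)]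
  calc ∫⁻ s, (paretoPDF τ β * fun s => volume ((fun c : Plane => (c, s)) ⁻¹'
          {b : Plane × ℝ | 2 * r < b.2 ∧ b.1 ∈ Metric.ball 0 (5 / 2 * b.2)})) s
      ≤ ∫⁻ s in Set.Ioi (2 * r), ENNReal.ofReal (β * τ ^ β * (5 / 2) ^ 2 * s ^ (1 - β)) *
          volume (Metric.ball (0 : Plane) 1) := by
        rw [← lintegral_indicator measurableSet_Ioi]
        refine lintegral_mono fun s => ?_
        simp only [Pi.mul_apply]
        by_cases hs : 2 * r < s
        · have h0 : 0 < s := by linarith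
          rw [Set.indicator_of_mem (show s ∈ Set.Ioi (2 * r) from hs)]
          have hset : (fun c : Plane => (c, s)) ⁻¹' {b : Plane × ℝ | 2 * r < b.2 ∧
              b.1 ∈ Metric.ball 0 (5 / 2 * b.2)} = Metric.ball 0 (5 / 2 * s) := by
            ext c; simp [hs]
          rw [hset, Measure.addHaar_ball volume (0 : Plane) (by positivity : 0 ≤ 5 / 2 * s),
            finrank_euclideanSpace_fin, ← mul_assoc]
          gcongr
          -- Below `τ` the density vanishes, so the power-law bound holds for all `s > 2 * r`,
          -- however `2 * r` compares with `τ`.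
          by_cases hτs : τ ≤ s
          · rw [paretoPDF_of_le hτs, ← ENNReal.ofReal_mul (by positivity)]
            refine (congrArg _ ?_).le
            have : s ^ (1 - β) = s ^ (-(β + 1)) * s ^ 2 := by
              rw [← Real.rpow_natCast s 2, ← Real.rpow_add h0]
              congr 1
              push_cast
              ring
            rw [this]
            ring
          · rw [paretoPDF_of_lt (not_le.1 hτs)]
            simp
        · have hset : (fun c : Plane => (c, s)) ⁻¹' {b : Plane × ℝ | 2 * r < b.2 ∧
              b.1 ∈ Metric.ball 0 (5 / 2 * b.2)} = ∅ := by
            ext c; simp [hs]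
          rw [hset]
          simp
    _ = _ := by
        rw [lintegral_mul_const _ (by fun_prop),
          ← ofReal_integral_eq_lintegral_ofReal hint
            ((ae_restrict_iff' measurableSet_Ioi).2 (Eventually.of_forall hpos)),
          integral_const_mul, integral_Ioi_rpow_of_lt (by linarith) (by linarith)]
        congr 2
        rw [show 1 - β + 1 = 2 - β by ring, Real.mul_rpow (by norm_num) hr.le]
        have : 2 - β ≠ 0 := by linarith
        have : β - 2 ≠ 0 := by linarith
        field_simp
        ring

/-- After division by `log r` the constant contributes `log C / log r`, which tends to zero.
Monotonicity of the extended logarithm also covers the values where `f r = 0`. -/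
theorem limsup_log_div_log_le {f : ℝ → ℝ} {C ξ : ℝ} (hC : 0 < C)
    (h : ∀ᶠ r in atTop, |f r| ≤ C * r ^ ξ) :
    limsup (fun r : ℝ => ENNReal.log (ENNReal.ofReal |f r|) / ((Real.log r : ℝ) : EReal)) atTop ≤
      (ξ : EReal) := by
  have ht : Tendsto (fun r : ℝ => (((Real.log C / Real.log r + ξ : ℝ)) : EReal)) atTop
      (𝓝 (ξ : EReal)) := by
    refine (continuous_coe_real_ereal.tendsto _).comp ?_
    simpa using (Real.tendsto_log_atTop.const_div_atTop (Real.log C)).add_const ξ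
  rw [← ht.limsup_eq]
  refine limsup_le_limsup ?_
  filter_upwards [h, eventually_gt_atTop 1] with r hr h1
  have hlog : 0 < Real.log r := Real.log_pos h1
  have h0 : 0 < r := by linarith
  have hpos : 0 < C * r ^ ξ := mul_pos hC (Real.rpow_pos_of_pos h0 _)
  have e : Real.log C / Real.log r + ξ = Real.log (C * r ^ ξ) / Real.log r := by
    rw [Real.log_mul hC.ne' (Real.rpow_pos_of_pos h0 _).ne', Real.log_rpow h0]
    field_simp
  rw [e, EReal.coe_div, ← ENNReal.log_ofReal_of_pos hpos]
  exact EReal.div_le_div_right_of_nonneg (by exact_mod_cast hlog.le)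
    (ENNReal.log_le_log (ENNReal.ofReal_le_ofReal hr))

variable {Ω : Type*} [MeasurableSpace Ω] {P : Measure Ω} [IsProbabilityMeasure P] {φ lam : ℝ}
  {p : Vertex → Vertex → ℝ} {Y : ℕ → Ω → Plane × ℝ} {X : ℕ → Ω → Vertex} {g : Ω → SimpleGraph ℕ}

theorem covariance_indicator_one {A B : Set Ω} (hA : MeasurableSet A) (hB : MeasurableSet B) :
    cov[A.indicator (fun _ => (1 : ℝ)), B.indicator (fun _ => (1 : ℝ)); P] =
      P.real (A ∩ B) - P.real A * P.real B := by
  have hm : ∀ {A : Set Ω}, MeasurableSet A → MemLp (A.indicator fun _ => (1 : ℝ)) 2 P :=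
    fun hA => (memLp_const 1).indicator hA
  have hAB : A.indicator (fun _ => (1 : ℝ)) * B.indicator (fun _ => (1 : ℝ)) =
      (A ∩ B).indicator fun _ => (1 : ℝ) := by
    funext ω
    rw [Pi.mul_apply, ← Set.inter_indicator_mul]
    simp
  rw [covariance_eq_sub (hm hA) (hm hB), hAB, integral_indicator_const _ hA,
    integral_indicator_const _ hB,
    integral_indicator_const _ (hA.inter hB)]
  simp

theorem IsCoxModel.abs_crossingCov_le (h : IsCoxModel P β τ φ p lam Y X g)
    (hp : IsConnectionFunction p) (hτ : 0 < τ) (hβ : 2 < β) {x : Plane} (hx : 10 ≤ ‖x‖) {r : ℝ}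
    (hr : 0 < r) :
    |crossingCov P (fun ω => embed (fun i => X i ω) (g ω)) x r| ≤
      3 * (β * τ ^ β * (5 / 2) ^ 2 * (2 ^ (2 - β) / (β - 2)) *
        volume.real (Metric.ball (0 : Plane) 1)) * r ^ (2 - β) := by
  have hβ0 : 0 < β := by linarith
  have o₁ := isObservable_localCrossing 0 r
  have o₂ := isObservable_localCrossing (r • x) r
  have hdisj : Disjoint (Metric.ball (0 : Plane) (3 * r)) (Metric.ball (r • x) (3 * r)) := by
    refine Metric.ball_disjoint_ball ?_
    rw [dist_zero_left, norm_smul, Real.norm_eq_abs, abs_of_pos hr]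
    nlinarith
  have key := h.abs_measure_inter_sub_le hp hτ hβ0 o₁ o₂ (isLocal_localCrossing 0 r)
    (isLocal_localCrossing (r • x) r) hdisj
  have hcov : crossingCov P (fun ω => embed (fun i => X i ω) (g ω)) x r = _ :=
    covariance_indicator_one (h.measurable_labelled o₁) (h.measurable_labelled o₂)
  rw [hcov]
  refine key.trans ?_
  rw [mul_assoc]
  refine mul_le_mul_of_nonneg_left ?_ (by norm_num)
  have hq := (h.measure_exists_ball_le hτ hβ0 ((measurableSet_meeting 0 (3 * r)).inter
    (measurableSet_meeting (r • x) (3 * r)))).trans (ballIntensity_meeting_inter_le hβ hτ hx hr)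
  have hβ2 : 0 < β - 2 := by linarith
  refine (ENNReal.toReal_mono (ENNReal.mul_ne_top ENNReal.ofReal_ne_top
    measure_ball_lt_top.ne) hq).trans (le_of_eq ?_)
  rw [ENNReal.toReal_mul, ENNReal.toReal_ofReal (by positivity), Measure.real]
  ring

theorem IsCoxModel.isPolynomiallyMixing (h : IsCoxModel P β τ φ p lam Y X g)
    (hp : IsConnectionFunction p) (hτ : 0 < τ) (hβ : 2 < β) :
    IsPolynomiallyMixing P (fun ω => embed (fun i => X i ω) (g ω)) (2 - β) := by
  have hβ2 : 0 < β - 2 := by linarith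
  have hv : 0 < volume.real (Metric.ball (0 : Plane) 1) :=
    ENNReal.toReal_pos (Metric.measure_ball_pos volume _ one_pos).ne' measure_ball_lt_top.ne
  refine ⟨by linarith, fun x hx => limsup_log_div_log_le
    (C := 3 * (β * τ ^ β * (5 / 2) ^ 2 * (2 ^ (2 - β) / (β - 2)) *
      volume.real (Metric.ball (0 : Plane) 1))) (by positivity) ?_⟩
  filter_upwards [eventually_gt_atTop 0] with r hr using h.abs_crossingCov_le hp hτ hβ hx hr

end Mixing

end CoxPercolation

end

/-! ### The theorem. -/

theorem proposition3p2
    (β τ φ : ℝ) (hβ : 2 < β) (hτ : 0 < τ) (hφ : 0 < φ)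
    (p : CoxPercolation.Vertex → CoxPercolation.Vertex → ℝ)
    (hp : CoxPercolation.IsConnectionFunction p)
    {Ω : ℝ → Type*} [∀ l, MeasurableSpace (Ω l)]
    (P : ∀ l, Measure (Ω l)) [∀ l, IsProbabilityMeasure (P l)]
    (Y : ∀ l, ℕ → Ω l → CoxPercolation.Plane × ℝ)
    (X : ∀ l, ℕ → Ω l → CoxPercolation.Vertex)
    (g : ∀ l, Ω l → SimpleGraph ℕ)
    (hmodel : ∀ l, 0 < l → CoxPercolation.IsCoxModel (P l) β τ φ p l (Y l) (X l) (g l)) :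
    (∀ l, 0 < l →
      CoxPercolation.IsStationarySimple (P l) l
        (fun ω => CoxPercolation.pointMeasure fun i => (X l i ω).1) ∧
      CoxPercolation.IsTranslationInvariant (P l)
        (fun ω => CoxPercolation.embed (fun i => X l i ω) (g l ω)) ∧
      CoxPercolation.IsLocallyFinite (P l)
        (fun ω => CoxPercolation.embed (fun i => X l i ω) (g l ω)) ∧
      (CoxPercolation.NonincreasingInDistance p →
        CoxPercolation.ConnectionDecreasesInDistance (P l) (X l) (g l)) ∧
      CoxPercolation.IsPolynomiallyMixing (P l)
        (fun ω => CoxPercolation.embed (fun i => X l i ω) (g l ω)) (2 - β)) ∧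
    CoxPercolation.IsMonotoneFamily P
      (fun l ω => CoxPercolation.embed (fun i => X l i ω) (g l ω)) := by
  have hβ' : 0 < β := by linarith
  refine ⟨fun l hl => ?_, fun l l' hl hlt E hE hup => ?_⟩
  · have h := hmodel l hl
    exact ⟨h.isStationarySimple hτ hβ', h.isTranslationInvariant hp hτ hβ',
      h.isLocallyFinite hp hτ hβ', h.connectionDecreasesInDistance hp hτ hβ',
      h.isPolynomiallyMixing hp hτ hβ⟩
  · exact (hmodel l hl).measure_event_le (hmodel l' (hl.trans hlt)) hp hτ hβ' hl hlt hE hup
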